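/- Let $\mathbf{SU}(2)$ carry the left-invariant vector fields $X,Y,Z$ associated with the matrices $\begin{pmatrix}0&1\\-1&0\end{pmatrix}$, $\begin{pmatrix}0&i\\ i&0\end{pmatrix}$, $\begin{pmatrix}i&0\\0&-i\end{pmatrix}$, let $\mathcal L=X^2+Y^2$, and let $p_t$ ($t>0$) be the heat kernel of $e^{t\mathcal L}$ issued from the identity, with respect to the normalized Haar measure $\mu$; that is, $p_t$ is continuous and for all smooth $\varphi$ one has $\frac{d}{dt}\int\varphi\,p_t\,d\mu=\int(\mathcal L\varphi)\,p_t\,d\mu$ for $t>0$, and $\int\varphi\,p_t\,d\mu\to\varphi(1)$ as $t\to0^+$. Write $p_t(r,z)$ for its value at the point $$\exp(r\cos\vartheta\,X+r\sin\vartheta\,Y)\exp(zZ)=\begin{pmatrix}\cos r\,e^{iz}&\sin r\,e^{i(\vartheta-z)}\\-\sin r\,e^{-i(\vartheta-z)}&\cos r\,e^{-iz}\end{pmatrix},$$ which does not depend on $\vartheta\in\mathbb R$ (each assertion below holds for every $\vartheta$). 1. For $t>0$ and $z\in[0,\pi]$, $$p_t(0,z)=\frac{\pi^2e^t}{4t^2}\,e^{-\frac{2\pi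 z-z^2}{4t}}\sum_{k\in\mathbb Z}e^{-\frac{k(k+1)\pi^2}{t}}\,\frac{(2k+1)+2k\,e^{-\frac{\pi}{2t}(z+2k\pi)}}{\bigl(1+e^{-\frac{\pi}{2t}(z+2k\pi)}\bigr)^2},$$ the series being absolutely convergent. Consequently, for every $z\in(0,\pi]$ there is $C>0$ (depending on $z$) such that, as $t\to0^+$, $$p_t(0,z)=\frac{\pi^2e^t}{4t^2}\,e^{-\frac{2\pi z-z^2}{4t}}\bigl(1+O(e^{-C/t})\bigr).$$ 2. For $r\in(0,\frac\pi2)$, as $t\to0^+$, $$p_t(r,0)\sim\frac{r}{\sin r}\sqrt{\frac{1}{1-r\cot r}}\;\frac{\sqrt\pi\,e^{-\frac{r^2}{4t}}}{4t^{3/2}}.$$ 3. Let $r\in(0,\frac\pi2)$ and $z\in[-\pi,\pi]$. The equation $$\theta-z=\cos r\,\sin\theta\,\frac{\arccos(\cos\theta\cos r)}{\sqrt{1-\cos^2r\cos^2\theta}}$$ has a unique solution $\theta=\theta(r,z)$ in $[-\pi,\pi]$, and, with $u=\cos r\cos\theta(r,z)$, as $t\to0^+$, $$p_t(r,z)\sim\frac1{\sin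 r}\,\frac{\arccos u}{\sqrt{1-\frac{u\arccos u}{\sqrt{1-u^2}}}}\;\frac{\sqrt\pi\,e^{-\frac{d^2}{4t}}}{4t^{3/2}},\qquad d^2=\frac{(\theta(r,z)-z)^2\tan^2r}{\sin^2\theta(r,z)},$$ where for $\sin\theta(r,z)=0$ (that is, $z\in\{-\pi,0,\pi\}$) the quotient $d^2$, which reads $0/0$, stands for its limit value $(\arccos u)^2$. -/

import Mathlib

open Real Set Filter Topology MeasureTheory Asymptotics
open scoped ContDiff

/-- The group `SU(2)` of `2 × 2` complex unitary matrices of determinant `1`, with the topology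
induced by that of the matrices. -/
abbrev SU2 : Type := ↥(Matrix.specialUnitaryGroup (Fin 2) ℂ)

noncomputable section

instance SU2.instMeasurableSpace : MeasurableSpace SU2 := borel SU2

instance SU2.instBorelSpace : BorelSpace SU2 := ⟨rfl⟩

instance SU2.instIsTopologicalGroup : IsTopologicalGroup SU2 where
  continuous_mul := continuous_mul
  continuous_inv := by
    refine Continuous.subtype_mk ?_ _
    exact Continuous.star continuous_subtype_val

instance SU2.instCompactSpace : CompactSpace SU2 := by
  refine isCompact_iff_compactSpace.1 ?_
  have hK : IsCompact
      (Set.pi Set.univ fun _ : Fin 2 => Set.pi Set.univ fun _ : Fin 2 =>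
        Metric.closedBall (0 : ℂ) 1) :=
    isCompact_univ_pi fun _ => isCompact_univ_pi fun _ => isCompact_closedBall _ _
  have hcl : IsClosed
      ((Matrix.specialUnitaryGroup (Fin 2) ℂ : Set (Matrix (Fin 2) (Fin 2) ℂ))) := by
    have h : ((Matrix.specialUnitaryGroup (Fin 2) ℂ : Set (Matrix (Fin 2) (Fin 2) ℂ))) =
        {A | A * star A = 1} ∩ {A | A.det = 1} := by
      ext A
      simp [Matrix.mem_specialUnitaryGroup_iff, Matrix.mem_unitaryGroup_iff]
    rw [h]
    exact (isClosed_eq (continuous_id.mul continuous_id.star) continuous_const).inter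
      (isClosed_eq (Continuous.matrix_det continuous_id) continuous_const)
  refine hK.of_isClosed_subset hcl ?_
  intro A hA i _ j _
  rw [mem_closedBall_zero_iff]
  exact entry_norm_bound_of_unitary (Matrix.mem_specialUnitaryGroup_iff.1 hA).1 i j

/-- The bi-invariant Haar measure of `SU(2)`, normalized to have total mass `1`. -/
def SU2.haar : Measure SU2 := Measure.haarMeasure ⊤

theorem SU2.mem_of_row (a b : ℂ) (h : a * star a + b * star b = 1) :
    !![a, b; -star b, star a] ∈ Matrix.specialUnitaryGroup (Fin 2) ℂ := by
  rw [Matrix.mem_specialUnitaryGroup_iff, Matrix.mem_unitaryGroup_iff]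
  constructor
  · ext i j
    fin_cases i <;> fin_cases j <;>
      simp [Matrix.mul_apply, Fin.sum_univ_two, Matrix.star_apply] <;>
      simp only [Complex.star_def] at h
    · exact h
    · ring
    · ring
    · linear_combination h
  · rw [Matrix.det_fin_two_of]
    linear_combination h

theorem SU2.cyl_mem (r ϑ z : ℝ) :
    !![(cos r : ℂ) * Complex.exp (z * Complex.I),
        (sin r : ℂ) * Complex.exp ((ϑ - z) * Complex.I);
      -((sin r : ℂ) * Complex.exp (-((ϑ - z) * Complex.I))),
        (cos r : ℂ) * Complex.exp (-(z * Complex.I))] ∈ Matrix.specialUnitaryGroup (Fin 2) ℂ := by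
  have c1 : star ((cos r : ℂ) * Complex.exp (z * Complex.I)) =
      (cos r : ℂ) * Complex.exp (-(z * Complex.I)) := by
    rw [Complex.star_def, map_mul, ← Complex.exp_conj, Complex.conj_ofReal]; simp
  have c2 : star ((sin r : ℂ) * Complex.exp ((ϑ - z) * Complex.I)) =
      (sin r : ℂ) * Complex.exp (-((ϑ - z) * Complex.I)) := by
    rw [Complex.star_def, map_mul, ← Complex.exp_conj, Complex.conj_ofReal]; simp
  rw [← c1, ← c2]
  apply SU2.mem_of_row
  rw [c1, c2]
  have e1 : Complex.exp (z * Complex.I) * Complex.exp (-(z * Complex.I)) = 1 := by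
    rw [← Complex.exp_add]; simp
  have e2 : Complex.exp ((ϑ - z) * Complex.I) * Complex.exp (-((ϑ - z) * Complex.I)) = 1 := by
    rw [← Complex.exp_add]; simp
  have hcs : (cos r : ℂ) ^ 2 + (sin r : ℂ) ^ 2 = 1 := by
    rw [add_comm]; exact_mod_cast Real.sin_sq_add_cos_sq r
  linear_combination hcs + (cos r : ℂ) ^ 2 * e1 + (sin r : ℂ) ^ 2 * e2

/-- The point of `SU(2)` with cylindric coordinates `(r, ϑ, z)`, that is
`exp (r cos ϑ X + r sin ϑ Y) * exp (z Z)` for the Pauli matrices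
`X = (0, 1; -1, 0)`, `Y = (0, i; i, 0)` and `Z = (i, 0; 0, -i)`. -/
def SU2.cyl (r ϑ z : ℝ) : SU2 :=
  ⟨!![(cos r : ℂ) * Complex.exp (z * Complex.I),
        (sin r : ℂ) * Complex.exp ((ϑ - z) * Complex.I);
      -((sin r : ℂ) * Complex.exp (-((ϑ - z) * Complex.I))),
        (cos r : ℂ) * Complex.exp (-(z * Complex.I))], SU2.cyl_mem r ϑ z⟩

/-- A function on `SU(2)` is smooth when it is the restriction of a smooth function of the (real
vector space of) matrices; this is smoothness on the closed submanifold `SU(2)`. -/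
def SU2.IsSmooth (f : SU2 → ℝ) : Prop :=
  ∃ F : (Fin 2 → Fin 2 → ℂ) → ℝ, ContDiff ℝ ∞ F ∧ ∀ g : SU2, f g = F (fun i j => g.1 i j)

/-- The left-invariant vector field `X`: `(X f)(g) = d/ds f (g * exp (s X))` at `s = 0`, where
`exp (s X) = (cos s, sin s; -sin s, cos s)`. -/
def SU2.vfX (f : SU2 → ℝ) (g : SU2) : ℝ := deriv (fun s : ℝ => f (g * SU2.cyl s 0 0)) 0

/-- The left-invariant vector field `Y`: `(Y f)(g) = d/ds f (g * exp (s Y))` at `s = 0`, where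
`exp (s Y) = (cos s, i sin s; i sin s, cos s)`. -/
def SU2.vfY (f : SU2 → ℝ) (g : SU2) : ℝ := deriv (fun s : ℝ => f (g * SU2.cyl s (π / 2) 0)) 0

/-- The subelliptic operator `L = X² + Y²`. -/
def SU2.subLaplacian (f : SU2 → ℝ) (g : SU2) : ℝ :=
  SU2.vfX (SU2.vfX f) g + SU2.vfY (SU2.vfY f) g

/-- `p` is the heat kernel, issued from the identity, of the semigroup `exp (t L)` with respect to
the normalized Haar measure `μ`: each `p t`, `t > 0`, is continuous, and the functional
`φ ↦ ∫ φ p_t dμ = (exp (t L) φ) 1` on smooth functions satisfies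
`d/dt ∫ φ p_t dμ = ∫ (L φ) p_t dμ` for `t > 0` and `∫ φ p_t dμ → φ 1` as `t → 0+`.
In other words `p` is the fundamental solution of `∂p/∂t = L p` with `p_t μ → δ_1`. -/
structure SU2.IsHeatKernel (p : ℝ → SU2 → ℝ) : Prop where
  continuous : ∀ t : ℝ, 0 < t → Continuous (p t)
  heat_eq : ∀ φ : SU2 → ℝ, SU2.IsSmooth φ → ∀ t : ℝ, 0 < t →
    HasDerivAt (fun s : ℝ => ∫ g, φ g * p s g ∂SU2.haar)
      (∫ g, SU2.subLaplacian φ g * p t g ∂SU2.haar) t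
  initial : ∀ φ : SU2 → ℝ, SU2.IsSmooth φ →
    Tendsto (fun t : ℝ => ∫ g, φ g * p t g ∂SU2.haar) (𝓝[>] 0) (𝓝 (φ 1))

/-- `θ ∈ [-π, π]` solves the equation
`θ - z = cos r sin θ arccos (cos θ cos r) / √(1 - cos² r cos² θ)`. -/
def SU2.IsCriticalAngle (r z θ : ℝ) : Prop :=
  θ ∈ Icc (-π) π ∧
    θ - z = cos r * sin θ *
      (arccos (cos θ * cos r) / √(1 - cos r ^ 2 * cos θ ^ 2))

/-- The exponent `(θ - z)² tan² r / sin² θ`, where `θ` is the critical angle of `(r, z)`. If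
`sin θ = 0` (this is the case `z ∈ {-π, 0, π}`, `θ = z`) the quotient is `0 / 0`, and it is
replaced by its limit value `arccos (cos r cos θ)²`. -/
def SU2.expo (r z θ : ℝ) : ℝ :=
  if sin θ = 0 then arccos (cos r * cos θ) ^ 2
  else (θ - z) ^ 2 * tan r ^ 2 / sin θ ^ 2

end

/-! Let `V_m` be the representation of `SU(2)` on binary forms of degree `m`. The diagonal matrix
coefficient of `V_m` at `x ^ p * y ^ q`, `p + q = m`, is an eigenfunction of `L` with eigenvalue
`-(4 p q + 2 (p + q)) = -(m (m + 2) - (p - q) ^ 2)`. Pairing the heat kernel with these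
coefficients, and then with class functions concentrating at the identity, gives its expansion
`∑ (p + q + 1) exp (-(4 p q + 2 (p + q)) t) φ_{p,q}`.

The factor `exp ((p - q) ^ 2 t)` is a Gaussian integral of `exp (i (p - q) w)` over the line
`w = θ + i y`, for any real `θ`. Since translating by `exp (w Z)` multiplies `φ_{p,q}` by
`exp (i (p - q) w)`, the heat kernel becomes a Gaussian integral over this line of the heat kernel
of the Laplace-Beltrami operator, evaluated at `cos δ = cos r * cos w`. Poisson summation writes
the latter as a sum of Gaussians centred at `2 π ℤ`.

On the axis `r = 0` take `θ = π / 2`: then `δ = w`, and every image contributes a Fourier transform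
of the hyperbolic secant or of its derivative, which is explicit. Off the axis take `θ` to be the
critical point of the phase `δ ^ 2 - (w - z) ^ 2` and apply Laplace's method with the dominant
image; the remaining images, and the part of the line far from `θ`, are exponentially small. -/

namespace SU2

noncomputable section

open Polynomial (C X derivative)
open Polynomial.Chebyshev (U)
open Finset.HasAntidiagonal (antidiagonal)

/-! ### Matrix coefficients on binary forms -/

section BinaryForms

variable {R : Type*} [CommRing R] (M : Matrix (Fin 2) (Fin 2) R)

/-- The image of the monomial `x ^ p * y ^ q` under the representation of `2 × 2` matrices on
binary forms, dehomogenised at `y = 1`. -/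
def binaryForm (p q : ℕ) : Polynomial R :=
  (C (M 0 0) * X + C (M 0 1)) ^ p * (C (M 1 0) * X + C (M 1 1)) ^ q

/-- The diagonal matrix coefficient, at the monomial `x ^ p * y ^ q`, of the representation of
`2 × 2` matrices on binary forms of degree `p + q`. -/
def diagCoeff (p q : ℕ) : R := (binaryForm M p q).coeff p

theorem diagCoeff_zero_left (q : ℕ) : diagCoeff M 0 q = M 1 1 ^ q := by
  simp [diagCoeff, binaryForm, Polynomial.coeff_zero_eq_eval_zero]

theorem diagCoeff_zero_right (p : ℕ) : diagCoeff M p 0 = M 0 0 ^ p := by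
  have h := Polynomial.coeff_pow_of_natDegree_le (p := C (M 0 0) * X + C (M 0 1)) (n := 1)
    (m := p) Polynomial.natDegree_linear_le
  simpa [diagCoeff, binaryForm] using h

theorem diagCoeff_succ_succ (p q : ℕ) :
    diagCoeff M (p + 1) (q + 1) =
      M 0 0 * diagCoeff M p (q + 1) + M 1 1 * diagCoeff M (p + 1) q - M.det * diagCoeff M p q := by
  have hform : binaryForm M (p + 1) (q + 1) = C (M 0 0) * (binaryForm M p (q + 1) * X) +
      C (M 1 1) * binaryForm M (p + 1) q - C M.det * (binaryForm M p q * X) := by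
    simp only [binaryForm, Matrix.det_fin_two, map_sub, map_mul]
    ring
  simp only [diagCoeff, hform, Polynomial.coeff_sub, Polynomial.coeff_add,
    Polynomial.coeff_C_mul, Polynomial.coeff_mul_X]

theorem diagCoeff_map {S : Type*} [CommRing S] (φ : R →+* S) (p q : ℕ) :
    diagCoeff (M.map φ) p q = φ (diagCoeff M p q) := by
  simp [diagCoeff, binaryForm, ← Polynomial.coeff_map]

theorem sum_diagCoeff_add_two (m : ℕ) :
    ∑ x ∈ antidiagonal (m + 2), diagCoeff M x.1 x.2 =
      M.trace * ∑ x ∈ antidiagonal (m + 1), diagCoeff M x.1 x.2 -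
        M.det * ∑ x ∈ antidiagonal m, diagCoeff M x.1 x.2 := by
  have hleft := Finset.Nat.sum_antidiagonal_succ (n := m) (f := fun x => diagCoeff M x.1 x.2)
  have hright := Finset.Nat.sum_antidiagonal_succ' (n := m) (f := fun x => diagCoeff M x.1 x.2)
  rw [Finset.Nat.sum_antidiagonal_succ, Finset.Nat.sum_antidiagonal_succ']
  simp only [diagCoeff_succ_succ, Finset.sum_sub_distrib, Finset.sum_add_distrib,
    ← Finset.mul_sum, diagCoeff_zero_left, diagCoeff_zero_right] at hleft hright ⊢
  rw [Matrix.trace_fin_two]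
  linear_combination -M 1 1 * hleft - M 0 0 * hright

theorem sum_diagCoeff_of_det_eq_one (hM : M.det = 1) {x : R} (hx : M.trace = 2 * x) (m : ℕ) :
    ∑ x ∈ antidiagonal m, diagCoeff M x.1 x.2 = (U R m).eval x := by
  induction m using Nat.twoStepInduction with
  | zero => simp [diagCoeff_zero_left]
  | one => simp [Finset.Nat.sum_antidiagonal_succ, diagCoeff_zero_left, diagCoeff_zero_right,
      ← hx, Matrix.trace_fin_two, add_comm]
  | more m h₀ h₁ =>
    rw [sum_diagCoeff_add_two, h₀, h₁, hM, hx]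
    push_cast
    simp [Polynomial.Chebyshev.U_add_two]

variable {M} in
/- The off-diagonal entries enter `diagCoeff_succ_succ` only through the determinant. -/
theorem diagCoeff_twist {M' : Matrix (Fin 2) (Fin 2) R} {e f : R} (hef : e * f = 1)
    (h₀ : M' 0 0 = e * M 0 0) (h₁ : M' 1 1 = f * M 1 1) (hdet : M'.det = M.det) (p q : ℕ) :
    diagCoeff M' p q = e ^ p * f ^ q * diagCoeff M p q := by
  induction p generalizing q with
  | zero => simp [diagCoeff_zero_left, h₁, mul_pow]
  | succ p ihp =>
    induction q with
    | zero => simp [diagCoeff_zero_right, h₀, mul_pow]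
    | succ q ihq =>
      rw [diagCoeff_succ_succ, diagCoeff_succ_succ, ihp, ihp, ihq, h₀, h₁, hdet]
      linear_combination (M.det * e ^ p * f ^ q * diagCoeff M p q) * hef

end BinaryForms

theorem sum_twist_diagCoeff {M : Matrix (Fin 2) (Fin 2) ℂ} (hM : M.det = 1) {δ x : ℂ}
    (hx : Complex.exp (δ * Complex.I) * M 0 0 + Complex.exp (-(δ * Complex.I)) * M 1 1 = 2 * x)
    (m : ℕ) :
    ∑ x ∈ antidiagonal m, Complex.exp (((x.1 : ℂ) - x.2) * (δ * Complex.I)) *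
      diagCoeff M x.1 x.2 = (U ℂ m).eval x := by
  have hexp : Complex.exp (δ * Complex.I) * Complex.exp (-(δ * Complex.I)) = 1 := by
    rw [← Complex.exp_add, add_neg_cancel, Complex.exp_zero]
  set M' : Matrix (Fin 2) (Fin 2) ℂ := !![Complex.exp (δ * Complex.I) * M 0 0, M 0 1;
    M 1 0, Complex.exp (-(δ * Complex.I)) * M 1 1] with hM'
  have hdet : M'.det = M.det := by
    rw [hM', Matrix.det_fin_two_of, Matrix.det_fin_two]
    linear_combination M 0 0 * M 1 1 * hexp
  rw [← sum_diagCoeff_of_det_eq_one M' (hdet.trans hM) (x := x) (by simp [hM', hx])]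
  refine Finset.sum_congr rfl fun y _ => ?_
  rw [diagCoeff_twist hexp (by simp [hM']) (by simp [hM']) hdet, ← Complex.exp_nat_mul,
    ← Complex.exp_nat_mul, ← Complex.exp_add]
  ring_nf

theorem eval_U_cos (m : ℕ) (δ : ℂ) :
    (U ℂ m).eval (Complex.cos δ) =
      ∑ x ∈ antidiagonal m, Complex.exp (((x.1 : ℂ) - x.2) * (δ * Complex.I)) := by
  rw [← sum_twist_diagCoeff (M := 1) (δ := δ) (by simp) (by simp [Complex.two_cos])]
  refine Finset.sum_congr rfl fun x _ => ?_
  simp [diagCoeff, binaryForm]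

theorem norm_eval_U_cos_le (m : ℕ) (δ : ℂ) :
    ‖(U ℂ m).eval (Complex.cos δ)‖ ≤ (m + 1) * exp (m * |δ.im|) := by
  rw [eval_U_cos]
  refine (norm_sum_le_of_le (n := fun _ => exp (m * |δ.im|)) _ fun x hx => ?_).trans_eq
    (by simp)
  have hm : (x.1 : ℝ) + x.2 = m := mod_cast Finset.HasAntidiagonal.mem_antidiagonal.1 hx
  have hre : (((x.1 : ℂ) - x.2) * (δ * Complex.I)).re = (x.2 - x.1 : ℝ) * δ.im := by
    rw [show ((x.1 : ℂ) - x.2) = ((x.1 - x.2 : ℝ) : ℂ) by push_cast; rfl, Complex.re_ofReal_mul]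
    simp only [Complex.mul_I_re]
    ring
  have habs : |(x.2 - x.1 : ℝ)| ≤ m := by
    rw [abs_le]
    constructor <;> linarith [x.1.cast_nonneg (α := ℝ), x.2.cast_nonneg (α := ℝ)]
  rw [Complex.norm_exp, hre]
  refine exp_le_exp.2 ((le_abs_self _).trans ?_)
  rw [abs_mul]
  gcongr

theorem norm_eval_U_le {x : ℝ} (hx : |x| ≤ 1) (m : ℕ) : ‖(U ℂ m).eval (x : ℂ)‖ ≤ m + 1 := by
  have h := norm_eval_U_cos_le m (arccos x)
  rwa [← Complex.ofReal_cos, Real.cos_arccos (abs_le.1 hx).1 (abs_le.1 hx).2, Complex.ofReal_im,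
    abs_zero, mul_zero, exp_zero, mul_one] at h

theorem norm_coeff_le_of_norm_eval_le {P : Polynomial ℂ} {c : ℝ}
    (hP : ∀ z, ‖z‖ = 1 → ‖P.eval z‖ ≤ c) (k : ℕ) : ‖P.coeff k‖ ≤ c := by
  have hc : 0 ≤ c := (norm_nonneg _).trans (hP 1 norm_one)
  refine le_of_sq_le_sq ?_ hc
  rcases eq_or_ne (P.coeff k) 0 with hk | hk
  · rw [hk, norm_zero]
    gcongr
  calc ‖P.coeff k‖ ^ 2
      ≤ ∑ i ∈ P.support, ‖P.coeff i‖ ^ 2 := Finset.single_le_sum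
        (f := fun i => ‖P.coeff i‖ ^ 2) (fun i _ => by positivity) (Polynomial.mem_support_iff.2 hk)
    _ = circleAverage (fun z => ‖P.eval z‖ ^ 2) 0 1 := P.sum_sq_norm_coeff_eq_circleAverage
    _ ≤ c ^ 2 := by
      refine circleAverage_mono_on_of_le_circle ?_ fun z hz => ?_
      · exact (P.continuous.norm.pow 2).continuousOn.circleIntegrable zero_le_one
      · rw [abs_one, mem_sphere_zero_iff_norm] at hz
        exact pow_le_pow_left₀ (norm_nonneg _) (hP z hz) 2

theorem coeff_sum_antidiagonal {R : Type*} [CommRing R] (a : ℕ × ℕ → R) (p q : ℕ) :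
    (∑ x ∈ antidiagonal (p + q), C (a x) * X ^ x.1).coeff p = a (p, q) := by
  simp only [Polynomial.finsetSum_coeff, Polynomial.coeff_C_mul, Polynomial.coeff_X_pow]
  rw [Finset.sum_eq_single_of_mem (p, q) (Finset.HasAntidiagonal.mem_antidiagonal.2 rfl)]
  · simp
  · rintro ⟨i, j⟩ hij hne
    have hpi : p ≠ i := by
      rintro rfl
      simp_all
    simp [hpi]

/- On the unit circle, the polynomial with coefficients `diagCoeff M p (m - p)` is, up to a phase, a
twisted sum as in `sum_twist_diagCoeff`. -/
theorem norm_diagCoeff_le {M : Matrix (Fin 2) (Fin 2) ℂ} (hdet : M.det = 1)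
    (hconj : M 1 1 = star (M 0 0)) (hnorm : ‖M 0 0‖ ≤ 1) (p q : ℕ) :
    ‖diagCoeff M p q‖ ≤ (p + q : ℕ) + 1 := by
  rw [← coeff_sum_antidiagonal (fun x => diagCoeff M x.1 x.2)]
  refine norm_coeff_le_of_norm_eval_le (fun z hz => ?_) p
  set φ : ℝ := z.arg / 2 with hφ
  set w := Complex.exp (φ * Complex.I) with hw
  have hz_exp : z = Complex.exp (2 * (φ * Complex.I)) := by
    conv_lhs => rw [← Complex.norm_mul_exp_arg_mul_I z, hz]
    rw [Complex.ofReal_one, one_mul, hφ]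
    push_cast
    ring_nf
  have hw_norm : ‖w‖ = 1 := Complex.norm_exp_ofReal_mul_I φ
  have htrace : w * M 0 0 + Complex.exp (-(φ * Complex.I)) * M 1 1 =
      2 * ((w * M 0 0).re : ℂ) := by
    have hadd := Complex.add_conj (w * M 0 0)
    rw [map_mul, hw, ← Complex.exp_conj, map_mul, Complex.conj_I, Complex.conj_ofReal,
      mul_neg] at hadd
    rw [hw, hconj, Complex.star_def, hadd]
    push_cast
    rfl
  have heval : (∑ x ∈ antidiagonal (p + q), C (diagCoeff M x.1 x.2) * X ^ x.1).eval z =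
      w ^ (p + q) * (U ℂ (p + q : ℕ)).eval ((w * M 0 0).re : ℂ) := by
    rw [← sum_twist_diagCoeff hdet htrace, Finset.mul_sum, Polynomial.eval_finsetSum]
    refine Finset.sum_congr rfl fun x hx => ?_
    rw [← Finset.HasAntidiagonal.mem_antidiagonal.1 hx, Polynomial.eval_mul, Polynomial.eval_C,
      Polynomial.eval_pow, Polynomial.eval_X, hz_exp, hw, ← Complex.exp_nat_mul,
      ← Complex.exp_nat_mul, ← mul_assoc (Complex.exp _), ← Complex.exp_add, mul_comm]
    push_cast
    ring_nf
  rw [heval, norm_mul, norm_pow, hw_norm, one_pow, one_mul]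
  refine norm_eval_U_le ((Complex.abs_re_le_norm _).trans ?_) _
  rwa [norm_mul, hw_norm, one_mul]

/-! ### Eigenfunctions of the sub-Laplacian -/

section CoefficientwiseCalculus

variable {E : Type*} [NormedAddCommGroup E] [NormedSpace ℝ E] {P Q : E → Polynomial ℂ}

theorem contDiff_coeff_linear {a b : E → ℂ} (ha : ContDiff ℝ ∞ a) (hb : ContDiff ℝ ∞ b) (k : ℕ) :
    ContDiff ℝ ∞ fun v => (C (a v) * X + C (b v)).coeff k := by
  rcases k with _ | _ | k
  · simpa [Polynomial.coeff_X, Polynomial.coeff_C] using hb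
  · simpa [Polynomial.coeff_X, Polynomial.coeff_C] using ha
  · simpa [Polynomial.coeff_X, Polynomial.coeff_C] using contDiff_const

theorem contDiff_coeff_mul (hP : ∀ k, ContDiff ℝ ∞ fun v => (P v).coeff k)
    (hQ : ∀ k, ContDiff ℝ ∞ fun v => (Q v).coeff k) (k : ℕ) :
    ContDiff ℝ ∞ fun v => (P v * Q v).coeff k := by
  simp only [Polynomial.coeff_mul]
  exact ContDiff.sum fun x _ => (hP x.1).mul (hQ x.2)

theorem contDiff_coeff_pow (hP : ∀ k, ContDiff ℝ ∞ fun v => (P v).coeff k) (n k : ℕ) :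
    ContDiff ℝ ∞ fun v => (P v ^ n).coeff k := by
  induction n generalizing k with
  | zero => simpa only [pow_zero] using contDiff_const
  | succ n ih => simpa only [pow_succ] using contDiff_coeff_mul ih hP k

theorem contDiff_coeff_binaryForm (p q k : ℕ) :
    ContDiff ℝ ∞ fun M : Fin 2 → Fin 2 → ℂ => (binaryForm (Matrix.of M) p q).coeff k :=
  contDiff_coeff_mul
    (contDiff_coeff_pow
      (contDiff_coeff_linear (contDiff_apply_apply ℝ ℂ 0 0) (contDiff_apply_apply ℝ ℂ 0 1)) p)
    (contDiff_coeff_pow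
      (contDiff_coeff_linear (contDiff_apply_apply ℝ ℂ 1 0) (contDiff_apply_apply ℝ ℂ 1 1)) q) k

end CoefficientwiseCalculus

/-- The coefficientwise derivative of a curve of polynomials. -/
def HasCoeffDerivAt (P : ℝ → Polynomial ℂ) (P' : Polynomial ℂ) (s : ℝ) : Prop :=
  ∀ k, HasDerivAt (fun σ => (P σ).coeff k) (P'.coeff k) s

theorem HasCoeffDerivAt.mul {P Q : ℝ → Polynomial ℂ} {P' Q' : Polynomial ℂ} {s : ℝ}
    (hP : HasCoeffDerivAt P P' s) (hQ : HasCoeffDerivAt Q Q' s) :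
    HasCoeffDerivAt (fun σ => P σ * Q σ) (P' * Q s + P s * Q') s := fun k => by
  simp only [Polynomial.coeff_mul, Polynomial.coeff_add, ← Finset.sum_add_distrib]
  exact HasDerivAt.fun_sum fun x _ => (hP x.1).mul (hQ x.2)

/-- The action on binary forms of degree `m`, dehomogenised at `y = 1`, of the horizontal vector
`cos ϑ X + sin ϑ Y`, where `e = exp (i ϑ)`. -/
def ladder (e : ℂ) (m : ℕ) (P : Polynomial ℂ) : Polynomial ℂ :=
  C e * derivative P + C (star e) * (X ^ 2 * derivative P - C (m : ℂ) * X * P)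

theorem ladder_mul (e : ℂ) (m n : ℕ) (P Q : Polynomial ℂ) :
    ladder e (m + n) (P * Q) = ladder e m P * Q + P * ladder e n Q := by
  simp only [ladder, Polynomial.derivative_mul, Nat.cast_add, map_add]
  ring

theorem coeff_ladder (e : ℂ) (m : ℕ) (P : Polynomial ℂ) (k : ℕ) :
    (ladder e m P).coeff k = e * (k + 1) * P.coeff (k + 1) +
      star e * (if k = 0 then 0 else (k : ℂ) - 1 - m) * P.coeff (k - 1) := by
  have hX : X ^ 2 * derivative P - C (m : ℂ) * X * P =
      (X * derivative P - C (m : ℂ) * P) * X := by ring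
  simp only [ladder, hX, Polynomial.coeff_add, Polynomial.coeff_C_mul, Polynomial.coeff_derivative]
  rcases k with _ | _ | k <;>
    simp [Polynomial.coeff_mul_X, Polynomial.coeff_X_mul, Polynomial.coeff_derivative]
  · ring
  · ring

theorem coeff_ladder_one_sq_add_ladder_I_sq (m : ℕ) (P : Polynomial ℂ) (k : ℕ) :
    (ladder 1 m (ladder 1 m P)).coeff k + (ladder Complex.I m (ladder Complex.I m P)).coeff k =
      -(4 * k * (m - k) + 2 * m) * P.coeff k := by
  simp only [coeff_ladder, Complex.star_def, map_one, Complex.conj_I]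
  rcases k with _ | _ | k <;>
    simp only [Nat.cast_zero, Nat.cast_add, Nat.cast_one, Nat.add_sub_cancel, if_true, if_false,
      Nat.add_eq_zero_iff, one_ne_zero, and_false, zero_add]
  · linear_combination (2 * P.coeff 2 + m * P.coeff 0) * Complex.I_sq
  · linear_combination (6 * P.coeff 3 + (3 * m - 2) * P.coeff 1) * Complex.I_sq
  · linear_combination ((k + 3) * (k + 4) * P.coeff (k + 4) +
      (2 * k * m - 8 * k - 2 * k ^ 2 + 5 * m - 8) * P.coeff (k + 2) +
      (-2 * k * m + k + k ^ 2 - m + m ^ 2) * P.coeff k) * Complex.I_sq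

theorem HasCoeffDerivAt.ladder {P : ℝ → Polynomial ℂ} {P' : Polynomial ℂ} {s : ℝ}
    (hP : HasCoeffDerivAt P P' s) (e : ℂ) (m : ℕ) :
    HasCoeffDerivAt (fun σ => ladder e m (P σ)) (SU2.ladder e m P') s := fun k => by
  simp only [coeff_ladder]
  exact ((hP _).const_mul _).add ((hP _).const_mul _)

theorem HasCoeffDerivAt.pow_ladder {P : ℝ → Polynomial ℂ} {s : ℝ} {e : ℂ} {m : ℕ}
    (hP : HasCoeffDerivAt P (SU2.ladder e m (P s)) s) (n : ℕ) :
    HasCoeffDerivAt (fun σ => P σ ^ n) (SU2.ladder e (n * m) (P s ^ n)) s := by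
  induction n with
  | zero =>
    intro k
    simpa [SU2.ladder] using hasDerivAt_const s _
  | succ n ih =>
    simpa only [pow_succ, Nat.succ_mul, ladder_mul] using ih.mul hP

theorem cyl_mul_cyl (s σ ϑ : ℝ) : cyl s ϑ 0 * cyl σ ϑ 0 = cyl (s + σ) ϑ 0 := by
  have hexp : Complex.exp (ϑ * Complex.I) * Complex.exp (-(ϑ * Complex.I)) = 1 := by
    rw [← Complex.exp_add, add_neg_cancel, Complex.exp_zero]
  apply Subtype.ext
  ext i j
  fin_cases i <;> fin_cases j <;>
    simp [cyl, Complex.cos_add, Complex.sin_add]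
  · linear_combination (-Complex.sin s * Complex.sin σ) * hexp
  · ring
  · ring
  · linear_combination (-Complex.sin s * Complex.sin σ) * hexp

theorem mul_cyl_apply (g : SU2) (s ϑ : ℝ) (i : Fin 2) :
    (g * cyl s ϑ 0).1 i 0 =
      g.1 i 0 * Complex.cos s - g.1 i 1 * (Complex.exp (-(ϑ * Complex.I)) * Complex.sin s) ∧
    (g * cyl s ϑ 0).1 i 1 =
      g.1 i 0 * (Complex.exp (ϑ * Complex.I) * Complex.sin s) + g.1 i 1 * Complex.cos s := by
  constructor
  · simp [cyl, Matrix.mul_apply, Fin.sum_univ_two]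
    ring
  · simp [cyl, Matrix.mul_apply, Fin.sum_univ_two, mul_comm]

/- Differentiating the entries of `g * cyl s ϑ 0` is right multiplication by
`(0, e; -conj e, 0)`, where `e = exp (i ϑ)`. -/
theorem hasDerivAt_mul_cyl_apply (g : SU2) (s ϑ : ℝ) (i : Fin 2) :
    HasDerivAt (fun σ : ℝ => (g * cyl σ ϑ 0).1 i 0)
      (-Complex.exp (-(ϑ * Complex.I)) * (g * cyl s ϑ 0).1 i 1) s ∧
    HasDerivAt (fun σ : ℝ => (g * cyl σ ϑ 0).1 i 1)
      (Complex.exp (ϑ * Complex.I) * (g * cyl s ϑ 0).1 i 0) s := by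
  have hexp : Complex.exp (ϑ * Complex.I) * Complex.exp (-(ϑ * Complex.I)) = 1 := by
    rw [← Complex.exp_add, add_neg_cancel, Complex.exp_zero]
  have hcos : HasDerivAt (fun s : ℝ => Complex.cos s) (-Complex.sin s) s :=
    (Complex.hasDerivAt_cos _).comp_ofReal
  have hsin : HasDerivAt (fun s : ℝ => Complex.sin s) (Complex.cos s) s :=
    (Complex.hasDerivAt_sin _).comp_ofReal
  simp only [mul_cyl_apply]
  constructor
  · refine ((hcos.const_mul _).sub ((hsin.const_mul _).const_mul _)).congr_deriv ?_
    linear_combination (g.1 i 0 * Complex.sin s) * hexp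
  · refine (((hsin.const_mul _).const_mul _).add (hcos.const_mul _)).congr_deriv ?_
    linear_combination (g.1 i 1 * Complex.sin s) * hexp

theorem hasCoeffDerivAt_row (g : SU2) (s ϑ : ℝ) (i : Fin 2) :
    HasCoeffDerivAt (fun σ => C ((g * cyl σ ϑ 0).1 i 0) * X + C ((g * cyl σ ϑ 0).1 i 1))
      (ladder (Complex.exp (ϑ * Complex.I)) 1
        (C ((g * cyl s ϑ 0).1 i 0) * X + C ((g * cyl s ϑ 0).1 i 1))) s := by
  have hstar : star (Complex.exp (ϑ * Complex.I)) = Complex.exp (-(ϑ * Complex.I)) := by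
    rw [Complex.star_def, ← Complex.exp_conj]
    simp
  intro k
  obtain ⟨h₀, h₁⟩ := hasDerivAt_mul_cyl_apply g s ϑ i
  rw [coeff_ladder, hstar]
  rcases k with _ | _ | k
  · simpa [Polynomial.coeff_X, Polynomial.coeff_C] using h₁
  · simpa [Polynomial.coeff_X, Polynomial.coeff_C] using h₀
  · rcases k with _ | k <;>
      norm_num [Polynomial.coeff_X, Polynomial.coeff_C, hasDerivAt_const]

theorem hasCoeffDerivAt_binaryForm (p q : ℕ) (g : SU2) (s ϑ : ℝ) :
    HasCoeffDerivAt (fun σ => binaryForm (g * cyl σ ϑ 0).1 p q)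
      (ladder (Complex.exp (ϑ * Complex.I)) (p + q) (binaryForm (g * cyl s ϑ 0).1 p q)) s := by
  have h := ((hasCoeffDerivAt_row g s ϑ 0).pow_ladder p).mul
    ((hasCoeffDerivAt_row g s ϑ 1).pow_ladder q)
  rw [← ladder_mul, mul_one, mul_one] at h
  exact h

/-- The real part of the diagonal matrix coefficient of `SU(2)` at `x ^ p * y ^ q`: a
joint eigenfunction of the Casimir operator and of the rotations `exp (z Z)`. -/
def sph (p q : ℕ) (g : SU2) : ℝ := (diagCoeff g.1 p q).re

/-- The eigenvalue of `-L` at `sph p q`. -/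
def eig (p q : ℕ) : ℝ := 4 * p * q + 2 * p + 2 * q

/-- Half the trace of an element of `SU(2)`, which is the real part of both diagonal entries. -/
def halfTrace (g : SU2) : ℝ := (g.1 0 0).re

/-- The character of `SU(2)` of degree `m`. -/
def char (m : ℕ) (g : SU2) : ℝ := (U ℝ m).eval (halfTrace g)

theorem det_eq_one (g : SU2) : g.1.det = 1 := (Matrix.mem_specialUnitaryGroup_iff.1 g.2).2

theorem star_eq_adjugate (g : SU2) : star g.1 = g.1.adjugate :=
  left_inv_eq_right_inv (congrArg Subtype.val (inv_mul_cancel g))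
    (by rw [Matrix.mul_adjugate, det_eq_one, one_smul])

theorem apply_one_one (g : SU2) : g.1 1 1 = star (g.1 0 0) := by
  rw [← Matrix.star_apply, star_eq_adjugate, Matrix.adjugate_fin_two]
  rfl

theorem apply_one_zero (g : SU2) : g.1 1 0 = -star (g.1 0 1) := by
  rw [← Matrix.star_apply, star_eq_adjugate, Matrix.adjugate_fin_two]
  exact (neg_neg _).symm

theorem norm_apply_zero_zero_le (g : SU2) : ‖g.1 0 0‖ ≤ 1 :=
  entry_norm_bound_of_unitary (Matrix.mem_specialUnitaryGroup_iff.1 g.2).1 0 0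

theorem abs_halfTrace_le (g : SU2) : |halfTrace g| ≤ 1 :=
  (Complex.abs_re_le_norm _).trans (norm_apply_zero_zero_le g)

theorem trace_eq (g : SU2) : g.1.trace = 2 * (halfTrace g : ℂ) := by
  rw [Matrix.trace_fin_two, apply_one_one, Complex.star_def, Complex.add_conj, halfTrace]
  push_cast
  rfl

theorem abs_sph_le (p q : ℕ) (g : SU2) : |sph p q g| ≤ (p + q : ℕ) + 1 :=
  (Complex.abs_re_le_norm _).trans
    (norm_diagCoeff_le (det_eq_one g) (apply_one_one g) (norm_apply_zero_zero_le g) p q)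

theorem sph_inv (p q : ℕ) (g : SU2) : sph p q g⁻¹ = sph p q g := by
  have hdet : (star g.1).det = (g.1.map (starRingEnd ℂ)).det := Matrix.det_transpose _
  have hcoeff : diagCoeff (star g.1) p q = diagCoeff (g.1.map (starRingEnd ℂ)) p q := by
    rw [diagCoeff_twist (e := 1) (f := 1) (one_mul 1) (one_mul _).symm (one_mul _).symm hdet]
    simp only [one_pow, one_mul]
  calc (diagCoeff (star g.1) p q).re = ((starRingEnd ℂ) (diagCoeff g.1 p q)).re := by
        rw [hcoeff, diagCoeff_map]
    _ = (diagCoeff g.1 p q).re := Complex.conj_re _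

theorem char_eq_sum_sph (m : ℕ) (g : SU2) :
    char m g = ∑ x ∈ antidiagonal m, sph x.1 x.2 g := by
  have h := sum_diagCoeff_of_det_eq_one g.1 (det_eq_one g) (trace_eq g) m
  rw [← Polynomial.Chebyshev.complex_ofReal_eval_U] at h
  simpa only [Complex.ofReal_re, Complex.re_sum, char, sph] using (congrArg Complex.re h).symm

theorem continuous_coeff_binaryForm (p q k : ℕ) :
    Continuous fun g : SU2 => (binaryForm g.1 p q).coeff k :=
  (contDiff_coeff_binaryForm p q k).continuous.comp continuous_subtype_val

theorem continuous_sph (p q : ℕ) : Continuous (sph p q) :=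
  Complex.continuous_re.comp (continuous_coeff_binaryForm p q p)

theorem continuous_halfTrace : Continuous halfTrace :=
  Complex.continuous_re.comp ((continuous_apply_apply 0 0).comp continuous_subtype_val)

theorem continuous_char (m : ℕ) : Continuous (char m) :=
  (U ℝ m).continuous.comp continuous_halfTrace

theorem isSmooth_sph_mul_left (p q : ℕ) (h : SU2) : IsSmooth fun g => sph p q (h * g) := by
  have hmul : ContDiff ℝ ∞ fun M : Fin 2 → Fin 2 → ℂ => fun i j => (h.1 * Matrix.of M) i j := by
    simp only [Matrix.mul_apply, Matrix.of_apply]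
    fun_prop
  exact ⟨fun M => (diagCoeff (h.1 * Matrix.of M) p q).re,
    Complex.reCLM.contDiff.comp ((contDiff_coeff_binaryForm p q p).comp hmul), fun _ => rfl⟩

theorem vfX_vfX (f : SU2 → ℝ) (g : SU2) :
    vfX (vfX f) g = deriv (deriv fun s => f (g * cyl s 0 0)) 0 := by
  rw [vfX]
  congr 1
  funext s
  simp only [vfX, mul_assoc, cyl_mul_cyl]
  rw [deriv_comp_const_add (f := fun s => f (g * cyl s 0 0)), add_zero]

theorem vfY_vfY (f : SU2 → ℝ) (g : SU2) :
    vfY (vfY f) g = deriv (deriv fun s => f (g * cyl s (π / 2) 0)) 0 := by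
  rw [vfY]
  congr 1
  funext s
  simp only [vfY, mul_assoc, cyl_mul_cyl]
  rw [deriv_comp_const_add (f := fun s => f (g * cyl s (π / 2) 0)), add_zero]

theorem subLaplacian_mul_left (f : SU2 → ℝ) (h g : SU2) :
    subLaplacian (fun g => f (h * g)) g = subLaplacian f (h * g) := by
  simp only [subLaplacian, vfX, vfY, mul_assoc]

/-- The derivative of `sph p q` in the horizontal direction `cos ϑ X + sin ϑ Y`. -/
def sphDeriv (p q : ℕ) (ϑ : ℝ) (g : SU2) : ℝ :=
  ((ladder (Complex.exp (ϑ * Complex.I)) (p + q) (binaryForm g.1 p q)).coeff p).re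

/-- The second derivative of `sph p q` in the horizontal direction `cos ϑ X + sin ϑ Y`. -/
def sphDeriv₂ (p q : ℕ) (ϑ : ℝ) (g : SU2) : ℝ :=
  ((ladder (Complex.exp (ϑ * Complex.I)) (p + q)
    (ladder (Complex.exp (ϑ * Complex.I)) (p + q) (binaryForm g.1 p q))).coeff p).re

theorem hasDerivAt_re {f : ℝ → ℂ} {f' : ℂ} {x : ℝ} (h : HasDerivAt f f' x) :
    HasDerivAt (fun s => (f s).re) f'.re x :=
  (Complex.reCLM.hasFDerivAt (x := f x)).comp_hasDerivAt x h

theorem hasDerivAt_sph (p q : ℕ) (g : SU2) (s ϑ : ℝ) :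
    HasDerivAt (fun σ => sph p q (g * cyl σ ϑ 0)) (sphDeriv p q ϑ (g * cyl s ϑ 0)) s :=
  hasDerivAt_re (hasCoeffDerivAt_binaryForm p q g s ϑ p)

theorem hasDerivAt_sphDeriv (p q : ℕ) (g : SU2) (s ϑ : ℝ) :
    HasDerivAt (fun σ => sphDeriv p q ϑ (g * cyl σ ϑ 0)) (sphDeriv₂ p q ϑ (g * cyl s ϑ 0)) s :=
  hasDerivAt_re ((hasCoeffDerivAt_binaryForm p q g s ϑ).ladder _ _ p)

theorem cyl_zero (ϑ : ℝ) : cyl 0 ϑ 0 = 1 := by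
  apply Subtype.ext
  ext i j
  fin_cases i <;> fin_cases j <;> simp [cyl]

theorem deriv_deriv_sph (p q : ℕ) (g : SU2) (ϑ : ℝ) :
    deriv (deriv fun s => sph p q (g * cyl s ϑ 0)) 0 = sphDeriv₂ p q ϑ g := by
  rw [funext fun s => (hasDerivAt_sph p q g s ϑ).deriv, (hasDerivAt_sphDeriv p q g 0 ϑ).deriv,
    cyl_zero, mul_one]

theorem sphDeriv₂_add (p q : ℕ) (g : SU2) :
    sphDeriv₂ p q 0 g + sphDeriv₂ p q (π / 2) g = -eig p q * sph p q g := by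
  have hexp : Complex.exp (((π / 2 : ℝ) : ℂ) * Complex.I) = Complex.I := by
    rw [Complex.exp_mul_I, ← Complex.ofReal_cos, ← Complex.ofReal_sin]
    simp
  have heig : (-(4 * p * ((p + q : ℕ) - p) + 2 * (p + q : ℕ)) : ℂ) = (-eig p q : ℝ) := by
    rw [eig]
    push_cast
    ring
  rw [sphDeriv₂, sphDeriv₂, ← Complex.add_re, hexp, Complex.ofReal_zero, zero_mul,
    Complex.exp_zero, coeff_ladder_one_sq_add_ladder_I_sq, heig, Complex.re_ofReal_mul]
  rfl

theorem subLaplacian_sph (p q : ℕ) (g : SU2) :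
    subLaplacian (sph p q) g = -eig p q * sph p q g := by
  rw [subLaplacian, vfX_vfX, vfY_vfY, deriv_deriv_sph, deriv_deriv_sph, sphDeriv₂_add]

instance : IsProbabilityMeasure haar :=
  ⟨by
    rw [haar]
    exact Measure.haarMeasure_self (K₀ := (⊤ : TopologicalSpace.PositiveCompacts SU2))⟩

instance : Measure.IsHaarMeasure haar := by
  rw [haar]
  infer_instance

theorem map_mul_right_haar (h : SU2) : Measure.map (fun g => g * h) haar = haar := by
  have : IsProbabilityMeasure (Measure.map (fun g => g * h) haar) :=
    Measure.isProbabilityMeasure_map (by fun_prop)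
  exact Measure.isHaarMeasure_eq_of_isProbabilityMeasure _ _

theorem integral_mul_right {f : SU2 → ℝ} (hf : Continuous f) (h : SU2) :
    ∫ g, f (g * h) ∂haar = ∫ g, f g ∂haar := by
  conv_rhs => rw [← map_mul_right_haar h]
  rw [integral_map (by fun_prop) hf.aestronglyMeasurable]

theorem integrable_of_continuous {f : SU2 → ℝ} (hf : Continuous f) : Integrable f haar :=
  integrableOn_univ.1 (hf.continuousOn.integrableOn_compact isCompact_univ)

theorem integral_deriv_eq_zero {f f' : SU2 → ℝ} (hf : Continuous f) (hf' : Continuous f')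
    {ϑ : ℝ} (hderiv : ∀ g s, HasDerivAt (fun σ => f (g * cyl σ ϑ 0)) (f' (g * cyl s ϑ 0)) s) :
    ∫ g, f' g ∂haar = 0 := by
  obtain ⟨M, hM⟩ := isCompact_univ.exists_bound_of_continuousOn hf'.continuousOn
  have hint := (hasDerivAt_integral_of_dominated_loc_of_deriv_le (μ := haar) (x₀ := (0 : ℝ))
    (F := fun s g => f (g * cyl s ϑ 0)) (F' := fun s g => f' (g * cyl s ϑ 0))
    (bound := fun _ => M) (s := univ) univ_mem
    (Eventually.of_forall fun s =>
      (by fun_prop : Continuous fun g => f (g * cyl s ϑ 0)).aestronglyMeasurable)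
    (integrable_of_continuous (by fun_prop))
    (by fun_prop : Continuous fun g => f' (g * cyl 0 ϑ 0)).aestronglyMeasurable
    (Eventually.of_forall fun g s _ => hM _ (mem_univ _)) (integrable_const M)
    (Eventually.of_forall fun g s _ => hderiv g s)).2
  simp only [integral_mul_right hf, integral_mul_right hf'] at hint
  exact hint.unique (hasDerivAt_const _ _)

theorem continuous_sphDeriv (p q : ℕ) (ϑ : ℝ) : Continuous (sphDeriv p q ϑ) := by
  have hcoeff := continuous_coeff_binaryForm p q
  unfold sphDeriv
  simp only [coeff_ladder]
  fun_prop

theorem continuous_sphDeriv₂ (p q : ℕ) (ϑ : ℝ) : Continuous (sphDeriv₂ p q ϑ) := by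
  have hcoeff := continuous_coeff_binaryForm p q
  unfold sphDeriv₂
  simp only [coeff_ladder]
  fun_prop

theorem integral_sph {p q : ℕ} (h : p + q ≠ 0) : ∫ g, sph p q g ∂haar = 0 := by
  have hzero : ∀ ϑ, ∫ g, sphDeriv₂ p q ϑ g ∂haar = 0 := fun ϑ =>
    integral_deriv_eq_zero (continuous_sphDeriv p q ϑ) (continuous_sphDeriv₂ p q ϑ)
      fun g s => hasDerivAt_sphDeriv p q g s ϑ
  have hsum : -eig p q * ∫ g, sph p q g ∂haar = 0 := by
    rw [← integral_const_mul]
    simp only [← sphDeriv₂_add]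
    rw [integral_add (integrable_of_continuous (continuous_sphDeriv₂ p q 0))
      (integrable_of_continuous (continuous_sphDeriv₂ p q (π / 2))), hzero, hzero, add_zero]
  have heig : 0 < eig p q := by
    have : (0 : ℝ) < p + q := by exact_mod_cast Nat.pos_of_ne_zero h
    rw [eig]
    nlinarith [p.cast_nonneg (α := ℝ), mul_nonneg (p.cast_nonneg (α := ℝ)) (q.cast_nonneg (α := ℝ))]
  exact (mul_eq_zero.1 hsum).resolve_left (neg_ne_zero.2 heig.ne')

theorem char_zero (g : SU2) : char 0 g = 1 := by simp [char]

theorem char_one (g : SU2) : char 1 g = 2 * halfTrace g := by simp [char]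

theorem char_add_two (m : ℕ) (g : SU2) :
    char (m + 2) g = 2 * halfTrace g * char (m + 1) g - char m g := by
  simp only [char]
  push_cast
  simp [Polynomial.Chebyshev.U_add_two]

theorem abs_char_le (m : ℕ) (g : SU2) : |char m g| ≤ m + 1 := by
  have h := norm_eval_U_le (abs_halfTrace_le g) m
  rwa [← Polynomial.Chebyshev.complex_ofReal_eval_U, Complex.norm_real] at h

theorem integral_char (m : ℕ) : ∫ g, char m g ∂haar = if m = 0 then 1 else 0 := by
  split_ifs with h
  · simp [h, char_zero]
  · simp only [char_eq_sum_sph]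
    rw [integral_finsetSum _ fun x _ => integrable_of_continuous (continuous_sph x.1 x.2)]
    refine Finset.sum_eq_zero fun x hx => integral_sph ?_
    rwa [Finset.HasAntidiagonal.mem_antidiagonal.1 hx]

theorem integrable_char_mul_char (m k : ℕ) : Integrable (fun g => char m g * char k g) haar :=
  integrable_of_continuous ((continuous_char m).mul (continuous_char k))

theorem integral_char_one_mul_char (k : ℕ) :
    ∫ g, char 1 g * char (k + 1) g ∂haar = if k = 0 then 1 else 0 := by
  have hrec : ∀ g, char 1 g * char (k + 1) g = char (k + 2) g + char k g := fun g => by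
    rw [char_add_two, char_one]
    ring
  simp only [hrec]
  rw [integral_add (integrable_of_continuous (continuous_char _))
    (integrable_of_continuous (continuous_char _)), integral_char, integral_char]
  simp

theorem integral_char_add_two_mul_char (m k : ℕ) :
    ∫ g, char (m + 2) g * char (k + 1) g ∂haar =
      ∫ g, char (m + 1) g * char (k + 2) g ∂haar + ∫ g, char (m + 1) g * char k g ∂haar -
        ∫ g, char m g * char (k + 1) g ∂haar := by
  have hint := integrable_char_mul_char
  rw [← integral_add (hint _ _) (hint _ _),
    ← integral_sub (by exact (hint _ _).add (hint _ _)) (hint _ _)]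
  congr with g
  simp only [char_add_two]
  ring

theorem integral_char_mul_char (m k : ℕ) :
    ∫ g, char m g * char k g ∂haar = if m = k then 1 else 0 := by
  have hzero : ∀ m, ∫ g, char m g * char 0 g ∂haar = if m = 0 then 1 else 0 := fun m => by
    simp only [char_zero, mul_one, integral_char]
  induction m using Nat.twoStepInduction generalizing k with
  | zero => simp only [mul_comm (char 0 _), hzero, eq_comm]
  | one =>
    rcases k with _ | k
    · exact hzero 1
    · rw [integral_char_one_mul_char]
      simp
  | more m ih₀ ih₁ =>
    rcases k with _ | k
    · exact hzero _
    · rw [integral_char_add_two_mul_char, ih₁, ih₁, ih₀]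
      split_ifs <;> first | omega | norm_num

/-! ### Spectral expansion of the heat kernel -/

theorem eq_exp_mul_of_hasDerivAt {F : ℝ → ℝ} {lam c : ℝ}
    (hF : ∀ t, 0 < t → HasDerivAt F (-lam * F t) t) (hF₀ : Tendsto F (𝓝[>] 0) (𝓝 c))
    {t : ℝ} (ht : 0 < t) : F t = exp (-lam * t) * c := by
  have hderiv : ∀ s ∈ Ioi (0 : ℝ), HasDerivAt (fun s => exp (lam * s) * F s) 0 s := by
    intro s hs
    have hexp : HasDerivAt (fun s => exp (lam * s)) (exp (lam * s) * lam) s := by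
      simpa using ((hasDerivAt_id s).const_mul lam).exp
    exact (hexp.fun_mul (hF s hs)).congr_deriv (by ring)
  have hconst : ∀ s ∈ Ioi (0 : ℝ), exp (lam * s) * F s = exp (lam * t) * F t := fun s hs =>
    isOpen_Ioi.is_const_of_deriv_eq_zero isPreconnected_Ioi
      (fun x hx => (hderiv x hx).differentiableAt.differentiableWithinAt)
      (fun x hx => (hderiv x hx).deriv) hs ht
  have hlim : Tendsto (fun s => exp (lam * s) * F s) (𝓝[>] 0) (𝓝 (exp (lam * 0) * c)) :=
    (((by fun_prop : Continuous fun s : ℝ => exp (lam * s)).tendsto 0).mono_left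
      nhdsWithin_le_nhds).mul hF₀
  have hval : exp (lam * t) * F t = c := by
    simpa using tendsto_nhds_unique (tendsto_const_nhds.congr'
      (eventually_nhdsWithin_of_forall fun s hs => (hconst s hs).symm)) hlim
  rw [← hval, ← mul_assoc, ← exp_add, neg_mul, neg_add_cancel, exp_zero, one_mul]

theorem IsHeatKernel.integral_sph_mul {k : ℝ → SU2 → ℝ} (hk : IsHeatKernel k) (p q : ℕ)
    (h : SU2) {t : ℝ} (ht : 0 < t) :
    ∫ g, sph p q (h * g) * k t g ∂haar = exp (-eig p q * t) * sph p q h := by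
  have hsmooth := isSmooth_sph_mul_left p q h
  refine eq_exp_mul_of_hasDerivAt (F := fun t => ∫ g, sph p q (h * g) * k t g ∂haar)
    (fun s hs => ?_) (by simpa only [mul_one] using hk.initial _ hsmooth) ht
  have hheat := hk.heat_eq _ hsmooth s hs
  simp only [subLaplacian_mul_left, subLaplacian_sph] at hheat
  rw [← integral_const_mul]
  simpa only [mul_assoc] using hheat

theorem two_mul_le_eig (p q : ℕ) : 2 * ((p + q : ℕ) : ℝ) ≤ eig p q := by
  rw [eig]
  push_cast
  linarith [mul_nonneg (p.cast_nonneg (α := ℝ)) (q.cast_nonneg (α := ℝ))]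

theorem summable_cube_mul_exp {t : ℝ} (ht : 0 < t) :
    Summable fun m : ℕ => ((m : ℝ) + 1) ^ 3 * exp (-(2 * m * t)) := by
  have h := (summable_nat_add_iff 1).2
    (Real.summable_pow_mul_exp_neg_nat_mul 3 (r := 2 * t) (by positivity))
  refine (h.mul_right (exp (2 * t))).congr fun m => ?_
  rw [mul_assoc, ← exp_add]
  push_cast
  ring_nf

/-- The image of the character of degree `m` under the heat semigroup at time `t`. -/
def heatChar (t : ℝ) (m : ℕ) (h : SU2) : ℝ :=
  ∑ x ∈ antidiagonal m, exp (-eig x.1 x.2 * t) * sph x.1 x.2 h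

theorem heatChar_inv (t : ℝ) (m : ℕ) (h : SU2) : heatChar t m h⁻¹ = heatChar t m h := by
  simp only [heatChar, sph_inv]

theorem abs_heatChar_le {t : ℝ} (ht : 0 < t) (m : ℕ) (h : SU2) :
    |heatChar t m h| ≤ ((m : ℝ) + 1) ^ 2 * exp (-(2 * m * t)) := by
  refine (Finset.abs_sum_le_sum_abs _ _).trans <| (Finset.sum_le_sum
    (g := fun _ => exp (-(2 * m * t)) * ((m : ℝ) + 1)) fun x hx => ?_).trans_eq ?_
  · have heig := two_mul_le_eig x.1 x.2
    have hsph := abs_sph_le x.1 x.2 h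
    rw [Finset.HasAntidiagonal.mem_antidiagonal.1 hx] at heig hsph
    rw [abs_mul, abs_of_pos (exp_pos _)]
    gcongr
    linarith [mul_le_mul_of_nonneg_right heig ht.le]
  · rw [Finset.sum_const, Finset.Nat.card_antidiagonal, nsmul_eq_mul]
    push_cast
    ring

theorem IsHeatKernel.integral_char_mul {k : ℝ → SU2 → ℝ} (hk : IsHeatKernel k) (m : ℕ)
    (h : SU2) {t : ℝ} (ht : 0 < t) :
    ∫ g, char m (h * g) * k t g ∂haar = heatChar t m h := by
  have hint : ∀ x ∈ antidiagonal m,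
      Integrable (fun g => sph x.1 x.2 (h * g) * k t g) haar := fun x _ =>
    integrable_of_continuous
      (((continuous_sph x.1 x.2).comp (continuous_const_mul h)).mul (hk.continuous t ht))
  simp only [char_eq_sum_sph, Finset.sum_mul]
  rw [integral_finsetSum _ hint]
  exact Finset.sum_congr rfl fun x _ => hk.integral_sph_mul x.1 x.2 h ht

theorem span_range_U_natCast : Submodule.span ℝ (range fun m : ℕ => U ℝ m) = ⊤ :=
  let S : Polynomial.Sequence ℝ := ⟨fun m => U ℝ m, Polynomial.Chebyshev.degree_U_natCast ℝ⟩
  S.span fun i => (Polynomial.leadingCoeff_ne_zero.2 (S.ne_zero i)).isUnit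

theorem IsHeatKernel.hasSum_integral_eval_halfTrace {k : ℝ → SU2 → ℝ} (hk : IsHeatKernel k)
    (h : SU2) {t : ℝ} (ht : 0 < t) (P : Polynomial ℝ) :
    HasSum (fun m => (∫ g, P.eval (halfTrace g) * char m g ∂haar) * heatChar t m h)
      (∫ g, P.eval (halfTrace (h * g)) * k t g ∂haar) := by
  have hcont := hk.continuous t ht
  have htr := continuous_halfTrace
  have hchar := continuous_char
  have hP : P ∈ Submodule.span ℝ (range fun m : ℕ => U ℝ m) :=
    span_range_U_natCast ▸ Submodule.mem_top
  induction hP using Submodule.span_induction with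
  | mem P hP =>
    obtain ⟨n, rfl⟩ := hP
    have hval : ∫ g, (U ℝ n).eval (halfTrace (h * g)) * k t g ∂haar = heatChar t n h :=
      hk.integral_char_mul n h ht
    have hortho : ∀ m, ∫ g, (U ℝ n).eval (halfTrace g) * char m g ∂haar = if n = m then 1 else 0 :=
      integral_char_mul_char n
    rw [hval]
    refine (hasSum_ite_eq n (heatChar t n h)).congr_fun fun m => ?_
    rw [hortho, ite_mul, one_mul, zero_mul]
    grind
  | zero => simp
  | add P Q _ _ hP hQ =>
    simp only [Polynomial.eval_add, add_mul]
    rw [integral_add (integrable_of_continuous (by fun_prop))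
      (integrable_of_continuous (by fun_prop))]
    refine (hP.add hQ).congr_fun fun m => ?_
    rw [integral_add (integrable_of_continuous (by fun_prop))
      (integrable_of_continuous (by fun_prop)), add_mul]
  | smul a P _ hP =>
    simp only [Polynomial.eval_smul, smul_eq_mul, mul_assoc, integral_const_mul]
    exact hP.mul_left a

theorem halfTrace_one : halfTrace 1 = 1 := by simp [halfTrace]

theorem char_at_one (m : ℕ) : char m 1 = m + 1 := by
  rw [char, halfTrace_one, Polynomial.Chebyshev.U_eval_one, Int.cast_natCast]

theorem eq_one_of_halfTrace_eq_one {g : SU2} (hg : halfTrace g = 1) : g = 1 := by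
  have h₀₀ : g.1 0 0 = 1 := by
    have hnorm : ‖g.1 0 0‖ = (g.1 0 0).re :=
      le_antisymm ((norm_apply_zero_zero_le g).trans_eq hg.symm) (Complex.re_le_norm _)
    rw [Complex.eq_coe_norm_of_nonneg (Complex.re_eq_norm.1 hnorm.symm), hnorm]
    exact_mod_cast hg
  have h₁₁ : g.1 1 1 = 1 := by rw [apply_one_one, h₀₀, star_one]
  have h₀₁ : g.1 0 1 = 0 := by
    have hdet := det_eq_one g
    rw [Matrix.det_fin_two, h₀₀, h₁₁, apply_one_zero] at hdet
    simpa using hdet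
  have h₁₀ : g.1 1 0 = 0 := by rw [apply_one_zero, h₀₁, star_zero, neg_zero]
  apply Subtype.ext
  ext i j
  fin_cases i <;> fin_cases j <;> simp [h₀₀, h₀₁, h₁₀, h₁₁]

instance : TopologicalSpace.MetrizableSpace SU2 :=
  have : TopologicalSpace.MetrizableSpace (Matrix (Fin 2) (Fin 2) ℂ) :=
    inferInstanceAs (TopologicalSpace.MetrizableSpace (Fin 2 → Fin 2 → ℂ))
  IsEmbedding.subtypeVal.metrizableSpace

/-- The class function `((1 + halfTrace) / 2) ^ n` as a polynomial in `halfTrace`; normalised to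
mass `1`, these functions concentrate at the identity as `n → ∞`. -/
def peakPoly (n : ℕ) : Polynomial ℝ := (C (1 / 2) * (1 + X)) ^ n

theorem eval_peakPoly (n : ℕ) (x : ℝ) : (peakPoly n).eval x = (1 / 2 * (1 + x)) ^ n := by
  simp [peakPoly]

theorem eval_peakPoly_nonneg (n : ℕ) (g : SU2) : 0 ≤ (peakPoly n).eval (halfTrace g) := by
  rw [eval_peakPoly]
  have := neg_le_of_abs_le (abs_halfTrace_le g)
  exact pow_nonneg (by linarith) n

theorem tendsto_integral_peakPoly {f : SU2 → ℝ} (hf : Continuous f) :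
    Tendsto (fun n => (∫ g, (peakPoly n).eval (halfTrace g) ∂haar)⁻¹ *
      ∫ g, (peakPoly n).eval (halfTrace g) * f g ∂haar) atTop (𝓝 (f 1)) := by
  have htr := continuous_halfTrace
  have hpeak := tendsto_setIntegral_pow_smul_of_unique_maximum_of_isCompact_of_continuousOn
    (μ := haar) (s := univ) (x₀ := (1 : SU2)) (c := fun g => 1 / 2 * (1 + halfTrace g)) (g := f)
    isCompact_univ (by fun_prop) (fun g _ hg => ?_) (fun g _ => ?_) (by norm_num [halfTrace_one])
    (by simp) hf.continuousOn
  · simpa only [eval_peakPoly, Measure.restrict_univ, smul_eq_mul] using hpeak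
  · have hlt := (le_of_abs_le (abs_halfTrace_le g)).lt_of_ne
      (mt eq_one_of_halfTrace_eq_one hg)
    rw [halfTrace_one]
    linarith
  · have := neg_le_of_abs_le (abs_halfTrace_le g)
    linarith

theorem abs_integral_peakPoly_mul_char_le (n m : ℕ) :
    |(∫ g, (peakPoly n).eval (halfTrace g) ∂haar)⁻¹ *
      ∫ g, (peakPoly n).eval (halfTrace g) * char m g ∂haar| ≤ m + 1 := by
  have htr := continuous_halfTrace
  have hmass : 0 ≤ ∫ g, (peakPoly n).eval (halfTrace g) ∂haar :=
    integral_nonneg (eval_peakPoly_nonneg n)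
  have hint : |∫ g, (peakPoly n).eval (halfTrace g) * char m g ∂haar| ≤
      (∫ g, (peakPoly n).eval (halfTrace g) ∂haar) * (m + 1) := by
    rw [← integral_mul_const]
    refine abs_integral_le_integral_abs.trans (integral_mono_of_nonneg
      (Eventually.of_forall fun g => abs_nonneg _) (integrable_of_continuous (by fun_prop))
      (Eventually.of_forall fun g => ?_))
    simp only [abs_mul, abs_of_nonneg (eval_peakPoly_nonneg n g)]
    exact mul_le_mul_of_nonneg_left (abs_char_le m g) (eval_peakPoly_nonneg n g)
  rw [abs_mul, abs_inv, abs_of_nonneg hmass]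
  exact inv_mul_le_of_le_mul₀ hmass (by positivity) hint

theorem IsHeatKernel.hasSum {k : ℝ → SU2 → ℝ} (hk : IsHeatKernel k) (h : SU2) {t : ℝ}
    (ht : 0 < t) : HasSum (fun m : ℕ => ((m : ℝ) + 1) * heatChar t m h) (k t h) := by
  set d : ℕ → ℕ → ℝ := fun n m => (∫ g, (peakPoly n).eval (halfTrace g) ∂haar)⁻¹ *
    ∫ g, (peakPoly n).eval (halfTrace g) * char m g ∂haar with hd
  have hbound : ∀ m : ℕ, ((m : ℝ) + 1) * |heatChar t m h| ≤
      ((m : ℝ) + 1) ^ 3 * exp (-(2 * m * t)) := fun m =>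
    calc ((m : ℝ) + 1) * |heatChar t m h| ≤ (m + 1) * (((m : ℝ) + 1) ^ 2 * exp (-(2 * m * t))) :=
          mul_le_mul_of_nonneg_left (abs_heatChar_le ht m h) (by positivity)
      _ = _ := by ring
  have hseries : ∀ n, (∫ g, (peakPoly n).eval (halfTrace g) ∂haar)⁻¹ *
      ∫ g, (peakPoly n).eval (halfTrace g) * k t (h * g) ∂haar =
        ∑' m, d n m * heatChar t m h := fun n => by
    have htranslate : ∫ g, (peakPoly n).eval (halfTrace (h⁻¹ * g)) * k t g ∂haar =
        ∫ g, (peakPoly n).eval (halfTrace g) * k t (h * g) ∂haar := by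
      rw [← integral_mul_left_eq_self _ h]
      simp only [inv_mul_cancel_left]
    have hsum := hk.hasSum_integral_eval_halfTrace h⁻¹ ht (peakPoly n)
    simp only [heatChar_inv, htranslate] at hsum
    simp only [hd, mul_assoc, tsum_mul_left, hsum.tsum_eq]
  have hlim : Tendsto (fun n => ∑' m, d n m * heatChar t m h) atTop
      (𝓝 (∑' m : ℕ, ((m : ℝ) + 1) * heatChar t m h)) := by
    refine tendsto_tsum_of_dominated_convergence (summable_cube_mul_exp ht)
      (fun m => ?_) (Eventually.of_forall fun n m => ?_)
    · rw [← char_at_one m]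
      exact (tendsto_integral_peakPoly (continuous_char m)).mul_const _
    · rw [norm_mul, Real.norm_eq_abs, Real.norm_eq_abs]
      exact (mul_le_mul_of_nonneg_right (abs_integral_peakPoly_mul_char_le n m)
        (abs_nonneg _)).trans (hbound m)
  have hlim' : Tendsto (fun n => ∑' m, d n m * heatChar t m h) atTop (𝓝 (k t h)) := by
    have hpeak := tendsto_integral_peakPoly ((hk.continuous t ht).comp (continuous_const_mul h))
    simp only [Function.comp_apply, mul_one] at hpeak
    exact hpeak.congr hseries
  rw [tendsto_nhds_unique hlim' hlim]
  refine (Summable.of_norm_bounded (summable_cube_mul_exp ht) fun m => ?_).hasSum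
  rw [norm_mul, Real.norm_eq_abs, Real.norm_eq_abs, abs_of_pos (by positivity : (0 : ℝ) < m + 1)]
  exact hbound m

theorem sph_cyl (p q : ℕ) (r ϑ z : ℝ) :
    sph p q (cyl r ϑ z) =
      (Complex.exp (((p : ℂ) - q) * (z * Complex.I)) * diagCoeff (cyl r 0 0).1 p q).re := by
  have hexp : Complex.exp (z * Complex.I) * Complex.exp (-(z * Complex.I)) = 1 := by
    rw [← Complex.exp_add, add_neg_cancel, Complex.exp_zero]
  rw [sph, diagCoeff_twist (M := (cyl r 0 0).1) hexp (by simp [cyl, mul_comm])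
    (by simp [cyl, mul_comm]) ((det_eq_one _).trans (det_eq_one _).symm),
    ← Complex.exp_nat_mul, ← Complex.exp_nat_mul, ← Complex.exp_add]
  ring_nf

/-! ### Integral representation of the heat kernel -/

/-- The point with imaginary part `y` of the vertical line of real part `θ`. -/
def line (θ y : ℝ) : ℂ := θ + y * Complex.I

/-- The heat-type weight `exp ((w - z) ^ 2 / (4 * t))` at the point `w = line θ y`; it is Gaussian
in `y`. -/
def gaussWeight (t θ z y : ℝ) : ℂ := Complex.exp ((line θ y - z) ^ 2 / (4 * t))

theorem continuous_line (θ : ℝ) : Continuous (line θ) := by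
  unfold line
  fun_prop

theorem continuous_gaussWeight (t θ z : ℝ) : Continuous (gaussWeight t θ z) := by
  have := continuous_line θ
  unfold gaussWeight
  fun_prop

theorem gaussWeight_mul_exp {t : ℝ} (ht : 0 < t) (θ z y : ℝ) (j : ℂ) :
    gaussWeight t θ z y * Complex.exp (j * (line θ y * Complex.I)) =
      Complex.exp (((-(1 / (4 * t)) : ℝ) : ℂ) * y ^ 2 +
        (Complex.I * (θ - z) / (2 * t) - j) * y +
          ((θ - z) ^ 2 / (4 * t) + j * θ * Complex.I)) := by
  have ht' : (t : ℂ) ≠ 0 := mod_cast ht.ne'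
  rw [gaussWeight, ← Complex.exp_add, line]
  congr 1
  push_cast
  field_simp
  linear_combination (2 * y ^ 2 + 8 * j * t * y) * Complex.I_sq

theorem integrable_gaussWeight_mul_exp {t : ℝ} (ht : 0 < t) (θ z : ℝ) (j : ℂ) :
    Integrable fun y => gaussWeight t θ z y * Complex.exp (j * (line θ y * Complex.I)) := by
  simp only [gaussWeight_mul_exp ht]
  refine integrable_cexp_quadratic' ?_ _ _
  rw [Complex.ofReal_re, neg_lt_zero]
  positivity

theorem integral_gaussWeight_mul_exp {t : ℝ} (ht : 0 < t) (θ z : ℝ) (j : ℂ) :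
    ∫ y, gaussWeight t θ z y * Complex.exp (j * (line θ y * Complex.I)) =
      (√(4 * π * t) : ℝ) * Complex.exp (t * j ^ 2 + j * (z * Complex.I)) := by
  have ht' : (t : ℂ) ≠ 0 := mod_cast ht.ne'
  have hneg : (((-(1 / (4 * t)) : ℝ) : ℂ)).re < 0 := by
    rw [Complex.ofReal_re, neg_lt_zero]
    positivity
  simp only [gaussWeight_mul_exp ht]
  rw [integral_cexp_quadratic hneg]
  congr 1
  · have hdiv : (π / -((-(1 / (4 * t)) : ℝ) : ℂ) : ℂ) = ((4 * π * t : ℝ) : ℂ) := by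
      push_cast
      field_simp
    rw [hdiv, Real.sqrt_eq_rpow, Complex.ofReal_cpow (by positivity)]
    push_cast
    rfl
  · congr 1
    push_cast
    field_simp
    linear_combination (4 * (θ - z) ^ 2 : ℂ) * Complex.I_sq

theorem norm_gaussWeight_mul_exp {t : ℝ} (ht : 0 < t) (θ z y j : ℝ) :
    ‖gaussWeight t θ z y * Complex.exp (j * (line θ y * Complex.I))‖ =
      exp ((θ - z) ^ 2 / (4 * t)) *
        (gaussWeight t 0 0 y * Complex.exp (j * (line 0 y * Complex.I))).re := by
  have hreal : gaussWeight t 0 0 y * Complex.exp (j * (line 0 y * Complex.I)) =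
      ((exp (-(1 / (4 * t)) * y ^ 2 - j * y) : ℝ) : ℂ) := by
    rw [gaussWeight_mul_exp ht]
    push_cast
    congr 1
    ring
  have hsplit : (((-(1 / (4 * t)) : ℝ) : ℂ) * y ^ 2 +
      (Complex.I * (θ - z) / (2 * t) - j) * y + ((θ - z) ^ 2 / (4 * t) + j * θ * Complex.I)) =
      ((-(1 / (4 * t)) * y ^ 2 - j * y + (θ - z) ^ 2 / (4 * t) : ℝ) : ℂ) +
        (((θ - z) / (2 * t) * y + j * θ : ℝ) : ℂ) * Complex.I := by
    push_cast
    ring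
  rw [hreal, Complex.ofReal_re, ← exp_add, gaussWeight_mul_exp ht, Complex.norm_exp, hsplit,
    Complex.add_re, Complex.ofReal_re, Complex.re_ofReal_mul, Complex.I_re]
  ring_nf

theorem integral_norm_gaussWeight_mul_exp {t : ℝ} (ht : 0 < t) (θ z j : ℝ) :
    ∫ y, ‖gaussWeight t θ z y * Complex.exp (j * (line θ y * Complex.I))‖ =
      exp ((θ - z) ^ 2 / (4 * t)) * (√(4 * π * t) * exp (t * j ^ 2)) := by
  have hre : ∫ y, (gaussWeight t 0 0 y * Complex.exp (j * (line 0 y * Complex.I))).re =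
      √(4 * π * t) * exp (t * j ^ 2) := by
    have h := congrArg Complex.re (integral_gaussWeight_mul_exp ht 0 0 j)
    rw [show (t * (j : ℂ) ^ 2 + j * (((0 : ℝ) : ℂ) * Complex.I)) = ((t * j ^ 2 : ℝ) : ℂ) by
      push_cast; ring, ← Complex.ofReal_exp, ← Complex.ofReal_mul, Complex.ofReal_re] at h
    rw [← h]
    exact integral_re (𝕜 := ℂ) (integrable_gaussWeight_mul_exp ht 0 0 j)
  simp only [norm_gaussWeight_mul_exp ht]
  rw [integral_const_mul, hre]

/-- The multiplicity `m + 1` times the decay at time `t` of the characters of degree `m` under the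
heat semigroup of the Laplace-Beltrami operator `X² + Y² + Z²`. -/
def ellipticWeight (t : ℝ) (m : ℕ) : ℝ := (m + 1) * exp (-(m * (m + 2)) * t)

/-- The heat kernel of the Laplace-Beltrami operator of `SU(2)`, as a function of half the trace
extended to complex arguments. -/
def ellipticKernel (t : ℝ) (u : ℂ) : ℂ := ∑' m : ℕ, ellipticWeight t m * (U ℂ m).eval u

theorem ellipticWeight_nonneg (t : ℝ) (m : ℕ) : 0 ≤ ellipticWeight t m := by
  rw [ellipticWeight]
  positivity

theorem ellipticWeight_mul_exp (t : ℝ) (p q : ℕ) :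
    ellipticWeight t (p + q) * exp (t * ((p : ℝ) - q) ^ 2) =
      ((p + q : ℕ) + 1) * exp (-eig p q * t) := by
  rw [ellipticWeight, mul_assoc, ← exp_add, eig]
  push_cast
  ring_nf

/-- The contribution of degree `m` to the integral representation of the heat kernel. -/
def kernelMode (t r θ z : ℝ) (m : ℕ) (y : ℝ) : ℂ :=
  gaussWeight t θ z y *
    (ellipticWeight t m * (U ℂ m).eval (cos r * Complex.cos (line θ y)))

theorem kernelMode_eq_sum (t r θ z : ℝ) (m : ℕ) (y : ℝ) :
    kernelMode t r θ z m y = ∑ x ∈ antidiagonal m,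
      (ellipticWeight t m * diagCoeff (cyl r 0 0).1 x.1 x.2) *
        (gaussWeight t θ z y *
          Complex.exp (((x.1 - x.2 : ℝ) : ℂ) * (line θ y * Complex.I))) := by
  rw [kernelMode, ← sum_twist_diagCoeff (M := (cyl r 0 0).1) (δ := line θ y) (det_eq_one _)
    (by simp [cyl, Complex.cos]; ring), Finset.mul_sum, Finset.mul_sum]
  refine Finset.sum_congr rfl fun x _ => ?_
  push_cast
  ring

theorem integrable_kernelMode {t : ℝ} (ht : 0 < t) (r θ z : ℝ) (m : ℕ) :
    Integrable (kernelMode t r θ z m) := by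
  rw [funext (kernelMode_eq_sum t r θ z m)]
  exact integrable_finsetSum _ fun x _ =>
    (integrable_gaussWeight_mul_exp ht θ z _).const_mul _

theorem integral_kernelMode {t : ℝ} (ht : 0 < t) (r ϑ θ z : ℝ) (m : ℕ) :
    (((√(4 * π * t) : ℝ) : ℂ)⁻¹ * ∫ y, kernelMode t r θ z m y).re =
      (m + 1) * heatChar t m (cyl r ϑ z) := by
  have hsqrt : ((√(4 * π * t) : ℝ) : ℂ) ≠ 0 :=
    mod_cast (Real.sqrt_pos.2 (by positivity : 0 < 4 * π * t)).ne'
  simp only [kernelMode_eq_sum]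
  rw [integral_finsetSum _ fun x _ => (integrable_gaussWeight_mul_exp ht θ z _).const_mul _,
    Finset.mul_sum, heatChar, Finset.mul_sum, Complex.re_sum]
  refine Finset.sum_congr rfl fun x hx => ?_
  rw [← Finset.HasAntidiagonal.mem_antidiagonal.1 hx, ← mul_assoc, ← ellipticWeight_mul_exp,
    sph_cyl, ← Complex.re_ofReal_mul, integral_const_mul, integral_gaussWeight_mul_exp ht,
    Complex.exp_add]
  congr 1
  push_cast
  field_simp

theorem integral_norm_kernelMode_summand_le {t : ℝ} (ht : 0 < t) (r θ z : ℝ) (p q : ℕ) :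
    ∫ y, ‖(ellipticWeight t (p + q) * diagCoeff (cyl r 0 0).1 p q) *
        (gaussWeight t θ z y * Complex.exp (((p - q : ℝ) : ℂ) * (line θ y * Complex.I)))‖ ≤
      exp ((θ - z) ^ 2 / (4 * t)) * √(4 * π * t) *
        (((p + q : ℕ) + 1) ^ 2 * exp (-(2 * (p + q : ℕ) * t))) := by
  have hcoeff := norm_diagCoeff_le (det_eq_one (cyl r 0 0)) (apply_one_one _)
    (norm_apply_zero_zero_le _) p q
  have heig := two_mul_le_eig p q
  have hweight := ellipticWeight_mul_exp t p q
  simp only [norm_mul _ (gaussWeight _ _ _ _ * _)]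
  rw [integral_const_mul, integral_norm_gaussWeight_mul_exp ht, norm_mul, Complex.norm_real,
    Real.norm_of_nonneg (ellipticWeight_nonneg t (p + q))]
  calc _ = exp ((θ - z) ^ 2 / (4 * t)) * √(4 * π * t) *
        (((p + q : ℕ) + 1) * ‖diagCoeff (cyl r 0 0).1 p q‖ * exp (-eig p q * t)) := by
        linear_combination exp ((θ - z) ^ 2 / (4 * t)) * √(4 * π * t) *
          ‖diagCoeff (cyl r 0 0).1 p q‖ * hweight
    _ ≤ exp ((θ - z) ^ 2 / (4 * t)) * √(4 * π * t) *
        (((p + q : ℕ) + 1) * ((p + q : ℕ) + 1) * exp (-(2 * (p + q : ℕ) * t))) := by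
        gcongr
        linarith [mul_le_mul_of_nonneg_right heig ht.le]
    _ = _ := by ring

theorem integral_norm_kernelMode_le {t : ℝ} (ht : 0 < t) (r θ z : ℝ) (m : ℕ) :
    ∫ y, ‖kernelMode t r θ z m y‖ ≤ exp ((θ - z) ^ 2 / (4 * t)) * √(4 * π * t) *
      (((m : ℝ) + 1) ^ 3 * exp (-(2 * m * t))) := by
  set F : ℕ × ℕ → ℝ → ℂ := fun x y => (ellipticWeight t m * diagCoeff (cyl r 0 0).1 x.1 x.2) *
    (gaussWeight t θ z y * Complex.exp (((x.1 - x.2 : ℝ) : ℂ) * (line θ y * Complex.I)))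
  have hF : ∀ x, Integrable fun y => ‖F x y‖ := fun x =>
    ((integrable_gaussWeight_mul_exp ht θ z _).const_mul _).norm
  have hterm : ∀ x ∈ antidiagonal m, ∫ y, ‖F x y‖ ≤
      exp ((θ - z) ^ 2 / (4 * t)) * √(4 * π * t) * (((m : ℝ) + 1) ^ 2 * exp (-(2 * m * t))) := by
    intro x hx
    have hsummand := integral_norm_kernelMode_summand_le ht r θ z x.1 x.2
    rwa [Finset.HasAntidiagonal.mem_antidiagonal.1 hx] at hsummand
  calc ∫ y, ‖kernelMode t r θ z m y‖ ≤ ∫ y, ∑ x ∈ antidiagonal m, ‖F x y‖ := by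
        refine integral_mono (integrable_kernelMode ht r θ z m).norm
          (integrable_finsetSum _ fun x _ => hF x) fun y => ?_
        simp only [kernelMode_eq_sum]
        exact norm_sum_le _ _
    _ ≤ ∑ x ∈ antidiagonal m, exp ((θ - z) ^ 2 / (4 * t)) * √(4 * π * t) *
        (((m : ℝ) + 1) ^ 2 * exp (-(2 * m * t))) := by
        rw [integral_finsetSum _ fun x _ => hF x]
        exact Finset.sum_le_sum hterm
    _ = _ := by
        rw [Finset.sum_const, Finset.Nat.card_antidiagonal, nsmul_eq_mul]
        push_cast
        ring

theorem IsHeatKernel.eq_integral {k : ℝ → SU2 → ℝ} (hk : IsHeatKernel k) (r ϑ z θ : ℝ) {t : ℝ}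
    (ht : 0 < t) : k t (cyl r ϑ z) = (((√(4 * π * t) : ℝ) : ℂ)⁻¹ *
      ∫ y, gaussWeight t θ z y * ellipticKernel t (cos r * Complex.cos (line θ y))).re := by
  have hsummable : Summable fun m => ∫ y, ‖kernelMode t r θ z m y‖ :=
    .of_nonneg_of_le (fun m => integral_nonneg fun y => norm_nonneg _)
      (integral_norm_kernelMode_le ht r θ z) ((summable_cube_mul_exp ht).mul_left _)
  have hsum := Complex.hasSum_re ((hasSum_integral_of_summable_integral_norm
    (integrable_kernelMode ht r θ z) hsummable).mul_left ((√(4 * π * t) : ℝ) : ℂ)⁻¹)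
  simp only [integral_kernelMode ht r ϑ] at hsum
  simp only [kernelMode, tsum_mul_left] at hsum
  exact (hk.hasSum (cyl r ϑ z) ht).unique hsum

/-! ### Poisson summation for the elliptic kernel -/

/-- The odd Gaussian `s exp (-s² / (4t))`: the heat kernel of the real line, differentiated, up to a
factor depending on `t`. Its translates are the images in Poisson's formula for
`ellipticKernel`. -/
def oddGauss (t : ℝ) (s : ℂ) : ℂ := s * Complex.exp (-s ^ 2 / (4 * t))

theorem im_div_pi_mul_I_pos {t : ℝ} (ht : 0 < t) : 0 < ((t / π : ℂ) * Complex.I).im := by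
  rw [show (t / π : ℂ) = ((t / π : ℝ) : ℂ) by push_cast; rfl, Complex.im_ofReal_mul, Complex.I_im]
  positivity

theorem neg_one_div_div_pi_mul_I (t : ℝ) :
    -1 / ((t / π : ℂ) * Complex.I) = ((π / t : ℝ) : ℂ) * Complex.I := by
  push_cast
  rw [← div_div, neg_div, one_div_div, div_eq_mul_inv, Complex.inv_I]
  ring

theorem jacobiTheta₂'_term_pair (δ : ℂ) (t : ℝ) (m : ℕ) :
    jacobiTheta₂'_term ((m + 1 : ℕ) : ℤ) (δ / (2 * π)) (t / π * Complex.I) +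
        jacobiTheta₂'_term (-((m + 1 : ℕ) : ℤ)) (δ / (2 * π)) (t / π * Complex.I) =
      -4 * π * Complex.exp (-t) * Complex.sin δ *
        (ellipticWeight t m * (U ℂ m).eval (Complex.cos δ)) := by
  have hπ : (π : ℂ) ≠ 0 := mod_cast pi_ne_zero
  have hterm (n : ℤ) : jacobiTheta₂'_term n (δ / (2 * π)) (t / π * Complex.I) =
      2 * π * Complex.I * n * (Complex.exp (n * δ * Complex.I) *
        Complex.exp (-(n : ℂ) ^ 2 * t)) := by
    rw [jacobiTheta₂'_term, jacobiTheta₂_term, ← Complex.exp_add]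
    congr 2
    field_simp
    linear_combination (n : ℂ) ^ 2 * t * Complex.I_sq
  have hdecay : Complex.exp (-((m : ℂ) + 1) ^ 2 * t) =
      Complex.exp (-t) * Complex.exp (-((m : ℂ) * (m + 2)) * t) := by
    rw [← Complex.exp_add]
    ring_nf
  have hsin := Complex.two_sin (((m : ℂ) + 1) * δ)
  have hU := Polynomial.Chebyshev.U_complex_cos δ m
  push_cast [hterm, ellipticWeight] at hU ⊢
  rw [neg_sq, hdecay, neg_mul ((m : ℂ) + 1) δ]
  linear_combination 2 * π * ((m : ℂ) + 1) * (Complex.exp (-t) *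
    Complex.exp (-((m : ℂ) * (m + 2)) * t)) * (hsin + 2 * hU)

theorem jacobiTheta₂'_eq_ellipticKernel (δ : ℂ) {t : ℝ} (ht : 0 < t) :
    jacobiTheta₂' (δ / (2 * π)) (t / π * Complex.I) =
      -4 * π * Complex.exp (-t) * Complex.sin δ * ellipticKernel t (Complex.cos δ) := by
  have hzero : jacobiTheta₂'_term 0 (δ / (2 * π)) (t / π * Complex.I) = 0 := by
    simp [jacobiTheta₂'_term]
  have hsum := (hasSum_nat_add_iff' 1).2
    (hasSum_jacobiTheta₂'_term (δ / (2 * π)) (im_div_pi_mul_I_pos ht)).nat_add_neg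
  simp only [Finset.sum_range_one, Nat.cast_zero, neg_zero, hzero, add_zero, sub_zero,
    jacobiTheta₂'_term_pair] at hsum
  rw [ellipticKernel, ← tsum_mul_left, hsum.tsum_eq]

theorem exp_mul_jacobiTheta₂_term (δ : ℂ) {t : ℝ} (ht : 0 < t) (n : ℤ) :
    Complex.exp (-π * Complex.I * (δ / (2 * π)) ^ 2 / (t / π * Complex.I)) *
        jacobiTheta₂_term n (δ / (2 * π) / (t / π * Complex.I)) (-1 / (t / π * Complex.I)) =
      Complex.exp (-(δ - 2 * n * π) ^ 2 / (4 * t)) := by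
  have hπ : (π : ℂ) ≠ 0 := mod_cast pi_ne_zero
  have ht' : (t : ℂ) ≠ 0 := mod_cast ht.ne'
  have hI := Complex.I_ne_zero
  rw [jacobiTheta₂_term, ← Complex.exp_add, neg_one_div_div_pi_mul_I]
  congr 1
  push_cast
  field_simp
  linear_combination (16 * π ^ 2 * (n : ℂ) ^ 2 : ℂ) * Complex.I_sq

theorem hasSum_oddGauss_jacobiTheta₂ (δ : ℂ) {t : ℝ} (ht : 0 < t) :
    HasSum (fun k : ℤ => oddGauss t (δ + 2 * k * π))
      (Complex.I * (Complex.exp (-π * Complex.I * (δ / (2 * π)) ^ 2 / (t / π * Complex.I)) *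
        (jacobiTheta₂' (δ / (2 * π) / (t / π * Complex.I)) (-1 / (t / π * Complex.I)) -
          2 * π * Complex.I * (δ / (2 * π)) *
            jacobiTheta₂ (δ / (2 * π) / (t / π * Complex.I)) (-1 / (t / π * Complex.I))))) := by
  have hπ : (π : ℂ) ≠ 0 := mod_cast pi_ne_zero
  have him : 0 < (-1 / (t / π * Complex.I)).im := by
    rw [neg_one_div_div_pi_mul_I, Complex.im_ofReal_mul, Complex.I_im]
    positivity
  have hsum := (((hasSum_jacobiTheta₂'_term (δ / (2 * π) / (t / π * Complex.I)) him).sub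
    ((hasSum_jacobiTheta₂_term (δ / (2 * π) / (t / π * Complex.I)) him).mul_left
      (2 * π * Complex.I * (δ / (2 * π))))).mul_left
    (Complex.exp (-π * Complex.I * (δ / (2 * π)) ^ 2 / (t / π * Complex.I)))).mul_left Complex.I
  refine ((Equiv.neg ℤ).hasSum_iff.2 hsum).congr_fun fun k => ?_
  have himage := exp_mul_jacobiTheta₂_term δ ht (-k)
  push_cast at himage
  rw [show -(δ - 2 * -(k : ℂ) * π) ^ 2 = -(δ + 2 * k * π) ^ 2 by ring] at himage
  simp only [Function.comp_apply, Equiv.neg_apply, jacobiTheta₂'_term, oddGauss, ← himage]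
  generalize jacobiTheta₂_term _ _ _ = T
  push_cast
  field_simp
  linear_combination (δ + 2 * k * π) * T * Complex.I_sq

/-- The factor relating `ellipticKernel` to the sum of the images of `oddGauss`. -/
def poissonFactor (t : ℝ) : ℝ := 4 * t * √(t / π) * exp (-t)

theorem poissonFactor_pos {t : ℝ} (ht : 0 < t) : 0 < poissonFactor t := by
  rw [poissonFactor]
  positivity

theorem sqrt_mul_poissonFactor {t : ℝ} (ht : 0 < t) :
    √(4 * π * t) * poissonFactor t = 8 * t ^ 2 * exp (-t) := by
  have hsqrt : √(4 * π * t) * √(t / π) = 2 * t := by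
    rw [← Real.sqrt_mul (by positivity), show 4 * π * t * (t / π) = (2 * t) ^ 2 by field_simp; ring,
      Real.sqrt_sq (by positivity)]
  rw [poissonFactor]
  linear_combination 4 * t * exp (-t) * hsqrt

/-- Poisson summation: the functional equation of the Jacobi theta function. -/
theorem hasSum_oddGauss (δ : ℂ) {t : ℝ} (ht : 0 < t) :
    HasSum (fun k : ℤ => oddGauss t (δ + 2 * k * π))
      (Complex.sin δ * ellipticKernel t (Complex.cos δ) * poissonFactor t) := by
  have hπ : (π : ℂ) ≠ 0 := mod_cast pi_ne_zero
  have ht' : (t : ℂ) ≠ 0 := mod_cast ht.ne'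
  have hI := Complex.I_ne_zero
  have hs0 : ((√(t / π) : ℝ) : ℂ) ≠ 0 :=
    mod_cast (Real.sqrt_pos.2 (by positivity : 0 < t / π)).ne'
  have hsqrt : (-Complex.I * (t / π * Complex.I)) ^ (1 / 2 : ℂ) = ((√(t / π) : ℝ) : ℂ) := by
    rw [show -Complex.I * (t / π * Complex.I) = ((t / π : ℝ) : ℂ) by
      push_cast; linear_combination (-(t / π) : ℂ) * Complex.I_sq, Real.sqrt_eq_rpow,
      Complex.ofReal_cpow (by positivity)]
    norm_num
  have hfun := (jacobiTheta₂'_eq_ellipticKernel δ ht).symm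
  rw [jacobiTheta₂'_functional_equation, hsqrt] at hfun
  have hsum := hasSum_oddGauss_jacobiTheta₂ δ ht
  set theta := Complex.exp (-π * Complex.I * (δ / (2 * π)) ^ 2 / (t / π * Complex.I))
  set J := jacobiTheta₂' (δ / (2 * π) / (t / π * Complex.I)) (-1 / (t / π * Complex.I)) -
    2 * π * Complex.I * (δ / (2 * π)) *
      jacobiTheta₂ (δ / (2 * π) / (t / π * Complex.I)) (-1 / (t / π * Complex.I))
  have hvalue : theta * J = -4 * π * Complex.exp (-t) * Complex.sin δ *
      ellipticKernel t (Complex.cos δ) * (t / π * Complex.I * ((√(t / π) : ℝ) : ℂ)) := by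
    rw [hfun]
    field_simp
  convert hsum using 1
  rw [hvalue, poissonFactor]
  push_cast
  field_simp
  linear_combination (Complex.sin δ * ellipticKernel t (Complex.cos δ)) * Complex.I_sq

/-! ### The Fourier transform of the hyperbolic secant -/

theorem exists_one_add_pow_mul_exp_le {a : ℝ} (ha : 0 < a) (n : ℕ) :
    ∃ C : ℝ, ∀ x : ℝ, 0 ≤ x → (1 + x) ^ n * exp (-(a * x)) ≤ C := by
  refine ⟨exp a * (n.factorial / a ^ n), fun x hx => ?_⟩
  have h := Real.pow_div_factorial_le_exp (a * (1 + x)) (by positivity) n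
  rw [mul_pow, div_le_iff₀ (by positivity)] at h
  calc (1 + x) ^ n * exp (-(a * x))
      = exp a * ((1 + x) ^ n / exp (a * (1 + x))) := by
        rw [div_eq_mul_inv, ← exp_neg, mul_left_comm, ← exp_add]
        ring_nf
    _ ≤ exp a * (n.factorial / a ^ n) := by
        gcongr ?_ * ?_
        rw [div_le_div_iff₀ (exp_pos _) (by positivity)]
        linarith

theorem integrable_one_add_abs_pow_mul_exp {a : ℝ} (ha : 0 < a) (n : ℕ) :
    Integrable fun x : ℝ => (1 + |x|) ^ n * exp (-(a * |x|)) := by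
  obtain ⟨C, hC⟩ := exists_one_add_pow_mul_exp_le ha (n + 2)
  refine (integrable_inv_one_add_sq.const_mul C).mono' (by fun_prop) (.of_forall fun x => ?_)
  rw [Real.norm_of_nonneg (by positivity), ← div_eq_mul_inv, le_div_iff₀ (by positivity)]
  have hsq : 1 + x ^ 2 ≤ (1 + |x|) ^ 2 := by
    rw [← sq_abs x]
    nlinarith [abs_nonneg x]
  calc (1 + |x|) ^ n * exp (-(a * |x|)) * (1 + x ^ 2)
      ≤ (1 + |x|) ^ n * exp (-(a * |x|)) * (1 + |x|) ^ 2 := by gcongr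
    _ = (1 + |x|) ^ (n + 2) * exp (-(a * |x|)) := by ring
    _ ≤ C := hC |x| (abs_nonneg x)

theorem summable_linear_mul_exp_neg_sq (a b B : ℝ) {A : ℝ} (hA : 0 < A) :
    Summable fun k : ℤ => (a * |(k : ℝ)| + b) * exp (-(A * (k : ℝ) ^ 2 - B * |(k : ℝ)|)) := by
  have h0 := summable_pow_mul_jacobiTheta₂_term_bound (B / (2 * π)) (T := A / π) (by positivity) 0
  have h1 := summable_pow_mul_jacobiTheta₂_term_bound (B / (2 * π)) (T := A / π) (by positivity) 1
  refine ((h1.mul_left a).add (h0.mul_left b)).congr fun k => ?_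
  have hexponent : -π * (A / π * (k : ℝ) ^ 2 - 2 * (B / (2 * π)) * ((|k| : ℤ) : ℝ)) =
      -(A * (k : ℝ) ^ 2 - B * |(k : ℝ)|) := by
    push_cast
    field_simp
  rw [hexponent]
  push_cast
  ring

theorem cosh_ofReal_ne_zero (y : ℝ) : Complex.cosh y ≠ 0 :=
  mod_cast (cosh_pos y).ne'

/-- The integrand of the Fourier transform of the hyperbolic secant. -/
def sechMode (ξ y : ℝ) : ℂ := Complex.exp (-(ξ * y * Complex.I)) / Complex.cosh y

theorem continuous_sechMode (ξ : ℝ) : Continuous (sechMode ξ) :=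
  Continuous.div (by fun_prop) (by fun_prop) cosh_ofReal_ne_zero

theorem norm_sechMode_le (ξ y : ℝ) : ‖sechMode ξ y‖ ≤ 2 * exp (-|y|) := by
  have hcosh : exp |y| / 2 ≤ cosh y := by
    rw [← cosh_abs, cosh_eq]
    linarith [exp_pos (-|y|)]
  rw [sechMode, ← Complex.ofReal_mul, ← neg_mul, ← Complex.ofReal_neg, norm_div,
    Complex.norm_exp_ofReal_mul_I, ← Complex.ofReal_cosh, Complex.norm_real,
    Real.norm_of_nonneg (cosh_pos y).le, one_div, exp_neg,
    show 2 * (exp |y|)⁻¹ = (exp |y| / 2)⁻¹ by field_simp]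
  exact inv_anti₀ (by positivity) hcosh

theorem norm_mul_sechMode_le {w : ℂ} {C : ℝ} (ξ : ℝ) {y : ℝ} (hw : ‖w‖ ≤ C * (1 + |y|)) :
    ‖w * sechMode ξ y‖ ≤ 2 * C * ((1 + |y|) ^ 1 * exp (-(1 * |y|))) := by
  rw [norm_mul]
  refine (mul_le_mul hw (norm_sechMode_le ξ y) (norm_nonneg _)
    ((norm_nonneg _).trans hw)).trans_eq ?_
  ring_nf

theorem integrable_mul_sechMode (ξ : ℝ) {f : ℝ → ℂ} (hf : Continuous f) {C : ℝ}
    (hC : ∀ y, ‖f y‖ ≤ C * (1 + |y|)) : Integrable fun y => f y * sechMode ξ y :=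
  ((integrable_one_add_abs_pow_mul_exp one_pos 1).const_mul (2 * C)).mono'
    (hf.mul (continuous_sechMode ξ)).aestronglyMeasurable
    (.of_forall fun y => norm_mul_sechMode_le ξ (hC y))

theorem integrable_sechMode (ξ : ℝ) : Integrable (sechMode ξ) := by
  simpa using integrable_mul_sechMode ξ (continuous_const (y := 1)) (C := 1) (by simp)

theorem betaIntegral_half_sub_half_add (ξ : ℝ) :
    Complex.betaIntegral (1 / 2 - ξ / 2 * Complex.I) (1 / 2 + ξ / 2 * Complex.I) =
      π / Complex.cosh (π * ξ / 2) := by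
  have hbeta := Complex.Gamma_mul_Gamma_eq_betaIntegral (s := 1 / 2 - ξ / 2 * Complex.I)
    (t := 1 / 2 + ξ / 2 * Complex.I) (by simp) (by simp)
  have hrefl := Complex.Gamma_mul_Gamma_one_sub (1 / 2 - ξ / 2 * Complex.I)
  rw [show 1 - (1 / 2 - ξ / 2 * Complex.I) = 1 / 2 + ξ / 2 * Complex.I by ring, hbeta,
    show (1 / 2 - ξ / 2 * Complex.I) + (1 / 2 + ξ / 2 * Complex.I) = 1 by ring,
    Complex.Gamma_one, one_mul] at hrefl
  rw [hrefl, show (π * (1 / 2 - ξ / 2 * Complex.I) : ℂ) = π / 2 - (π * ξ / 2) * Complex.I by ring,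
    Complex.sin_pi_div_two_sub, Complex.cos_mul_I]

theorem sigmoid_eq_exp_sub_log (x : ℝ) : sigmoid x = exp (x / 2 - log (2 * cosh (x / 2))) := by
  have hneg : exp (-x) = exp (-(x / 2)) ^ 2 := by
    rw [← exp_nat_mul]
    ring_nf
  rw [exp_sub, exp_log (by positivity), sigmoid_def, cosh_eq, hneg, exp_neg]
  field_simp

theorem one_sub_sigmoid_eq_exp_sub_log (x : ℝ) :
    1 - sigmoid x = exp (-(x / 2) - log (2 * cosh (x / 2))) := by
  rw [← sigmoid_neg, sigmoid_eq_exp_sub_log, neg_div, cosh_neg]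

theorem sigmoid_smul_cpow_mul_cpow (ξ x : ℝ) : |sigmoid x * (1 - sigmoid x)| •
      ((sigmoid x : ℂ) ^ (1 / 2 - ξ / 2 * Complex.I - 1) *
        (1 - (sigmoid x : ℂ)) ^ (1 / 2 + ξ / 2 * Complex.I - 1)) =
    1 / 2 * sechMode ξ (x * (1 / 2)) := by
  have hpos : 0 < sigmoid x * (1 - sigmoid x) :=
    mul_pos (sigmoid_pos x) (by linarith [sigmoid_lt_one x])
  have hcpow (a : ℝ) (s : ℂ) : ((exp a : ℝ) : ℂ) ^ s = Complex.exp (a * s) := by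
    rw [Complex.cpow_def_of_ne_zero (mod_cast (exp_pos a).ne'), ← Complex.ofReal_log (exp_pos a).le,
      log_exp]
  rw [abs_of_pos hpos, Complex.real_smul, ← Complex.ofReal_one, ← Complex.ofReal_sub,
    one_sub_sigmoid_eq_exp_sub_log, sigmoid_eq_exp_sub_log, hcpow, hcpow, ← exp_add,
    ← Complex.exp_add, Complex.ofReal_exp, ← Complex.exp_add]
  set L := log (2 * cosh (x / 2))
  have hL : Complex.exp (-L) = 1 / (2 * Complex.cosh ((x * (1 / 2) : ℝ))) := by
    rw [← Complex.ofReal_neg, ← Complex.ofReal_exp, exp_neg, exp_log (by positivity)]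
    push_cast
    ring_nf
  rw [show (((x / 2 - L + (-(x / 2) - L) : ℝ) : ℂ) +
      (((x / 2 - L : ℝ) : ℂ) * (((1 : ℝ) : ℂ) / 2 - ξ / 2 * Complex.I - ((1 : ℝ) : ℂ)) +
        ((-(x / 2) - L : ℝ) : ℂ) * (((1 : ℝ) : ℂ) / 2 + ξ / 2 * Complex.I - ((1 : ℝ) : ℂ)))) =
      -(ξ * (x * (1 / 2) : ℝ) * Complex.I) + -L by push_cast; ring, Complex.exp_add, hL, sechMode]
  push_cast
  ring

/-- The logistic substitution turns the Fourier transform of the hyperbolic secant into a beta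
integral. -/
theorem integral_sechMode (ξ : ℝ) :
    ∫ y, sechMode ξ y = π / Complex.cosh (π * ξ / 2) := by
  rw [← betaIntegral_half_sub_half_add, Complex.betaIntegral,
    intervalIntegral.integral_of_le zero_le_one,
    integral_Ioc_eq_integral_Ioo, ← range_sigmoid, ← image_univ,
    integral_image_eq_integral_abs_deriv_smul MeasurableSet.univ
      (fun x _ => (hasDerivAt_sigmoid x).hasDerivWithinAt) sigmoid_injective.injOn,
    Measure.restrict_univ]
  simp only [sigmoid_smul_cpow_mul_cpow]
  rw [integral_const_mul, Measure.integral_comp_mul_right (sechMode ξ)]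
  norm_num
  ring

theorem hasDerivAt_sechMode (ξ y : ℝ) :
    HasDerivAt (fun ξ => sechMode ξ y) (-(y * Complex.I) * sechMode ξ y) ξ := by
  have hlinear : HasDerivAt (fun ξ : ℝ => -((ξ : ℂ) * y * Complex.I)) (-(y * Complex.I)) ξ := by
    simpa using ((((hasDerivAt_id ξ).ofReal_comp).mul_const (y : ℂ)).mul_const Complex.I).fun_neg
  refine (hlinear.cexp.div_const (Complex.cosh y)).congr_deriv ?_
  rw [sechMode]
  ring

theorem hasDerivAt_integral_sechMode (ξ : ℝ) :
    HasDerivAt (fun ξ => ∫ y, sechMode ξ y) (∫ y, -(y * Complex.I) * sechMode ξ y) ξ :=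
  (hasDerivAt_integral_of_dominated_loc_of_deriv_le (F := sechMode)
    (F' := fun ξ y => -(y * Complex.I) * sechMode ξ y) univ_mem
    (.of_forall fun ξ => (continuous_sechMode ξ).aestronglyMeasurable) (integrable_sechMode ξ)
    ((Continuous.mul (by fun_prop) (continuous_sechMode ξ)).aestronglyMeasurable)
    (.of_forall fun y ξ _ => norm_mul_sechMode_le (C := 1) ξ (by simp))
    ((integrable_one_add_abs_pow_mul_exp one_pos 1).const_mul (2 * 1))
    (.of_forall fun y ξ _ => hasDerivAt_sechMode ξ y)).2

theorem integral_mul_I_mul_sechMode (ξ : ℝ) :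
    ∫ y : ℝ, y * Complex.I * sechMode ξ y =
      π ^ 2 / 2 * (Complex.sinh (π * ξ / 2) / Complex.cosh (π * ξ / 2) ^ 2) := by
  have hleft := hasDerivAt_integral_sechMode ξ
  simp only [integral_sechMode, neg_mul, integral_neg] at hleft
  have hlinear : HasDerivAt (fun ξ : ℝ => (π * ξ / 2 : ℂ)) (π / 2) ξ := by
    simpa using (((hasDerivAt_id ξ).ofReal_comp).const_mul (π : ℂ)).div_const 2
  have hcosh : Complex.cosh (π * ξ / 2) ≠ 0 := mod_cast cosh_ofReal_ne_zero (π * ξ / 2)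
  have hright := (hasDerivAt_const ξ (π : ℂ)).fun_div
    ((Complex.hasDerivAt_cosh _).comp ξ hlinear) hcosh
  rw [← neg_inj, hleft.unique hright]
  simp only [Function.comp_apply]
  ring

/-! ### The heat kernel on the axis `r = 0` -/

theorem sin_line_pi_div_two (y : ℝ) : Complex.sin (line (π / 2) y) = Complex.cosh y := by
  rw [line, Complex.ofReal_div, Complex.ofReal_ofNat, add_comm, Complex.sin_add_pi_div_two,
    Complex.cos_mul_I]

/-- The leading factor of the heat kernel at the point `(0, z)` of the vertical axis. -/
def axisFactor (t z : ℝ) : ℝ := π ^ 2 * exp t / (4 * t ^ 2) * exp (-(2 * π * z - z ^ 2) / (4 * t))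

/-- The summands of the heat kernel on the vertical axis, normalized by `axisFactor`. -/
def axisTerm (t z : ℝ) (k : ℤ) : ℝ :=
  exp (-((k : ℝ) * (k + 1) * π ^ 2 / t)) *
    ((2 * (k : ℝ) + 1 + 2 * (k : ℝ) * exp (-(π / (2 * t) * (z + 2 * k * π)))) /
      (1 + exp (-(π / (2 * t) * (z + 2 * k * π)))) ^ 2)

/-- The contribution of the `k`-th image to the integral representation of the heat kernel at
`(0, z)`, for the line of integration through `π / 2`. -/
def axisMode (t z : ℝ) (k : ℤ) (y : ℝ) : ℂ :=
  (((poissonFactor t)⁻¹ * exp (-((z + 2 * k * π) * (π + 2 * k * π - z)) / (4 * t)) : ℝ) : ℂ) *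
    ((((π / 2 + 2 * k * π : ℝ) : ℂ) + y * Complex.I) * sechMode ((z + 2 * k * π) / (2 * t)) y)

theorem axisMode_eq {t : ℝ} (ht : 0 < t) (z : ℝ) (k : ℤ) (y : ℝ) :
    axisMode t z k y = gaussWeight t (π / 2) z y * (Complex.cosh y)⁻¹ * (poissonFactor t : ℂ)⁻¹ *
      oddGauss t (line (π / 2) y + 2 * k * π) := by
  have ht' : (t : ℂ) ≠ 0 := mod_cast ht.ne'
  have hexp : Complex.exp ((line (π / 2) y - z) ^ 2 / (4 * t)) *
      Complex.exp (-(line (π / 2) y + 2 * k * π) ^ 2 / (4 * t)) =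
      Complex.exp (-((z + 2 * k * π) * (π + 2 * k * π - z)) / (4 * t)) *
        Complex.exp (-((z + 2 * k * π) / (2 * t) * y * Complex.I)) := by
    rw [← Complex.exp_add, ← Complex.exp_add, line]
    congr 1
    push_cast
    field_simp
    ring
  have hline : line (π / 2) y = π / 2 + y * Complex.I := by
    rw [line]
    push_cast
    rfl
  rw [axisMode, oddGauss, gaussWeight, sechMode]
  push_cast [hline] at hexp ⊢
  linear_combination (-((Complex.cosh y)⁻¹ * (poissonFactor t : ℂ)⁻¹ *
    (π / 2 + y * Complex.I + 2 * k * π))) * hexp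

theorem hasSum_axisMode {t : ℝ} (ht : 0 < t) (z y : ℝ) :
    HasSum (fun k => axisMode t z k y) (gaussWeight t (π / 2) z y *
      ellipticKernel t (cos 0 * Complex.cos (line (π / 2) y))) := by
  have hfactor : (poissonFactor t : ℂ) ≠ 0 := mod_cast (poissonFactor_pos ht).ne'
  have hcosh := cosh_ofReal_ne_zero y
  have hsum := (hasSum_oddGauss (line (π / 2) y) ht).mul_left
    (gaussWeight t (π / 2) z y * (Complex.cosh y)⁻¹ * (poissonFactor t : ℂ)⁻¹)
  simp only [← axisMode_eq ht, sin_line_pi_div_two] at hsum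
  have hvalue : gaussWeight t (π / 2) z y * ellipticKernel t (Complex.cos (line (π / 2) y)) =
      gaussWeight t (π / 2) z y * (Complex.cosh y)⁻¹ * (poissonFactor t : ℂ)⁻¹ *
        (Complex.cosh y * ellipticKernel t (Complex.cos (line (π / 2) y)) * poissonFactor t) := by
    field_simp
  rw [Real.cos_zero, Complex.ofReal_one, one_mul, hvalue]
  exact hsum

theorem norm_axis_coeff_le (k : ℤ) (y : ℝ) :
    ‖((π / 2 + 2 * k * π : ℝ) : ℂ) + y * Complex.I‖ ≤
      (2 * π * |(k : ℝ)| + (π / 2 + 1)) * (1 + |y|) := by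
  have hre : |π / 2 + 2 * (k : ℝ) * π| ≤ π / 2 + 2 * |(k : ℝ)| * π := by
    simpa [abs_mul, abs_div, abs_of_pos pi_pos] using abs_add_le (π / 2) (2 * (k : ℝ) * π)
  have hnorm := norm_add_le ((π / 2 + 2 * k * π : ℝ) : ℂ) (y * Complex.I)
  rw [Complex.norm_real, norm_mul, Complex.norm_real, Complex.norm_I, mul_one, Real.norm_eq_abs,
    Real.norm_eq_abs] at hnorm
  have hprod : 0 ≤ (2 * π * |(k : ℝ)| + π / 2) * |y| := by positivity
  nlinarith

theorem continuous_axis_coeff (k : ℤ) :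
    Continuous fun y : ℝ => ((π / 2 + 2 * k * π : ℝ) : ℂ) + y * Complex.I := by
  fun_prop

theorem integrable_axisMode (t z : ℝ) (k : ℤ) : Integrable (axisMode t z k) :=
  (integrable_mul_sechMode _ (continuous_axis_coeff k) (norm_axis_coeff_le k)).const_mul _

theorem exp_axis_exponent_le {t : ℝ} (ht : 0 < t) (z : ℝ) (k : ℤ) :
    exp (-((z + 2 * k * π) * (π + 2 * k * π - z)) / (4 * t)) ≤ exp (z * (z - π) / (4 * t)) *
      exp (-(π ^ 2 / t * (k : ℝ) ^ 2 - π ^ 2 / (2 * t) * |(k : ℝ)|)) := by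
  rw [← exp_add, exp_le_exp, ← sub_nonneg]
  have hk : 0 ≤ |(k : ℝ)| + k := by linarith [neg_le_abs (k : ℝ)]
  calc 0 ≤ π ^ 2 / (2 * t) * (|(k : ℝ)| + k) := by positivity
    _ = _ := by
        field_simp
        ring

theorem norm_axisMode_le {t : ℝ} (ht : 0 < t) (z : ℝ) (k : ℤ) (y : ℝ) :
    ‖axisMode t z k y‖ ≤ (poissonFactor t)⁻¹ * (exp (z * (z - π) / (4 * t)) *
        exp (-(π ^ 2 / t * (k : ℝ) ^ 2 - π ^ 2 / (2 * t) * |(k : ℝ)|))) *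
      (2 * (2 * π * |(k : ℝ)| + (π / 2 + 1)) * ((1 + |y|) ^ 1 * exp (-(1 * |y|)))) := by
  have hfactor := poissonFactor_pos ht
  rw [axisMode, norm_mul, Complex.norm_real, Real.norm_of_nonneg (by positivity)]
  gcongr
  · exact exp_axis_exponent_le ht z k
  · exact norm_mul_sechMode_le _ (norm_axis_coeff_le k y)

theorem integral_norm_axisMode_le {t : ℝ} (ht : 0 < t) (z : ℝ) (k : ℤ) :
    ∫ y, ‖axisMode t z k y‖ ≤ ((poissonFactor t)⁻¹ * exp (z * (z - π) / (4 * t)) *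
        (2 * ∫ y : ℝ, (1 + |y|) ^ 1 * exp (-(1 * |y|)))) *
      ((2 * π * |(k : ℝ)| + (π / 2 + 1)) *
        exp (-(π ^ 2 / t * (k : ℝ) ^ 2 - π ^ 2 / (2 * t) * |(k : ℝ)|))) := by
  refine (integral_mono (integrable_axisMode t z k).norm
    (((integrable_one_add_abs_pow_mul_exp one_pos 1).const_mul _).const_mul _)
    (norm_axisMode_le ht z k)).trans_eq ?_
  rw [integral_const_mul, integral_const_mul]
  ring

theorem integral_axisMode (t z : ℝ) (k : ℤ) :
    ∫ y, axisMode t z k y =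
      (((poissonFactor t)⁻¹ * exp (-((z + 2 * k * π) * (π + 2 * k * π - z)) / (4 * t)) *
        ((π / 2 + 2 * k * π) * (π / cosh (π * ((z + 2 * k * π) / (2 * t)) / 2)) +
          π ^ 2 / 2 * (sinh (π * ((z + 2 * k * π) / (2 * t)) / 2) /
            cosh (π * ((z + 2 * k * π) / (2 * t)) / 2) ^ 2)) : ℝ) : ℂ) := by
  have hsplit (y : ℝ) := add_mul (((π / 2 + 2 * k * π : ℝ) : ℂ)) (y * Complex.I)
    (sechMode ((z + 2 * k * π) / (2 * t)) y)
  simp only [axisMode, hsplit]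
  rw [integral_const_mul, integral_add ((integrable_sechMode _).const_mul _)
    (integrable_mul_sechMode _ (by fun_prop) (C := 1) (by simp)), integral_const_mul,
    integral_sechMode, integral_mul_I_mul_sechMode]
  push_cast
  rfl

theorem axisFactor_mul_axisTerm {t : ℝ} (ht : 0 < t) (z : ℝ) (k : ℤ) :
    axisFactor t z * axisTerm t z k = (√(4 * π * t))⁻¹ * ((poissonFactor t)⁻¹ *
      exp (-((z + 2 * k * π) * (π + 2 * k * π - z)) / (4 * t)) *
      ((π / 2 + 2 * k * π) * (π / cosh (π * ((z + 2 * k * π) / (2 * t)) / 2)) +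
        π ^ 2 / 2 * (sinh (π * ((z + 2 * k * π) / (2 * t)) / 2) /
          cosh (π * ((z + 2 * k * π) / (2 * t)) / 2) ^ 2))) := by
  set a := π * ((z + 2 * k * π) / (2 * t)) / 2 with ha
  have hgauss : exp (-((z + 2 * k * π) * (π + 2 * k * π - z)) / (4 * t)) =
      exp (-(2 * π * z - z ^ 2) / (4 * t)) * exp (-((k : ℝ) * (k + 1) * π ^ 2 / t)) * exp a := by
    rw [← exp_add, ← exp_add, ha]
    congr 1
    field_simp
    ring
  have hratio : exp (-(π / (2 * t) * (z + 2 * k * π))) = exp (-a) ^ 2 := by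
    rw [← exp_nat_mul, ha]
    congr 1
    push_cast
    field_simp
  have hfactor : (√(4 * π * t))⁻¹ * (poissonFactor t)⁻¹ = exp t / (8 * t ^ 2) := by
    rw [← mul_inv, sqrt_mul_poissonFactor ht, exp_neg]
    field_simp
  rw [axisFactor, axisTerm, hratio, hgauss, mul_assoc _⁻¹, ← mul_assoc _⁻¹, hfactor, cosh_eq,
    sinh_eq, show exp a = (exp (-a))⁻¹ by rw [exp_neg, inv_inv]]
  have hv := exp_pos (-a)
  generalize exp (-a) = v at *
  field_simp
  ring

theorem IsHeatKernel.hasSum_axis {k : ℝ → SU2 → ℝ} (hk : IsHeatKernel k) (ϑ z : ℝ) {t : ℝ}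
    (ht : 0 < t) : HasSum (fun n : ℤ => axisFactor t z * axisTerm t z n) (k t (cyl 0 ϑ z)) := by
  have hsummable : Summable fun n => ∫ y, ‖axisMode t z n y‖ :=
    .of_nonneg_of_le (fun n => integral_nonneg fun y => norm_nonneg _)
      (integral_norm_axisMode_le ht z)
      ((summable_linear_mul_exp_neg_sq _ _ _ (by positivity)).mul_left _)
  have hsum := Complex.hasSum_re ((hasSum_integral_of_summable_integral_norm
    (integrable_axisMode t z) hsummable).mul_left ((√(4 * π * t) : ℝ) : ℂ)⁻¹)
  simp only [fun y => (hasSum_axisMode ht z y).tsum_eq] at hsum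
  rw [← hk.eq_integral 0 ϑ z (π / 2) ht] at hsum
  refine hsum.congr_fun fun n => ?_
  rw [integral_axisMode, ← Complex.ofReal_inv, ← Complex.ofReal_mul, Complex.ofReal_re,
    axisFactor_mul_axisTerm ht]

/-- A summable bound, uniform in `t ≤ 1`, for the deviation of the axis series from its leading
term. -/
def axisMajorant (k : ℤ) : ℝ :=
  (2 * |(k : ℝ)| + 2) * exp (-(π ^ 2 / 2 * (k : ℝ) ^ 2 - π ^ 2 / 2 * |(k : ℝ)|))

theorem abs_axisTerm_le (t z : ℝ) (k : ℤ) :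
    |axisTerm t z k| ≤ (2 * |(k : ℝ)| + 1) * exp (-((k : ℝ) * (k + 1) * π ^ 2 / t)) := by
  rw [axisTerm, abs_mul, abs_of_pos (exp_pos _), mul_comm]
  have hE := exp_pos (-(π / (2 * t) * (z + 2 * k * π)))
  generalize exp (-(π / (2 * t) * (z + 2 * k * π))) = E at *
  gcongr
  rw [abs_div, abs_of_pos (by positivity : 0 < (1 + E) ^ 2), div_le_iff₀ (by positivity)]
  have hodd : |2 * (k : ℝ) + 1| ≤ 2 * |(k : ℝ)| + 1 := by
    simpa [abs_mul] using abs_add_le (2 * (k : ℝ)) 1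
  calc |2 * (k : ℝ) + 1 + 2 * k * E| ≤ |2 * (k : ℝ) + 1| + 2 * |(k : ℝ)| * E := by
        simpa [abs_mul, abs_of_pos hE] using abs_add_le (2 * (k : ℝ) + 1) (2 * k * E)
    _ ≤ (2 * |(k : ℝ)| + 1) * (1 + E) := by nlinarith
    _ ≤ (2 * |(k : ℝ)| + 1) * (1 + E) ^ 2 := by
        gcongr
        exact le_self_pow₀ (by linarith) two_ne_zero

theorem abs_axisTerm_zero_sub_one_le (t z : ℝ) :
    |axisTerm t z 0 - 1| ≤ exp (-(π * z / 2) / t) * axisMajorant 0 := by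
  have hE : exp (-(π / (2 * t) * (z + 2 * (0 : ℤ) * π))) = exp (-(π * z / 2) / t) := by
    congr 1
    push_cast
    ring
  rw [axisTerm, axisMajorant, hE]
  have hpos := exp_pos (-(π * z / 2) / t)
  generalize exp (-(π * z / 2) / t) = E at *
  have hdev : exp (-(((0 : ℤ) : ℝ) * ((0 : ℤ) + 1) * π ^ 2 / t)) *
      ((2 * ((0 : ℤ) : ℝ) + 1 + 2 * ((0 : ℤ) : ℝ) * E) / (1 + E) ^ 2) - 1 =
      -(E * (2 + E) / (1 + E) ^ 2) := by
    simp
    field_simp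
    ring
  rw [hdev, abs_neg, abs_of_pos (by positivity), div_le_iff₀ (by positivity)]
  norm_num
  nlinarith [pow_pos hpos 2, pow_pos hpos 3]

theorem abs_axisTerm_neg_one_le {t z : ℝ} (ht : 0 < t) (hz : z ≤ π) :
    |axisTerm t z (-1)| ≤ exp (-(π * z / 2) / t) * axisMajorant (-1) := by
  have hE : (exp (-(π / (2 * t) * (z + 2 * (-1 : ℤ) * π))))⁻¹ ≤ exp (-(π * z / 2) / t) := by
    rw [← exp_neg, exp_le_exp, ← sub_nonneg]
    calc 0 ≤ π * (π - z) / t := div_nonneg (mul_nonneg pi_pos.le (sub_nonneg.2 hz)) ht.le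
      _ = _ := by
          push_cast
          field_simp
          ring
  have hmajorant : axisMajorant (-1) = 4 := by
    norm_num [axisMajorant]
  rw [hmajorant]
  refine le_trans ?_ (mul_le_mul_of_nonneg_right hE zero_le_four)
  rw [axisTerm]
  have hpos := exp_pos (-(π / (2 * t) * (z + 2 * (-1 : ℤ) * π)))
  generalize exp (-(π / (2 * t) * (z + 2 * (-1 : ℤ) * π))) = E at *
  have hvalue : exp (-(((-1 : ℤ) : ℝ) * ((-1 : ℤ) + 1) * π ^ 2 / t)) *
      ((2 * ((-1 : ℤ) : ℝ) + 1 + 2 * ((-1 : ℤ) : ℝ) * E) / (1 + E) ^ 2) =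
      -((1 + 2 * E) / (1 + E) ^ 2) := by
    norm_num
    ring
  rw [hvalue, abs_neg, abs_of_pos (by positivity), div_le_iff₀ (by positivity),
    show E⁻¹ * 4 * (1 + E) ^ 2 = 4 * (1 + E) ^ 2 / E by field_simp, le_div_iff₀ hpos]
  nlinarith

theorem abs_axisTerm_le_of_ne {t z : ℝ} (ht : 0 < t) (ht1 : t ≤ 1) (hz : z ≤ π) {k : ℤ}
    (h0 : k ≠ 0) (h1 : k ≠ -1) :
    |axisTerm t z k| ≤ exp (-(π * z / 2) / t) * axisMajorant k := by
  have hk : (2 : ℝ) ≤ (k : ℝ) * (k + 1) := by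
    have : 2 ≤ k * (k + 1) := by
      rcases lt_or_ge 0 k with h | h
      · nlinarith
      · nlinarith [show k ≤ -2 by omega]
    exact_mod_cast this
  have hexp : exp (-((k : ℝ) * (k + 1) * π ^ 2 / t)) ≤ exp (-(π * z / 2) / t) *
      exp (-(π ^ 2 / 2 * (k : ℝ) ^ 2 - π ^ 2 / 2 * |(k : ℝ)|)) := by
    rw [← exp_add, exp_le_exp]
    have hhalf : π ^ 2 / 2 * (k : ℝ) ^ 2 - π ^ 2 / 2 * |(k : ℝ)| ≤
        π ^ 2 / 2 * (k * (k + 1)) / t := by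
      rw [le_div_iff₀ ht]
      calc (π ^ 2 / 2 * (k : ℝ) ^ 2 - π ^ 2 / 2 * |(k : ℝ)|) * t
          ≤ π ^ 2 / 2 * (k * (k + 1)) * t := by
            gcongr
            nlinarith [neg_abs_le (k : ℝ), pow_pos pi_pos 2]
        _ ≤ π ^ 2 / 2 * (k * (k + 1)) := mul_le_of_le_one_right (by positivity) ht1
    have hother : π * z / 2 / t ≤ π ^ 2 / 2 * (k * (k + 1)) / t := by
      gcongr
      nlinarith [pi_pos, pow_pos pi_pos 2]
    rw [neg_div]
    linear_combination hhalf + hother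
  rw [axisMajorant]
  calc |axisTerm t z k| ≤ (2 * |(k : ℝ)| + 1) * exp (-((k : ℝ) * (k + 1) * π ^ 2 / t)) :=
        abs_axisTerm_le t z k
    _ ≤ (2 * |(k : ℝ)| + 2) * (exp (-(π * z / 2) / t) *
        exp (-(π ^ 2 / 2 * (k : ℝ) ^ 2 - π ^ 2 / 2 * |(k : ℝ)|))) := by
        gcongr
        norm_num
    _ = _ := by ring

theorem abs_axisTerm_sub_ite_le {t z : ℝ} (ht : 0 < t) (ht1 : t ≤ 1) (hz : z ≤ π) (k : ℤ) :
    |axisTerm t z k - if k = 0 then 1 else 0| ≤ exp (-(π * z / 2) / t) * axisMajorant k := by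
  split_ifs with h0
  · rw [h0]
    exact abs_axisTerm_zero_sub_one_le t z
  · rw [sub_zero]
    by_cases h1 : k = -1
    · rw [h1]
      exact abs_axisTerm_neg_one_le ht hz
    · exact abs_axisTerm_le_of_ne ht ht1 hz h0 h1

theorem IsHeatKernel.isBigO_axis {k : ℝ → SU2 → ℝ} (hk : IsHeatKernel k) (ϑ : ℝ) {z : ℝ}
    (hz : z ≤ π) : (fun t : ℝ => k t (cyl 0 ϑ z) / axisFactor t z - 1)
      =O[𝓝[>] 0] fun t : ℝ => exp (-(π * z / 2) / t) := by
  have hsummable : Summable axisMajorant := summable_linear_mul_exp_neg_sq 2 2 _ (by positivity)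
  refine .of_bound (∑' n, axisMajorant n) ?_
  filter_upwards [Ioc_mem_nhdsGT (zero_lt_one' ℝ)] with t ⟨ht, ht1⟩
  have hfactor : axisFactor t z ≠ 0 := by
    rw [axisFactor]
    positivity
  have hsum := ((hk.hasSum_axis ϑ z ht).div_const (axisFactor t z)).sub
    (hasSum_ite_eq (0 : ℤ) (1 : ℝ))
  simp only [mul_div_cancel_left₀ _ hfactor] at hsum
  rw [Real.norm_of_nonneg (exp_pos _).le, mul_comm]
  exact hsum.norm_le_of_bounded (hsummable.hasSum.mul_left _) (abs_axisTerm_sub_ite_le ht ht1 hz)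

/-! ### The equation `cos δ = c * cos w` on a vertical line -/

theorem line_re (θ y : ℝ) : (line θ y).re = θ := by simp [line]

theorem line_im (θ y : ℝ) : (line θ y).im = y := by simp [line]

theorem exists_cos_eq_re_mem_Icc (u : ℂ) : ∃ δ : ℂ, Complex.cos δ = u ∧ δ.re ∈ Icc 0 π := by
  obtain ⟨δ, hδ⟩ := Complex.cos_surjective u
  set n := round (δ.re / (2 * π))
  set δ' : ℂ := δ - n * (2 * π) with hδ'
  have hcos : Complex.cos δ' = u := by rw [hδ', Complex.cos_sub_int_mul_two_pi, hδ]
  have hre : δ'.re = (δ.re / (2 * π) - n) * (2 * π) := by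
    rw [hδ', Complex.sub_re, show (n * (2 * π) : ℂ) = ((n * (2 * π) : ℝ) : ℂ) by push_cast; rfl,
      Complex.ofReal_re]
    field_simp
  have habs : |δ'.re| ≤ π := by
    rw [hre, abs_mul, abs_of_pos two_pi_pos]
    nlinarith [pi_pos, abs_sub_round (δ.re / (2 * π))]
  rcases le_total 0 δ'.re with h | h
  · exact ⟨δ', hcos, h, (le_abs_self _).trans habs⟩
  · exact ⟨-δ', by rw [Complex.cos_neg, hcos], by simpa using h, (neg_le_abs _).trans habs⟩

theorem cos_re (δ : ℂ) : (Complex.cos δ).re = cos δ.re * cosh δ.im := by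
  rw [Complex.cos_eq]
  simp [← Complex.ofReal_cos, ← Complex.ofReal_cosh, ← Complex.ofReal_sin, ← Complex.ofReal_sinh]

theorem cos_im (δ : ℂ) : (Complex.cos δ).im = -(sin δ.re * sinh δ.im) := by
  rw [Complex.cos_eq]
  simp [← Complex.ofReal_cos, ← Complex.ofReal_cosh, ← Complex.ofReal_sin, ← Complex.ofReal_sinh]

theorem norm_cos_add_one (δ : ℂ) : ‖Complex.cos δ + 1‖ = cosh δ.im + cos δ.re := by
  have hnonneg : 0 ≤ cosh δ.im + cos δ.re := by
    linarith [one_le_cosh δ.im, neg_one_le_cos δ.re]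
  rw [← Real.sqrt_sq hnonneg, Complex.norm_def, Complex.normSq_apply, Complex.add_re,
    Complex.add_im, cos_re, cos_im, Complex.one_re, Complex.one_im]
  congr 1
  linear_combination
    (sinh δ.im ^ 2) * sin_sq_add_cos_sq δ.re + (cos δ.re ^ 2 - 1) * cosh_sq δ.im

theorem norm_cos_sub_one (δ : ℂ) : ‖Complex.cos δ - 1‖ = cosh δ.im - cos δ.re := by
  have h := norm_cos_add_one (δ + π)
  rw [Complex.cos_add_pi, Complex.add_im, Complex.add_re, Complex.ofReal_im, Complex.ofReal_re,
    add_zero, Real.cos_add_pi] at h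
  rw [← norm_neg, neg_sub, sub_eq_neg_add, h, sub_eq_add_neg]

/- On an ellipse with foci `±1` the sum `‖u + 1‖ + ‖u - 1‖` is `2 cosh (im δ)`, where `u = cos δ`;
hence the contraction by `c` towards `0` contracts `cosh (im δ) - 1`. -/
theorem cosh_im_sub_one_le {c : ℝ} (hc : c ∈ Ioo 0 1) {δ w : ℂ}
    (h : Complex.cos δ = c * Complex.cos w) : cosh δ.im - 1 ≤ c * (cosh w.im - 1) := by
  have hnorm_c : ‖(c : ℂ)‖ = c := Complex.norm_of_nonneg hc.1.le
  have hnorm_one_sub : ‖(1 - c : ℂ)‖ = 1 - c := mod_cast Complex.norm_of_nonneg (sub_pos.2 hc.2).le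
  have hadd : ‖Complex.cos δ + 1‖ ≤ c * ‖Complex.cos w + 1‖ + (1 - c) := by
    rw [h, show (c * Complex.cos w + 1 : ℂ) = c * (Complex.cos w + 1) + (1 - c) by ring]
    exact (norm_add_le _ _).trans_eq (by rw [norm_mul, hnorm_one_sub, hnorm_c])
  have hsub : ‖Complex.cos δ - 1‖ ≤ c * ‖Complex.cos w - 1‖ + (1 - c) := by
    rw [h, show (c * Complex.cos w - 1 : ℂ) = c * (Complex.cos w - 1) - (1 - c) by ring]
    exact (norm_sub_le _ _).trans_eq (by rw [norm_mul, hnorm_one_sub, hnorm_c])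
  rw [norm_cos_add_one, norm_cos_add_one] at hadd
  rw [norm_cos_sub_one, norm_cos_sub_one] at hsub
  linarith

theorem cosh_im_le_cosh {c : ℝ} (hc : c ∈ Ioo 0 1) {δ w : ℂ}
    (h : Complex.cos δ = c * Complex.cos w) : cosh δ.im ≤ cosh w.im := by
  nlinarith [cosh_im_sub_one_le hc h, one_le_cosh w.im, hc.2]

theorem cos_re_mul_cosh {c : ℝ} {δ w : ℂ} (h : Complex.cos δ = c * Complex.cos w) :
    cos δ.re * cosh δ.im = c * cos w.re * cosh w.im := by
  rw [← cos_re, h, Complex.re_ofReal_mul, cos_re, mul_assoc]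

/-- The amount by which `y²` exceeds `2 log cosh y`; it measures the decay of the Gaussian weight
along a vertical line that is left over once the growth of `cosh` is compensated. -/
def logCoshGap (y : ℝ) : ℝ := y ^ 2 - 2 * log (cosh y)

theorem logCoshGap_abs (y : ℝ) : logCoshGap |y| = logCoshGap y := by
  rw [logCoshGap, logCoshGap, sq_abs, cosh_abs]

theorem hasDerivAt_logCoshGap (y : ℝ) : HasDerivAt logCoshGap (2 * (y - tanh y)) y := by
  have hlog : HasDerivAt (fun y => log (cosh y)) (sinh y / cosh y) y :=
    (hasDerivAt_cosh y).log (cosh_pos y).ne'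
  refine ((hasDerivAt_pow 2 y).fun_sub (hlog.const_mul 2)).congr_deriv ?_
  rw [tanh_eq_sinh_div_cosh]
  push_cast
  ring

theorem hasDerivAt_sub_tanh (y : ℝ) : HasDerivAt (fun y => y - tanh y) (tanh y ^ 2) y := by
  have hcosh := (cosh_pos y).ne'
  have htanh := (hasDerivAt_sinh y).fun_div (hasDerivAt_cosh y) hcosh
  simp only [← tanh_eq_sinh_div_cosh] at htanh
  refine ((hasDerivAt_id y).fun_sub htanh).congr_deriv ?_
  rw [tanh_eq_sinh_div_cosh]
  field_simp
  ring

theorem strictMonoOn_sub_tanh : StrictMonoOn (fun y : ℝ => y - tanh y) (Ici 0) := by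
  refine strictMonoOn_of_deriv_pos (convex_Ici 0)
    (fun y _ => (hasDerivAt_sub_tanh y).continuousAt.continuousWithinAt) fun y hy => ?_
  rw [interior_Ici] at hy
  rw [(hasDerivAt_sub_tanh y).deriv, tanh_eq_sinh_div_cosh]
  have hsinh : 0 < sinh y := sinh_pos_iff.2 hy
  positivity

theorem sub_tanh_pos {y : ℝ} (hy : 0 < y) : 0 < y - tanh y := by
  simpa using strictMonoOn_sub_tanh self_mem_Ici hy.le hy

theorem monotoneOn_logCoshGap : MonotoneOn logCoshGap (Ici 0) := by
  refine monotoneOn_of_deriv_nonneg (convex_Ici 0)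
    (fun y _ => (hasDerivAt_logCoshGap y).continuousAt.continuousWithinAt)
    (fun y _ => (hasDerivAt_logCoshGap y).differentiableAt.differentiableWithinAt) fun y hy => ?_
  rw [interior_Ici] at hy
  rw [(hasDerivAt_logCoshGap y).deriv]
  linarith [sub_tanh_pos hy]

theorem exists_mul_le_sub_tanh {a : ℝ} (ha : 0 < a) :
    ∃ ε : ℝ, 0 < ε ∧ ∀ y, a ≤ y → ε * y ≤ y - tanh y := by
  set m := a - tanh a
  have hm : 0 < m := sub_tanh_pos ha
  refine ⟨m / (1 + m), by positivity, fun y hy => ?_⟩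
  have hmono : m ≤ y - tanh y := strictMonoOn_sub_tanh.monotoneOn ha.le (ha.le.trans hy) hy
  rw [div_mul_eq_mul_div, div_le_iff₀ (by positivity)]
  nlinarith [tanh_lt_one y]

theorem cosh_sub_one (y : ℝ) : cosh y - 1 = 2 * sinh (y / 2) ^ 2 := by
  rw [← mul_div_cancel₀ y (two_ne_zero' ℝ), cosh_two_mul, cosh_sq,
    mul_div_cancel_left₀ _ (two_ne_zero' ℝ)]
  ring

theorem exists_mul_sinh_le_sinh_sub {s a : ℝ} (hs : s < 1) (ha : 0 < a) :
    ∃ x : ℝ, 0 < x ∧ ∀ y, a ≤ y → s * sinh y ≤ sinh (y - x) := by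
  have htanh : 0 < tanh a := by
    rw [tanh_eq_sinh_div_cosh]
    exact div_pos (sinh_pos_iff.2 ha) (cosh_pos _)
  set x := arsinh ((1 - s) * tanh a)
  have hsinh_x : sinh x = (1 - s) * tanh a := sinh_arsinh _
  refine ⟨x, arsinh_pos_iff.2 (mul_pos (by linarith) htanh), fun y hy => ?_⟩
  have htanh_mul : tanh a * cosh y ≤ sinh y := by
    have := sinh_nonneg_iff.2 (sub_nonneg.2 hy)
    rw [sinh_sub] at this
    rw [tanh_eq_sinh_div_cosh, div_mul_eq_mul_div, div_le_iff₀ (cosh_pos _)]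
    linarith
  have hcosh : sinh y ≤ sinh y * cosh x :=
    le_mul_of_one_le_right (sinh_nonneg_iff.2 (ha.le.trans hy)) (one_le_cosh x)
  rw [sinh_sub, hsinh_x]
  nlinarith

theorem exists_abs_le_abs_sub {c η : ℝ} (hc : c ∈ Ioo 0 1) (hη : 0 < η) :
    ∃ ρ : ℝ, 0 < ρ ∧ ∀ b y : ℝ, η ≤ |y| → cosh b - 1 ≤ c * (cosh y - 1) → |b| ≤ |y| - ρ := by
  have hsqrt : √c < 1 := by
    rw [Real.sqrt_lt' one_pos, one_pow]
    exact hc.2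
  obtain ⟨x, hx, hshift⟩ := exists_mul_sinh_le_sinh_sub hsqrt (half_pos hη)
  refine ⟨2 * x, by positivity, fun b y hy hb => ?_⟩
  rw [← cosh_abs b, ← cosh_abs y, cosh_sub_one, cosh_sub_one] at hb
  have : 0 ≤ sinh (|y| / 2) := sinh_nonneg_iff.2 (by positivity)
  have hcontract : sinh (|b| / 2) ≤ √c * sinh (|y| / 2) := by
    refine le_of_sq_le_sq ?_ (by positivity)
    rw [mul_pow, Real.sq_sqrt hc.1.le]
    linarith
  linarith [sinh_le_sinh.1 (hcontract.trans (hshift (|y| / 2) (by linarith)))]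

theorem exists_mul_abs_le_logCoshGap_sub {c η : ℝ} (hc : c ∈ Ioo 0 1) (hη : 0 < η) :
    ∃ ε : ℝ, 0 < ε ∧ ∀ b y : ℝ, η ≤ |y| → cosh b - 1 ≤ c * (cosh y - 1) →
      ε * |y| ≤ logCoshGap y - logCoshGap b := by
  obtain ⟨ρ, hρ, hshift⟩ := exists_abs_le_abs_sub hc hη
  obtain ⟨ε, hε, hslope⟩ := exists_mul_le_sub_tanh (half_pos hη)
  set σ := min ρ (η / 2)
  have hσ : 0 < σ := lt_min hρ (by positivity)
  have hση : σ ≤ η / 2 := min_le_right _ _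
  refine ⟨σ * ε, by positivity, fun b y hy hb => ?_⟩
  have hbσ : |b| ≤ |y| - σ := (hshift b y hy hb).trans (by linarith [min_le_left ρ (η / 2)])
  have hmono : logCoshGap |b| ≤ logCoshGap (|y| - σ) :=
    monotoneOn_logCoshGap (abs_nonneg b) ((abs_nonneg b).trans hbσ) hbσ
  obtain ⟨ξ, hξ, hmean⟩ := exists_hasDerivAt_eq_slope logCoshGap (fun y => 2 * (y - tanh y))
    (show |y| - σ < |y| by linarith)
    (fun v _ => (hasDerivAt_logCoshGap v).continuousAt.continuousWithinAt)
    fun v _ => hasDerivAt_logCoshGap v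
  rw [eq_div_iff (by linarith)] at hmean
  have hξ_slope : ε * ξ ≤ ξ - tanh ξ := hslope ξ (by linarith [hξ.1])
  have hy_le : |y| ≤ 2 * ξ := by linarith [hξ.1]
  have hlinear : ε * |y| ≤ 2 * (ξ - tanh ξ) := by nlinarith
  have hbound := mul_le_mul_of_nonneg_left hlinear hσ.le
  rw [← logCoshGap_abs y, ← logCoshGap_abs b]
  linarith

theorem antitoneOn_log_cos_add_sq :
    AntitoneOn (fun x : ℝ => log (cos x) + x ^ 2 / 2) (Ico 0 (π / 2)) := by
  have hderiv (x : ℝ) (hx : x ∈ Ico 0 (π / 2)) :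
      HasDerivAt (fun x : ℝ => log (cos x) + x ^ 2 / 2) (x - tan x) x := by
    have hcos : cos x ≠ 0 := (cos_pos_of_mem_Ioo ⟨by linarith [hx.1, pi_pos], hx.2⟩).ne'
    refine (((hasDerivAt_cos x).log hcos).fun_add
      ((hasDerivAt_pow 2 x).div_const 2)).congr_deriv ?_
    rw [tan_eq_sin_div_cos]
    push_cast
    ring
  refine antitoneOn_of_deriv_nonpos (convex_Ico _ _)
    (fun x hx => (hderiv x hx).continuousAt.continuousWithinAt)
    (fun x hx => (hderiv x (interior_subset hx)).differentiableAt.differentiableWithinAt)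
    fun x hx => ?_
  rw [(hderiv x (interior_subset hx)).deriv]
  rw [interior_Ico] at hx
  linarith [lt_tan hx.1 hx.2]

theorem arccos_sq_le_of_cos_mul_eq {u a p q : ℝ} (hu : |u| ≤ 1) (ha : a ∈ Icc 0 π) (hp : 0 < p)
    (hpq : p ≤ q) (h : cos a * p = u * q) :
    arccos u ^ 2 ≤ a ^ 2 + 2 * (log q - log p) := by
  have hq : 0 < q := hp.trans_le hpq
  rcases le_or_gt u 0 with hu0 | hu0
  · have hcos : cos a ≤ u := by
      refine le_of_mul_le_mul_right ?_ hp
      rw [h]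
      exact mul_le_mul_of_nonpos_left hpq hu0
    have hle : arccos u ≤ a := by
      simpa only [arccos_cos ha.1 ha.2] using arccos_le_arccos hcos
    nlinarith [arccos_nonneg u, log_le_log hp hpq]
  · have hcos : u ≤ cos a := by
      refine le_of_mul_le_mul_right ?_ hp
      rw [h]
      gcongr
    have hle : a ≤ arccos u := by
      simpa only [arccos_cos ha.1 ha.2] using arccos_le_arccos hcos
    have hlt : arccos u < π / 2 := arccos_lt_pi_div_two.2 hu0
    have hanti := antitoneOn_log_cos_add_sq ⟨ha.1, hle.trans_lt hlt⟩ ⟨arccos_nonneg u, hlt⟩ hle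
    simp only [cos_arccos (neg_le_of_abs_le hu) (le_of_abs_le hu)] at hanti
    have hlog : log (cos a) + log p = log u + log q := by
      rw [← log_mul (hu0.trans_le hcos).ne' hp.ne', ← log_mul hu0.ne' hq.ne', h]
    linarith

theorem abs_mul_cos_lt_one {c : ℝ} (hc : c ∈ Ioo 0 1) (θ : ℝ) : |c * cos θ| < 1 := by
  rw [abs_mul, abs_of_pos hc.1]
  nlinarith [abs_cos_le_one θ, hc.1, hc.2]

theorem exists_mul_abs_le_phase {c η : ℝ} (hc : c ∈ Ioo 0 1) (θ : ℝ) (hη : 0 < η) :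
    ∃ ε : ℝ, 0 < ε ∧ ∀ (δ : ℂ) (y : ℝ), δ.re ∈ Icc 0 π → η ≤ |y| →
      Complex.cos δ = c * Complex.cos (line θ y) →
      ε * |y| ≤ y ^ 2 - δ.im ^ 2 + δ.re ^ 2 - arccos (c * cos θ) ^ 2 := by
  obtain ⟨ε, hε, hgap⟩ := exists_mul_abs_le_logCoshGap_sub hc hη
  refine ⟨ε, hε, fun δ y hδ hy h => ?_⟩
  have hgap_le := hgap δ.im y hy (by simpa only [line_im] using cosh_im_sub_one_le hc h)
  have hcosh : cosh δ.im ≤ cosh y := by simpa only [line_im] using cosh_im_le_cosh hc h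
  have hcos : cos δ.re * cosh δ.im = c * cos θ * cosh y := by
    simpa only [line_im, line_re] using cos_re_mul_cosh h
  have harccos := arccos_sq_le_of_cos_mul_eq (abs_mul_cos_lt_one hc θ).le hδ (cosh_pos _) hcosh hcos
  unfold logCoshGap at hgap_le
  linarith

/-! ### The dominant image -/

theorem abs_im_le_norm_cos_add_one (δ : ℂ) : |δ.im| ≤ ‖Complex.cos δ‖ + 1 := by
  have hadd := norm_add_le (Complex.cos δ) 1
  have hsub := norm_sub_le (Complex.cos δ) 1
  rw [norm_cos_add_one, norm_one] at hadd
  rw [norm_cos_sub_one, norm_one] at hsub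
  have hcosh : |δ.im| ≤ cosh δ.im := by
    rw [← cosh_abs]
    exact (self_le_sinh_iff.2 (abs_nonneg _)).trans (sinh_lt_cosh _).le
  linarith

theorem norm_eval_U_le_exp (m : ℕ) (u : ℂ) :
    ‖(U ℂ m).eval u‖ ≤ (m + 1) * exp (m * (‖u‖ + 1)) := by
  obtain ⟨δ, rfl⟩ := Complex.cos_surjective u
  refine (norm_eval_U_cos_le m δ).trans ?_
  gcongr
  exact abs_im_le_norm_cos_add_one δ

theorem continuous_ellipticKernel {t : ℝ} (ht : 0 < t) : Continuous (ellipticKernel t) := by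
  refine continuous_iff_continuousAt.2 fun u => ?_
  have hu : u ∈ Metric.ball (0 : ℂ) (‖u‖ + 1) := by simp
  refine ContinuousOn.continuousAt ?_ (Metric.isOpen_ball.mem_nhds hu)
  refine continuousOn_tsum (fun m => by fun_prop)
    ((summable_linear_mul_exp_neg_sq 1 1 (‖u‖ + 3) ht).comp_injective Nat.cast_injective)
    fun m w hw => ?_
  have hw' : ‖w‖ ≤ ‖u‖ + 1 := (mem_ball_zero_iff.1 hw).le
  have hm : (0 : ℝ) ≤ m := m.cast_nonneg
  rw [norm_mul, Complex.norm_of_nonneg (ellipticWeight_nonneg t m)]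
  simp only [Function.comp_apply, Int.cast_natCast, abs_of_nonneg hm, one_mul]
  calc ellipticWeight t m * ‖(U ℂ m).eval w‖
      ≤ (m + 1) * exp (-(m * (m + 2)) * t) * (exp m * exp (m * (‖u‖ + 2))) := by
        rw [ellipticWeight]
        gcongr
        refine (norm_eval_U_le_exp m w).trans ?_
        gcongr ?_ * exp (_ * ?_)
        · exact add_one_le_exp _
        · linarith
    _ = (m + 1) * exp (-(m * (m + 2)) * t + (m + m * (‖u‖ + 2))) := by
        rw [exp_add, exp_add]
        ring
    _ ≤ (m + 1) * exp (-(t * (m : ℝ) ^ 2 - (‖u‖ + 3) * m)) := by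
        gcongr
        nlinarith [mul_nonneg hm ht.le]

theorem oddGauss_neg (t : ℝ) (s : ℂ) : oddGauss t (-s) = -oddGauss t s := by
  rw [oddGauss, oddGauss, neg_sq, neg_mul]

theorem norm_exp_neg_sq_div (s : ℂ) (t : ℝ) :
    ‖Complex.exp (-s ^ 2 / (4 * t))‖ = exp (-(s.re ^ 2 - s.im ^ 2) / (4 * t)) := by
  rw [Complex.norm_exp, show (-s ^ 2 / (4 * t) : ℂ) = -s ^ 2 / ((4 * t : ℝ) : ℂ) by push_cast; rfl,
    Complex.div_ofReal_re, Complex.neg_re, sq, Complex.mul_re, ← sq, ← sq]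

theorem hasDerivAt_oddGauss {t : ℝ} (ht : 0 < t) (s : ℂ) :
    HasDerivAt (oddGauss t) ((1 - s ^ 2 / (2 * t)) * Complex.exp (-s ^ 2 / (4 * t))) s := by
  have ht' : (t : ℂ) ≠ 0 := mod_cast ht.ne'
  refine ((hasDerivAt_id s).fun_mul
    (((hasDerivAt_pow 2 s).fun_neg.div_const (4 * t : ℂ)).cexp)).congr_deriv ?_
  simp only [id]
  field_simp
  push_cast
  ring

theorem norm_oddGauss_deriv_le {t a v : ℝ} {s : ℂ} (ht : 0 < t) (ha : |s.re| ≤ a) (hv : |v| ≤ 1) :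
    ‖(1 - (a + v * s) ^ 2 / (2 * t)) * Complex.exp (-(a + v * s) ^ 2 / (4 * t))‖ ≤
      (1 + (a + ‖s‖) ^ 2 / (2 * t)) * exp (-((a - |s.re|) ^ 2 - s.im ^ 2) / (4 * t)) := by
  have ha0 : 0 ≤ a := (abs_nonneg _).trans ha
  have hnorm : ‖(a + v * s : ℂ)‖ ≤ a + ‖s‖ := by
    refine (norm_add_le _ _).trans ?_
    rw [norm_mul, Complex.norm_of_nonneg ha0, Complex.norm_real, Real.norm_eq_abs]
    nlinarith [norm_nonneg s]
  have hfactor : ‖1 - (a + v * s : ℂ) ^ 2 / (2 * t)‖ ≤ 1 + (a + ‖s‖) ^ 2 / (2 * t) := by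
    refine (norm_sub_le _ _).trans ?_
    rw [norm_one, norm_div, norm_pow, norm_mul, Complex.norm_of_nonneg ht.le, Complex.norm_ofNat]
    gcongr
  have hre : a - |s.re| ≤ a + v * s.re := by
    have habs : |v * s.re| ≤ |s.re| := by
      rw [abs_mul]
      exact mul_le_of_le_one_left (abs_nonneg _) hv
    linarith [neg_abs_le (v * s.re)]
  have hre_sq : (a - |s.re|) ^ 2 ≤ (a + v * s.re) ^ 2 := pow_le_pow_left₀ (by linarith) hre 2
  have him_sq : (v * s.im) ^ 2 ≤ s.im ^ 2 := by
    rw [mul_pow]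
    exact mul_le_of_le_one_left (sq_nonneg _) ((sq_le_one_iff_abs_le_one v).2 hv)
  rw [norm_mul, norm_exp_neg_sq_div, show (a + v * s : ℂ).re = a + v * s.re by simp,
    show (a + v * s : ℂ).im = v * s.im by simp]
  gcongr

theorem norm_oddGauss_sub_le {t a : ℝ} {s : ℂ} (ht : 0 < t) (ha : |s.re| ≤ a) :
    ‖oddGauss t (a + s) - oddGauss t (a - s)‖ ≤ 2 * ‖s‖ * ((1 + (a + ‖s‖) ^ 2 / (2 * t)) *
      exp (-((a - |s.re|) ^ 2 - s.im ^ 2) / (4 * t))) := by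
  have hderiv (v : ℝ) : HasDerivAt (fun v : ℝ => oddGauss t (a + v * s))
      ((1 - (a + v * s) ^ 2 / (2 * t)) * Complex.exp (-(a + v * s) ^ 2 / (4 * t)) * s) v := by
    have hline : HasDerivAt (fun v : ℝ => (a + v * s : ℂ)) s v := by
      simpa using ((Complex.ofRealCLM.hasDerivAt (x := v)).mul_const s).const_add (a : ℂ)
    exact (hasDerivAt_oddGauss ht _).comp v hline
  have hmean := norm_image_sub_le_of_norm_deriv_le_segment'
    (fun v _ => (hderiv v).hasDerivWithinAt)
    (fun v (hv : v ∈ Ico (-1 : ℝ) 1) => (norm_mul_le _ _).trans (mul_le_mul_of_nonneg_right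
      (norm_oddGauss_deriv_le ht ha (abs_le.2 ⟨hv.1, hv.2.le⟩)) (norm_nonneg s)))
    1 ⟨by norm_num, le_rfl⟩
  push_cast at hmean
  rw [one_mul, neg_one_mul, ← sub_eq_add_neg] at hmean
  exact hmean.trans_eq (by ring)

theorem norm_sin_sq (s : ℂ) : ‖Complex.sin s‖ ^ 2 = sin s.re ^ 2 + sinh s.im ^ 2 := by
  have h := norm_cos_sub_one (2 * s)
  rw [show Complex.cos (2 * s) - 1 = -2 * Complex.sin s ^ 2 by
      rw [Complex.cos_two_mul, Complex.cos_sq']; ring,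
    norm_mul, norm_pow, norm_neg, Complex.norm_ofNat, show (2 * s).im = 2 * s.im by simp,
    show (2 * s).re = 2 * s.re by simp, cosh_two_mul, cos_two_mul, cosh_sq, cos_sq'] at h
  linarith

theorem norm_le_norm_sin {s : ℂ} (h : |s.re| ≤ π / 2) : ‖s‖ ≤ π / 2 * ‖Complex.sin s‖ := by
  have hsin : |s.re| ≤ π / 2 * |sin s.re| := by
    have := mul_le_mul_of_nonneg_left (mul_abs_le_abs_sin h) (by positivity : 0 ≤ π / 2)
    rwa [← mul_assoc, show π / 2 * (2 / π) = 1 by field_simp, one_mul] at this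
  have hsinh : |s.im| ≤ π / 2 * |sinh s.im| := by
    have : |s.im| ≤ |sinh s.im| := by
      rw [abs_sinh]
      exact self_le_sinh_iff.2 (abs_nonneg _)
    nlinarith [pi_gt_three, abs_nonneg (sinh s.im)]
  have hre := pow_le_pow_left₀ (abs_nonneg _) hsin 2
  have him := pow_le_pow_left₀ (abs_nonneg _) hsinh 2
  rw [mul_pow, sq_abs, sq_abs] at hre him
  refine le_of_sq_le_sq ?_ (by positivity)
  rw [mul_pow, norm_sin_sq, ← Complex.normSq_eq_norm_sq, Complex.normSq_apply]
  linarith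

/-- The Gaussian size of the image nearest to `0`, with a polynomial factor that absorbs the
derivatives of `oddGauss`. -/
def gaussMajorant (t : ℝ) (δ : ℂ) : ℝ :=
  (1 + |δ.im|) ^ 2 / t * exp (-(δ.re ^ 2 - δ.im ^ 2) / (4 * t))

theorem gaussMajorant_nonneg {t : ℝ} (ht : 0 < t) (δ : ℂ) : 0 ≤ gaussMajorant t δ := by
  rw [gaussMajorant]
  positivity

theorem one_le_one_add_abs_sq_div {t : ℝ} (ht : 0 < t) (ht1 : t ≤ 1) (y : ℝ) :
    1 ≤ (1 + |y|) ^ 2 / t := by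
  rw [le_div_iff₀ ht, one_mul]
  exact ht1.trans (one_le_pow₀ (by linarith [abs_nonneg y]))

theorem norm_oddGauss_le {t : ℝ} (ht : 0 < t) (ht1 : t ≤ 1) (δ : ℂ) :
    ‖oddGauss t δ‖ ≤ ‖δ‖ * gaussMajorant t δ := by
  rw [oddGauss, norm_mul, norm_exp_neg_sq_div, gaussMajorant]
  gcongr
  exact le_mul_of_one_le_left (exp_pos _).le (one_le_one_add_abs_sq_div ht ht1 _)

/-- The weight of the `n`-th pair of images relative to `gaussMajorant`. -/
def imageWeight (n : ℕ) : ℝ := 2 * (1 + (2 * π) ^ 2 * (n + 1) ^ 2) * exp (-n)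

theorem imageWeight_nonneg (n : ℕ) : 0 ≤ imageWeight n := by
  rw [imageWeight]
  positivity

theorem two_le_imageWeight_zero : 2 ≤ imageWeight 0 := by
  simp only [imageWeight, CharP.cast_eq_zero, zero_add, one_pow, mul_one, neg_zero, exp_zero]
  nlinarith [sq_nonneg (2 * π)]

theorem summable_imageWeight : Summable imageWeight := by
  have hpow (k : ℕ) : Summable fun n : ℕ => (n : ℝ) ^ k * exp (-n) := by
    simpa using Real.summable_pow_mul_exp_neg_nat_mul k one_pos
  refine (((hpow 0).mul_left (2 * (1 + (2 * π) ^ 2))).add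
    (((hpow 1).mul_left (4 * (2 * π) ^ 2)).add
      ((hpow 2).mul_left (2 * (2 * π) ^ 2)))).congr fun n => ?_
  rw [imageWeight]
  ring

theorem exp_neg_sq_sub_sq_div_le {t p q r : ℝ} {n : ℕ} (ht : 0 < t) (ht1 : t ≤ 1)
    (h : p ^ 2 + 4 * n ≤ q ^ 2) :
    exp (-(q ^ 2 - r ^ 2) / (4 * t)) ≤ exp (-(p ^ 2 - r ^ 2) / (4 * t)) * exp (-n) := by
  rw [← exp_add, exp_le_exp, div_le_iff₀ (by positivity), add_mul,
    div_mul_cancel₀ _ (by positivity)]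
  nlinarith [mul_nonneg n.cast_nonneg (sub_nonneg.2 ht1)]

theorem norm_image_pair_le {t a : ℝ} {δ s : ℂ} {n : ℕ} (ht : 0 < t) (ht1 : t ≤ 1)
    (hs : s.im = δ.im) (hsa : |s.re| ≤ a) (hs_re : |s.re| ≤ π / 2) (ha : a ≤ (2 * n + 1) * π)
    (hα : δ.re ^ 2 + 4 * n ≤ (a - |s.re|) ^ 2) :
    ‖oddGauss t (a + s) - oddGauss t (a - s)‖ ≤ ‖s‖ * gaussMajorant t δ * imageWeight n := by
  have ha0 : 0 ≤ a := (abs_nonneg _).trans hsa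
  have : (0 : ℝ) ≤ n := n.cast_nonneg
  have hsize : a + ‖s‖ ≤ 2 * π * (n + 1) * (1 + |δ.im|) := by
    have hnorm := Complex.norm_le_abs_re_add_abs_im s
    rw [hs] at hnorm
    have him : |δ.im| ≤ 2 * π * (n + 1) * |δ.im| :=
      le_mul_of_one_le_left (abs_nonneg _) (by nlinarith [pi_gt_three])
    nlinarith [pi_pos]
  have hpoly : 1 + (a + ‖s‖) ^ 2 / (2 * t) ≤
      (1 + |δ.im|) ^ 2 / t * (1 + (2 * π) ^ 2 * (n + 1) ^ 2) := by
    have hdiv : (a + ‖s‖) ^ 2 / (2 * t) ≤ (2 * π * (n + 1) * (1 + |δ.im|)) ^ 2 / t := by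
      gcongr
      linarith
    exact (add_le_add (one_le_one_add_abs_sq_div ht ht1 δ.im) hdiv).trans_eq (by ring)
  have hexp := exp_neg_sq_sub_sq_div_le (r := s.im) ht ht1 hα
  calc ‖oddGauss t (a + s) - oddGauss t (a - s)‖
      ≤ 2 * ‖s‖ * (((1 + |δ.im|) ^ 2 / t * (1 + (2 * π) ^ 2 * (n + 1) ^ 2)) *
        (exp (-(δ.re ^ 2 - s.im ^ 2) / (4 * t)) * exp (-n))) := by
        refine (norm_oddGauss_sub_le ht hsa).trans ?_
        gcongr
    _ = ‖s‖ * gaussMajorant t δ * imageWeight n := by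
        rw [hs, gaussMajorant, imageWeight]
        ring

theorem norm_image_sum_le_of_re_le {t : ℝ} {δ S : ℂ} (ht : 0 < t) (ht1 : t ≤ 1)
    (hδ : δ.re ∈ Icc 0 (π / 2)) (hS : HasSum (fun k : ℤ => oddGauss t (δ + 2 * k * π)) S) :
    ‖S‖ ≤ ‖δ‖ * gaussMajorant t δ * (∑' n, imageWeight n + 1) := by
  have habs : |δ.re| = δ.re := abs_of_nonneg hδ.1
  have hpair (n : ℕ) :
      ‖oddGauss t (δ + 2 * (n : ℤ) * π) + oddGauss t (δ + 2 * (-(n : ℤ) : ℤ) * π)‖ ≤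
        ‖δ‖ * gaussMajorant t δ * imageWeight n := by
    have heq : oddGauss t (δ + 2 * (n : ℤ) * π) + oddGauss t (δ + 2 * (-(n : ℤ) : ℤ) * π) =
        oddGauss t ((2 * n * π : ℝ) + δ) - oddGauss t ((2 * n * π : ℝ) - δ) := by
      rw [← neg_sub δ, oddGauss_neg]
      push_cast
      ring_nf
    rw [heq]
    rcases Nat.eq_zero_or_pos n with rfl | hn
    · simp only [Nat.cast_zero, mul_zero, zero_mul, Complex.ofReal_zero, zero_add, zero_sub,
        oddGauss_neg, sub_neg_eq_add, ← two_mul]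
      rw [norm_mul, Complex.norm_ofNat, mul_comm]
      exact mul_le_mul (norm_oddGauss_le ht ht1 δ) two_le_imageWeight_zero zero_le_two
        (mul_nonneg (norm_nonneg _) (gaussMajorant_nonneg ht δ))
    · have hn1 : (1 : ℝ) ≤ n := mod_cast hn
      have hgap : π / 2 ≤ n * π - δ.re := by nlinarith [pi_pos, hδ.2]
      refine norm_image_pair_le ht ht1 rfl ?_ (habs.trans_le hδ.2) (by nlinarith [pi_pos]) ?_ <;>
        rw [habs]
      · nlinarith [pi_pos]
      · have hone : 1 ≤ π * (n * π - δ.re) := by nlinarith [pi_gt_three]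
        nlinarith
  have hsum := hS.nat_add_neg.norm_le_of_bounded (summable_imageWeight.hasSum.mul_left _) hpair
  have hzero : ‖oddGauss t (δ + 2 * (0 : ℤ) * π)‖ ≤ ‖δ‖ * gaussMajorant t δ := by
    simpa using norm_oddGauss_le ht ht1 δ
  have htriangle := norm_sub_le (S + oddGauss t (δ + 2 * (0 : ℤ) * π))
    (oddGauss t (δ + 2 * (0 : ℤ) * π))
  rw [add_sub_cancel_right] at htriangle
  linarith

theorem norm_image_sum_le_of_le_re {t : ℝ} {δ S : ℂ} (ht : 0 < t) (ht1 : t ≤ 1)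
    (hδ : δ.re ∈ Icc (π / 2) π) (hS : HasSum (fun k : ℤ => oddGauss t (δ + 2 * k * π)) S) :
    ‖S‖ ≤ ‖δ - π‖ * gaussMajorant t δ * ∑' n, imageWeight n := by
  have him : (δ - π).im = δ.im := by simp
  have hre : |(δ - π).re| = π - δ.re := by
    rw [Complex.sub_re, Complex.ofReal_re, abs_of_nonpos (by linarith [hδ.2]), neg_sub]
  refine hS.nat_add_neg_add_one.norm_le_of_bounded (summable_imageWeight.hasSum.mul_left _)
    fun n => ?_
  have heq : oddGauss t (δ + 2 * (n : ℤ) * π) + oddGauss t (δ + 2 * (-((n : ℤ) + 1) : ℤ) * π) =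
      oddGauss t (((2 * n + 1) * π : ℝ) + (δ - π)) -
        oddGauss t (((2 * n + 1) * π : ℝ) - (δ - π)) := by
    rw [← neg_sub (δ - π), oddGauss_neg]
    push_cast
    ring_nf
  have : (0 : ℝ) ≤ n := n.cast_nonneg
  rw [heq]
  refine norm_image_pair_le ht ht1 him ?_ (by linarith [hδ.1]) le_rfl ?_ <;> rw [hre]
  · nlinarith [pi_pos, hδ.1]
  · have hgap : π / 2 ≤ n * π + δ.re := by nlinarith [pi_pos, hδ.1]
    have hone : 1 ≤ π * (n * π + δ.re) := by nlinarith [pi_gt_three]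
    nlinarith

theorem exists_norm_ellipticKernel_le_of_sin_ne_zero : ∃ C : ℝ, 0 < C ∧ ∀ (t : ℝ) (δ : ℂ),
    0 < t → t ≤ 1 → δ.re ∈ Icc 0 π → Complex.sin δ ≠ 0 →
      ‖ellipticKernel t (Complex.cos δ)‖ * poissonFactor t ≤ C * gaussMajorant t δ := by
  have hweight : 0 ≤ ∑' n, imageWeight n := tsum_nonneg imageWeight_nonneg
  refine ⟨π / 2 * (∑' n, imageWeight n + 1), by positivity, fun t δ ht ht1 hδ hsin => ?_⟩
  have hmajorant := gaussMajorant_nonneg ht δ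
  have hS := hasSum_oddGauss δ ht
  have key : ‖Complex.sin δ * ellipticKernel t (Complex.cos δ) * poissonFactor t‖ ≤
      (π / 2 * ‖Complex.sin δ‖) * gaussMajorant t δ * (∑' n, imageWeight n + 1) := by
    rcases le_total δ.re (π / 2) with h | h
    · refine (norm_image_sum_le_of_re_le ht ht1 ⟨hδ.1, h⟩ hS).trans ?_
      gcongr
      exact norm_le_norm_sin (by rwa [abs_of_nonneg hδ.1])
    · refine (norm_image_sum_le_of_le_re ht ht1 ⟨h, hδ.2⟩ hS).trans ?_
      gcongr
      · rw [← norm_neg (Complex.sin δ), ← Complex.sin_sub_pi]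
        refine norm_le_norm_sin ?_
        rw [Complex.sub_re, Complex.ofReal_re, abs_of_nonpos] <;> linarith [hδ.2]
      · linarith
  rw [mul_assoc, norm_mul, norm_mul, Complex.norm_of_nonneg (poissonFactor_pos ht).le] at key
  refine le_of_mul_le_mul_left (key.trans_eq ?_) (norm_pos_iff.2 hsin)
  ring

theorem exists_norm_ellipticKernel_le : ∃ C : ℝ, 0 < C ∧ ∀ (t : ℝ) (δ : ℂ),
    0 < t → t ≤ 1 → δ.re ∈ Icc 0 π →
      ‖ellipticKernel t (Complex.cos δ)‖ * poissonFactor t ≤ C * gaussMajorant t δ := by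
  obtain ⟨C, hC, hbound⟩ := exists_norm_ellipticKernel_le_of_sin_ne_zero
  refine ⟨C, hC, fun t δ ht ht1 hδ => ?_⟩
  rcases ne_or_eq (Complex.sin δ) 0 with hsin | hsin
  · exact hbound t δ ht ht1 hδ hsin
  obtain ⟨k, rfl⟩ := Complex.sin_eq_zero_iff.1 hsin
  -- The zeros of `sin` are real, so they are approached vertically inside the strip.
  have hcont_left : Continuous fun s : ℝ =>
      ‖ellipticKernel t (Complex.cos (k * π + s * Complex.I))‖ * poissonFactor t :=
    ((continuous_ellipticKernel ht).comp (by fun_prop)).norm.mul_const _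
  have hcont_right : Continuous fun s : ℝ => C * gaussMajorant t (k * π + s * Complex.I) := by
    unfold gaussMajorant
    fun_prop
  have hclosed := isClosed_le hcont_left hcont_right
  have hmem : (0 : ℝ) ∈ closure {s : ℝ | s ≠ 0} := dense_compl_singleton (0 : ℝ) 0
  have hsubset := hclosed.closure_subset_iff.2 fun s (hs : s ≠ 0) =>
    hbound t (k * π + s * Complex.I) ht ht1 (by simpa using hδ) fun hzero => by
      obtain ⟨l, hl⟩ := Complex.sin_eq_zero_iff.1 hzero
      exact hs (by simpa using congrArg Complex.im hl)
  simpa using hsubset hmem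

/-- The elliptic kernel at `cos δ`, multiplied by `sin δ` and freed from its Gaussian factor
`exp (-δ ^ 2 / (4 * t))`. -/
def normalizedKernel (t : ℝ) (δ : ℂ) : ℂ :=
  Complex.exp (δ ^ 2 / (4 * t)) *
    (Complex.sin δ * ellipticKernel t (Complex.cos δ) * poissonFactor t)

theorem exp_mul_oddGauss {t : ℝ} (ht : 0 < t) (δ : ℂ) (k : ℤ) :
    Complex.exp (δ ^ 2 / (4 * t)) * oddGauss t (δ + 2 * k * π) =
      (δ + 2 * k * π) * Complex.exp ((-(k * π / t) : ℝ) * (δ + k * π)) := by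
  have ht' : (t : ℂ) ≠ 0 := mod_cast ht.ne'
  rw [oddGauss, mul_left_comm, ← Complex.exp_add]
  congr 2
  push_cast
  field_simp
  ring

theorem image_exponent_le {t α x : ℝ} {k : ℤ} (ht : 0 < t) (ht1 : t ≤ 1) (hα : α < π)
    (hx : |x| ≤ α) (hk : k ≠ 0) :
    -(k * π / t) * (x + k * π) ≤
      -(π * (π - α) / 2 / t) - π * (π - α) / 2 * (k : ℝ) ^ 2 := by
  have hk1 : 1 ≤ |(k : ℝ)| := mod_cast Int.one_le_abs hk
  have hk_sq : 1 ≤ (k : ℝ) ^ 2 := (one_le_sq_iff_one_le_abs _).2 hk1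
  have hkx : -(k * x) ≤ (k : ℝ) ^ 2 * α := by
    refine (neg_le_abs _).trans ?_
    rw [abs_mul, ← sq_abs (k : ℝ), sq, mul_assoc]
    have hα0 : 0 ≤ α := (abs_nonneg _).trans hx
    nlinarith [mul_nonneg (abs_nonneg (k : ℝ)) hα0]
  have hA : 0 ≤ π * (π - α) / 2 := by
    have : 0 ≤ π - α := by linarith
    positivity
  have hquad : 2 * (π * (π - α) / 2) * (k : ℝ) ^ 2 ≤ k * π * (x + k * π) := by
    nlinarith [mul_le_mul_of_nonneg_left hkx pi_pos.le]
  rw [show -(k * π / t) * (x + k * π) = -(k * π * (x + k * π)) / t by ring, div_le_iff₀ ht,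
    sub_mul, neg_mul, div_mul_cancel₀ _ ht.ne']
  generalize π * (π - α) / 2 = A at *
  have htk : A * (k : ℝ) ^ 2 * t ≤ A * (k : ℝ) ^ 2 := mul_le_of_le_one_right (by positivity) ht1
  have hAk : A ≤ A * (k : ℝ) ^ 2 := le_mul_of_one_le_right hA hk_sq
  linarith

theorem norm_exp_mul_oddGauss_sub_le {t α R : ℝ} {δ : ℂ} (ht : 0 < t) (ht1 : t ≤ 1) (hα : α < π)
    (hδ : |δ.re| ≤ α) (hR : ‖δ‖ ≤ R) (k : ℤ) :
    ‖Complex.exp (δ ^ 2 / (4 * t)) * oddGauss t (δ + 2 * k * π) - (if k = 0 then δ else 0)‖ ≤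
      exp (-(π * (π - α) / 2 / t)) * ((2 * π * |(k : ℝ)| + R) *
        exp (-(π * (π - α) / 2 * (k : ℝ) ^ 2 - 0 * |(k : ℝ)|))) := by
  have hR0 : 0 ≤ R := (norm_nonneg _).trans hR
  rw [exp_mul_oddGauss ht]
  split_ifs with hk
  · subst hk
    simp only [Int.cast_zero, mul_zero, zero_mul, add_zero, zero_div, neg_zero,
      Complex.ofReal_zero, Complex.exp_zero, mul_one, sub_self, norm_zero]
    positivity
  · have hnorm : ‖δ + 2 * k * π‖ ≤ 2 * π * |(k : ℝ)| + R := by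
      refine (norm_add_le _ _).trans ?_
      rw [show (2 * (k : ℂ) * π) = ((2 * k * π : ℝ) : ℂ) by push_cast; rfl, Complex.norm_real,
        Real.norm_eq_abs, abs_mul, abs_mul, abs_two, abs_of_pos pi_pos]
      linarith
    have hre : (δ + k * π).re = δ.re + k * π := by simp
    have hexp := exp_le_exp.2 (image_exponent_le ht ht1 hα hδ hk)
    rw [sub_zero, norm_mul, Complex.norm_exp, Complex.re_ofReal_mul, hre, mul_left_comm,
      ← exp_add, zero_mul, sub_zero, ← sub_eq_add_neg]
    gcongr

theorem exists_norm_normalizedKernel_sub_le {α : ℝ} (hα : α < π) (R : ℝ) :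
    ∃ C b : ℝ, 0 < C ∧ 0 < b ∧ ∀ (t : ℝ) (δ : ℂ), 0 < t → t ≤ 1 → |δ.re| ≤ α → ‖δ‖ ≤ R →
      ‖normalizedKernel t δ - δ‖ ≤ C * exp (-(b / t)) := by
  have hA : 0 < π * (π - α) / 2 := by
    have : 0 < π - α := by linarith
    positivity
  obtain ⟨W, hW⟩ := summable_linear_mul_exp_neg_sq (2 * π) R 0 hA
  refine ⟨|W| + 1, _, by positivity, hA, fun t δ ht ht1 hδ hR => ?_⟩
  have hsum := ((hasSum_oddGauss δ ht).mul_left (Complex.exp (δ ^ 2 / (4 * t)))).sub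
    (hasSum_ite_eq (0 : ℤ) δ)
  refine (hsum.norm_le_of_bounded (hW.mul_left _)
    (norm_exp_mul_oddGauss_sub_le ht ht1 hα hδ hR)).trans ?_
  rw [mul_comm]
  gcongr
  linarith [le_abs_self W]

/-! ### The phase near a critical point -/

theorem exists_local_inverse_cos {a : ℂ} (ha : Complex.sin a ≠ 0) :
    ∃ A : ℂ → ℂ, A (Complex.cos a) = a ∧ ∀ᶠ u in 𝓝 (Complex.cos a),
      Complex.cos (A u) = u ∧ HasDerivAt A (-Complex.sin (A u))⁻¹ u := by
  have hequiv := (Complex.hasStrictDerivAt_cos a).hasStrictFDerivAt_equiv (neg_ne_zero.2 ha)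
  set e := hequiv.toOpenPartialHomeomorph Complex.cos
  have hsource : a ∈ e.source := hequiv.mem_toOpenPartialHomeomorph_source
  have htarget : Complex.cos a ∈ e.target := e.map_source hsource
  have hvalue : e.symm (Complex.cos a) = a := e.left_inv hsource
  have hsin : ContinuousAt (fun u => -Complex.sin (e.symm u)) (Complex.cos a) :=
    (Complex.continuous_sin.continuousAt.comp (e.symm.continuousAt htarget)).neg
  refine ⟨e.symm, hvalue, ?_⟩
  filter_upwards [e.open_target.mem_nhds htarget,
    hsin.eventually_ne (by rw [hvalue]; exact neg_ne_zero.2 ha)] with u hu hu_sin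
  exact ⟨e.right_inv hu, e.hasDerivAt_symm hu hu_sin (Complex.hasDerivAt_cos _)⟩

theorem exists_branch {c θ a : ℝ} (ha : sin a ≠ 0) (h : cos a = c * cos θ) :
    ∃ D : ℂ → ℂ, D θ = a ∧ ∀ᶠ w in 𝓝 (θ : ℂ), Complex.cos (D w) = c * Complex.cos w ∧
      HasDerivAt D (c * Complex.sin w / Complex.sin (D w)) w := by
  have ha' : Complex.sin (a : ℂ) ≠ 0 := mod_cast ha
  have h' : Complex.cos (a : ℂ) = c * Complex.cos θ := mod_cast h
  obtain ⟨A, hA, hinv⟩ := exists_local_inverse_cos ha'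
  have hcont : ContinuousAt (fun w : ℂ => (c : ℂ) * Complex.cos w) θ := by fun_prop
  refine ⟨fun w => A (c * Complex.cos w), by simp only [← h', hA], ?_⟩
  rw [h'] at hinv
  filter_upwards [hcont.eventually hinv] with w ⟨hcos, hderiv⟩
  refine ⟨hcos, (hderiv.comp w ((Complex.hasDerivAt_cos w).const_mul (c : ℂ))).congr_deriv ?_⟩
  rw [inv_neg, div_eq_mul_inv]
  ring

theorem isLittleO_sq_of_hasDerivAt {F F' : ℂ → ℂ} {x m : ℂ}
    (hF : ∀ᶠ w in 𝓝 x, HasDerivAt F (F' w) w) (hzero : F' x = 0) (hF' : HasDerivAt F' m x) :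
    (fun w => F w - F x - m * (w - x) ^ 2 / 2) =o[𝓝 x] fun w => (w - x) ^ 2 := by
  rw [isLittleO_iff]
  intro ε hε
  obtain ⟨ρ, hρ, hball⟩ := Metric.eventually_nhds_iff_ball.1 (hF.and (hF'.isLittleO.def hε))
  refine Metric.eventually_nhds_iff_ball.2 ⟨ρ, hρ, fun w hw => ?_⟩
  set s := Metric.closedBall x ‖w - x‖
  have hsubset : s ⊆ Metric.ball x ρ :=
    Metric.closedBall_subset_ball (by rwa [← dist_eq_norm])
  have hderiv : ∀ v ∈ s, HasDerivWithinAt (fun w => F w - F x - m * (w - x) ^ 2 / 2)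
      (F' v - m * (v - x)) s v := fun v hv => by
    have hsq : HasDerivAt (fun w => m * (w - x) ^ 2 / 2) (m * (v - x)) v := by
      refine (((((hasDerivAt_id v).sub_const x).fun_pow 2).const_mul m).div_const 2).congr_deriv ?_
      simp only [id]
      push_cast
      ring
    exact (((hball v (hsubset hv)).1.sub_const _).fun_sub hsq).hasDerivWithinAt
  have hbound : ∀ v ∈ s, ‖F' v - m * (v - x)‖ ≤ ε * ‖w - x‖ := fun v hv => by
    have hle := (hball v (hsubset hv)).2
    rw [hzero, sub_zero, smul_eq_mul, mul_comm (v - x)] at hle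
    exact hle.trans (mul_le_mul_of_nonneg_left (mem_closedBall_iff_norm.1 hv) hε.le)
  have hmean := (convex_closedBall x ‖w - x‖).norm_image_sub_le_of_norm_hasDerivWithin_le hderiv
    hbound (Metric.mem_closedBall_self (norm_nonneg _)) (mem_closedBall_iff_norm.2 le_rfl)
  rw [norm_pow, sq ‖w - x‖, ← mul_assoc]
  simpa using hmean

/-- The second derivative at a critical angle `θ` of half the phase
`θ ↦ (θ - z) ^ 2 - arccos (c * cos θ) ^ 2`, written in terms of `c` and `a = arccos (c * cos θ)`. -/
def phaseCurvature (c a : ℝ) : ℝ := (1 - cos a * a / sin a) * (1 - c ^ 2) / sin a ^ 2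

theorem sq_mul_sin_sq {c θ a : ℝ} (h : cos a = c * cos θ) :
    c ^ 2 * sin θ ^ 2 = c ^ 2 - cos a ^ 2 := by
  rw [h]
  linear_combination c ^ 2 * sin_sq_add_cos_sq θ

theorem hasDerivAt_phase_deriv {c θ a : ℝ} (z : ℂ) (ha : sin a ≠ 0) (h : cos a = c * cos θ)
    {D : ℂ → ℂ} (hDθ : D θ = a) (hD : HasDerivAt D (c * Complex.sin θ / Complex.sin (D θ)) θ) :
    HasDerivAt (fun w => 2 * (D w * (c * Complex.sin w / Complex.sin (D w)) - (w - z)))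
      (-(2 * phaseCurvature c a)) (θ : ℂ) := by
  have ha' : Complex.sin (a : ℂ) ≠ 0 := mod_cast ha
  have h' : (c : ℂ) * Complex.cos θ = Complex.cos a := mod_cast h.symm
  have hsin : (c : ℂ) ^ 2 * Complex.sin θ ^ 2 = c ^ 2 - Complex.cos a ^ 2 :=
    mod_cast sq_mul_sin_sq h
  have hderiv := ((hD.fun_mul (((Complex.hasDerivAt_sin (θ : ℂ)).const_mul (c : ℂ)).fun_div
    hD.csin (by rwa [hDθ]))).fun_sub ((hasDerivAt_id (θ : ℂ)).sub_const z)).const_mul (2 : ℂ)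
  refine hderiv.congr_deriv ?_
  simp only [hDθ, phaseCurvature]
  push_cast
  rw [h']
  field_simp
  linear_combination (Complex.sin a - a * Complex.cos a) *
    (hsin - Complex.sin_sq_add_cos_sq (a : ℂ))

/-- The error of the second order expansion at `w = θ` of the phase `δ ^ 2 - (w - z) ^ 2`, where
`cos δ = c * cos w` and `δ = a` at `w = θ`. -/
def phaseRemainder (c θ z a : ℝ) (δ w : ℂ) : ℂ :=
  δ ^ 2 - (w - z) ^ 2 - (a ^ 2 - (θ - z) ^ 2) + phaseCurvature c a * (w - θ) ^ 2

theorem phaseRemainder_isLittleO {c θ z a : ℝ} (ha : sin a ≠ 0) (h : cos a = c * cos θ)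
    (hcrit : θ - z = c * sin θ * (a / sin a)) {D : ℂ → ℂ} (hDθ : D θ = a)
    (hD : ∀ᶠ w in 𝓝 (θ : ℂ), HasDerivAt D (c * Complex.sin w / Complex.sin (D w)) w) :
    (fun w => phaseRemainder c θ z a (D w) w) =o[𝓝 (θ : ℂ)] fun w => (w - θ) ^ 2 := by
  have hphase : ∀ᶠ w in 𝓝 (θ : ℂ), HasDerivAt (fun w => D w ^ 2 - (w - z) ^ 2)
      (2 * (D w * (c * Complex.sin w / Complex.sin (D w)) - (w - z))) w := by
    filter_upwards [hD] with w hw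
    refine ((hw.fun_pow 2).fun_sub
      (((hasDerivAt_id w).sub_const (z : ℂ)).fun_pow 2)).congr_deriv ?_
    simp only [id]
    push_cast
    ring
  have hzero : (2 * (D θ * (c * Complex.sin θ / Complex.sin (D θ)) - (θ - z)) : ℂ) = 0 := by
    have hcrit' : ((θ : ℂ) - z) = c * Complex.sin θ * (a / Complex.sin a) := mod_cast hcrit
    rw [hDθ, hcrit']
    ring
  refine (isLittleO_sq_of_hasDerivAt hphase hzero
    (hasDerivAt_phase_deriv z ha h hDθ hD.self_of_nhds)).congr_left fun w => ?_
  rw [hDθ, phaseRemainder]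
  ring

theorem mul_cos_lt_sin {a : ℝ} (ha : a ∈ Ioo 0 π) : a * cos a < sin a := by
  have hsin := sin_pos_of_mem_Ioo ha
  rcases le_or_gt (cos a) 0 with hcos | hcos
  · nlinarith [ha.1]
  · have hlt : a < π / 2 := by
      by_contra! hle
      linarith [cos_nonpos_of_pi_div_two_le_of_le hle (by linarith [ha.2])]
    simpa only [tan_eq_sin_div_cos, lt_div_iff₀ hcos] using lt_tan ha.1 hlt

theorem one_sub_cos_mul_div_sin_pos {a : ℝ} (ha : a ∈ Ioo 0 π) : 0 < 1 - cos a * a / sin a := by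
  rw [sub_pos, div_lt_one (sin_pos_of_mem_Ioo ha), mul_comm]
  exact mul_cos_lt_sin ha

theorem phaseCurvature_pos {c a : ℝ} (hc : c ∈ Ioo 0 1) (ha : a ∈ Ioo 0 π) :
    0 < phaseCurvature c a := by
  have hsin := sin_pos_of_mem_Ioo ha
  have hfactor := one_sub_cos_mul_div_sin_pos ha
  have hc_sq : 0 < 1 - c ^ 2 := by nlinarith [hc.1, hc.2]
  unfold phaseCurvature
  positivity

/-! ### Laplace asymptotics -/

theorem norm_gaussWeight (t θ z y : ℝ) :
    ‖gaussWeight t θ z y‖ = exp (((θ - z) ^ 2 - y ^ 2) / (4 * t)) := by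
  have hcast : ((line θ y - z) ^ 2 / (4 * t) : ℂ) = (line θ y - z) ^ 2 / ((4 * t : ℝ) : ℂ) := by
    push_cast
    rfl
  rw [gaussWeight, Complex.norm_exp, hcast, Complex.div_ofReal_re, sq, Complex.mul_re,
    Complex.sub_re, Complex.sub_im, line_re, line_im, Complex.ofReal_re, Complex.ofReal_im]
  ring_nf

/-- The integrand of `IsHeatKernel.eq_integral` on the line of real part `θ`, in the variable
`x = y / √t` and divided by its exponential order of magnitude at `y = 0`, when
`cos a = c * cos θ`. -/
def laplaceIntegrand (c θ z a t x : ℝ) : ℂ :=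
  (poissonFactor t * exp ((a ^ 2 - (θ - z) ^ 2) / (4 * t)) : ℝ) *
    (gaussWeight t θ z (√t * x) * ellipticKernel t (c * Complex.cos (line θ (√t * x))))

theorem continuous_laplaceIntegrand (c θ z a : ℝ) {t : ℝ} (ht : 0 < t) :
    Continuous (laplaceIntegrand c θ z a t) := by
  have := continuous_line θ
  have := continuous_gaussWeight t θ z
  have := continuous_ellipticKernel ht
  unfold laplaceIntegrand
  fun_prop

theorem norm_laplaceIntegrand (c θ z a : ℝ) {t : ℝ} (ht : 0 < t) (x : ℝ) :
    ‖laplaceIntegrand c θ z a t x‖ = exp ((a ^ 2 - (√t * x) ^ 2) / (4 * t)) *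
      (‖ellipticKernel t (c * Complex.cos (line θ (√t * x)))‖ * poissonFactor t) := by
  have hexp : exp ((a ^ 2 - (√t * x) ^ 2) / (4 * t)) = exp ((a ^ 2 - (θ - z) ^ 2) / (4 * t)) *
      exp (((θ - z) ^ 2 - (√t * x) ^ 2) / (4 * t)) := by
    rw [← exp_add]
    ring_nf
  rw [laplaceIntegrand, norm_mul, norm_mul, norm_gaussWeight, hexp,
    Complex.norm_of_nonneg (mul_pos (poissonFactor_pos ht) (exp_pos _)).le]
  ring

theorem one_div_mul_exp_le {s t : ℝ} (hs : 0 < s) (ht : 0 < t) :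
    1 / t * exp (-(2 * s / t)) ≤ 1 / s * exp (-(s / t)) := by
  have hle : s / t ≤ exp (s / t) := by linarith [add_one_le_exp (s / t)]
  calc 1 / t * exp (-(2 * s / t)) = 1 / s * (s / t) * exp (-(2 * s / t)) := by field_simp
    _ ≤ 1 / s * exp (s / t) * exp (-(2 * s / t)) := by gcongr
    _ = 1 / s * exp (-(s / t)) := by
      rw [mul_assoc, ← exp_add]
      ring_nf

theorem norm_laplaceIntegrand_le {c θ z a t x C p : ℝ} {δ : ℂ} (ht : 0 < t)
    (hp : 0 < p) (hδ : Complex.cos δ = c * Complex.cos (line θ (√t * x)))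
    (hC : ‖ellipticKernel t (Complex.cos δ)‖ * poissonFactor t ≤ C * gaussMajorant t δ)
    (hC0 : 0 < C) (hphase : p ≤ (√t * x) ^ 2 - δ.im ^ 2 + δ.re ^ 2 - a ^ 2) :
    ‖laplaceIntegrand c θ z a t x‖ ≤ C * (1 + |δ.im|) ^ 2 * (8 / p * exp (-(p / (8 * t)))) := by
  calc ‖laplaceIntegrand c θ z a t x‖
      ≤ exp ((a ^ 2 - (√t * x) ^ 2) / (4 * t)) * (C * gaussMajorant t δ) := by
        rw [norm_laplaceIntegrand c θ z a ht, ← hδ]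
        gcongr
    _ = C * (1 + |δ.im|) ^ 2 *
        (1 / t * exp (-((√t * x) ^ 2 - δ.im ^ 2 + δ.re ^ 2 - a ^ 2) / (4 * t))) := by
        have hexp : exp (-((√t * x) ^ 2 - δ.im ^ 2 + δ.re ^ 2 - a ^ 2) / (4 * t)) =
            exp ((a ^ 2 - (√t * x) ^ 2) / (4 * t)) *
              exp (-(δ.re ^ 2 - δ.im ^ 2) / (4 * t)) := by
          rw [← exp_add]
          ring_nf
        rw [gaussMajorant, hexp]
        ring
    _ ≤ C * (1 + |δ.im|) ^ 2 * (1 / t * exp (-p / (4 * t))) := by gcongr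
    _ = C * (1 + |δ.im|) ^ 2 * (1 / t * exp (-(2 * (p / 8) / t))) := by ring_nf
    _ ≤ C * (1 + |δ.im|) ^ 2 * (1 / (p / 8) * exp (-(p / 8 / t))) := by
        gcongr _ * ?_
        exact one_div_mul_exp_le (by positivity) ht
    _ = _ := by rw [one_div_div, div_div]

theorem exists_norm_laplaceIntegrand_le_far {c η : ℝ} (θ z : ℝ) (hc : c ∈ Ioo 0 1) (hη : 0 < η) :
    ∃ C ε : ℝ, 0 < C ∧ 0 < ε ∧ ∀ t x : ℝ, 0 < t → t ≤ 1 → η ≤ |√t * x| →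
      ‖laplaceIntegrand c θ z (arccos (c * cos θ)) t x‖ ≤
        C * ((1 + |x|) ^ 2 * exp (-(ε * |x|))) := by
  obtain ⟨C, hC, hkernel⟩ := exists_norm_ellipticKernel_le
  obtain ⟨ε, hε, hphase⟩ := exists_mul_abs_le_phase hc θ hη
  refine ⟨C * (8 / (ε * η)), ε / 8, by positivity, by positivity, fun t x ht ht1 hx => ?_⟩
  obtain ⟨δ, hδ, hre⟩ := exists_cos_eq_re_mem_Icc (c * Complex.cos (line θ (√t * x)))
  have hy : 0 < |√t * x| := hη.trans_le hx
  have habs : |√t * x| = √t * |x| := by rw [abs_mul, abs_of_nonneg (Real.sqrt_nonneg t)]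
  have him : |δ.im| ≤ |x| := by
    have hle : |δ.im| ≤ |√t * x| := by
      simpa only [line_im, cosh_le_cosh] using cosh_im_le_cosh hc hδ
    exact hle.trans (habs.trans_le
      (mul_le_of_le_one_left (abs_nonneg x) (Real.sqrt_le_one.2 ht1)))
  have hexponent : ε / 8 * |x| ≤ ε * |√t * x| / (8 * t) := by
    rw [le_div_iff₀ (by positivity), habs]
    have ht_le : t ≤ √t := Real.le_sqrt_of_sq_le (by nlinarith)
    nlinarith [mul_le_mul_of_nonneg_left ht_le (mul_nonneg hε.le (abs_nonneg x))]
  calc _ ≤ C * (1 + |δ.im|) ^ 2 *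
        (8 / (ε * |√t * x|) * exp (-(ε * |√t * x| / (8 * t)))) :=
        norm_laplaceIntegrand_le ht (by positivity) hδ (hkernel t δ ht ht1 hre) hC
          (hphase δ _ hre hx hδ)
    _ ≤ C * (1 + |x|) ^ 2 * (8 / (ε * η) * exp (-(ε / 8 * |x|))) := by gcongr
    _ = _ := by ring

theorem laplaceIntegrand_eq {c θ z a t x : ℝ} {δ : ℂ} (ht : 0 < t) (hsin : Complex.sin δ ≠ 0)
    (hδ : Complex.cos δ = c * Complex.cos (line θ (√t * x))) :
    laplaceIntegrand c θ z a t x =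
      Complex.exp ((-(phaseCurvature c a / 4) * x ^ 2 : ℝ) -
        phaseRemainder c θ z a δ (line θ (√t * x)) / (4 * t)) *
          (normalizedKernel t δ / Complex.sin δ) := by
  have ht' : (t : ℂ) ≠ 0 := mod_cast ht.ne'
  have hsq : (line θ (√t * x) - θ) ^ 2 = -(t * x ^ 2 : ℂ) := by
    have hsqrt : ((√t : ℝ) : ℂ) ^ 2 = t := mod_cast Real.sq_sqrt ht.le
    rw [line, add_sub_cancel_left, mul_pow, Complex.I_sq]
    push_cast
    rw [mul_pow, hsqrt]
    ring
  have hexp : Complex.exp ((-(phaseCurvature c a / 4) * x ^ 2 : ℝ) -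
      phaseRemainder c θ z a δ (line θ (√t * x)) / (4 * t)) * Complex.exp (δ ^ 2 / (4 * t)) =
      gaussWeight t θ z (√t * x) * (exp ((a ^ 2 - (θ - z) ^ 2) / (4 * t)) : ℝ) := by
    rw [gaussWeight, Complex.ofReal_exp, ← Complex.exp_add, ← Complex.exp_add, phaseRemainder, hsq]
    push_cast
    congr 1
    field_simp
    ring
  rw [normalizedKernel, mul_div_assoc, ← mul_assoc, hexp, hδ, laplaceIntegrand]
  push_cast
  field_simp

theorem eventually_branch_bounds {a : ℝ} (ha : a ∈ Ioo 0 π) {D : ℂ → ℂ} {w₀ : ℂ}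
    (hD : ContinuousAt D w₀) (hDw₀ : D w₀ = a) : ∀ᶠ w in 𝓝 w₀,
      sin a / 2 ≤ ‖Complex.sin (D w)‖ ∧ |(D w).re| ≤ (a + π) / 2 ∧ ‖D w‖ ≤ a + 1 := by
  have hsin_pos := sin_pos_of_mem_Ioo ha
  have hsin : sin a / 2 < ‖Complex.sin (D w₀)‖ := by
    rw [hDw₀, ← Complex.ofReal_sin, Complex.norm_of_nonneg hsin_pos.le]
    linarith
  have hre : |(D w₀).re| < (a + π) / 2 := by
    rw [hDw₀, Complex.ofReal_re, abs_of_pos ha.1]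
    linarith [ha.2]
  have hnorm : ‖D w₀‖ < a + 1 := by
    rw [hDw₀, Complex.norm_of_nonneg ha.1.le]
    linarith
  filter_upwards [(Complex.continuous_sin.continuousAt.comp hD).norm.eventually_const_le hsin,
    (Complex.continuous_re.continuousAt.comp hD).abs.eventually_le_const hre,
    hD.norm.eventually_le_const hnorm] with w hw_sin hw_re hw_norm
  exact ⟨hw_sin, hw_re, hw_norm⟩

/-- `D` is a continuous solution of `cos (D w) = c * cos w` near `w = θ` with `D θ = a`, along
which the phase has a critical point at `θ`. -/
structure IsPhaseBranch (c θ z a : ℝ) (D : ℂ → ℂ) : Prop where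
  apply_eq : D θ = a
  continuousAt : ContinuousAt D θ
  cos_eq : ∀ᶠ w in 𝓝 (θ : ℂ), Complex.cos (D w) = c * Complex.cos w
  remainder_isLittleO :
    (fun w => phaseRemainder c θ z a (D w) w) =o[𝓝 (θ : ℂ)] fun w => (w - θ) ^ 2

theorem exists_isPhaseBranch {c θ z a : ℝ} (ha : sin a ≠ 0) (h : cos a = c * cos θ)
    (hcrit : θ - z = c * sin θ * (a / sin a)) : ∃ D, IsPhaseBranch c θ z a D := by
  obtain ⟨D, hDθ, hD⟩ := exists_branch ha h
  have hderiv := hD.mono fun w hw => hw.2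
  exact ⟨D, hDθ, hderiv.self_of_nhds.continuousAt, hD.mono fun w hw => hw.1,
    phaseRemainder_isLittleO ha h hcrit hDθ hderiv⟩

theorem norm_line_sub (θ y : ℝ) : ‖line θ y - θ‖ = |y| := by simp [line]

theorem norm_sq_line_sqrt_mul_sub {t : ℝ} (ht : 0 < t) (θ x : ℝ) :
    ‖(line θ (√t * x) - θ) ^ 2‖ = t * x ^ 2 := by
  rw [norm_pow, norm_line_sub, sq_abs, mul_pow, Real.sq_sqrt ht.le]

theorem exists_norm_laplaceIntegrand_le_near {c θ z a : ℝ} (hc : c ∈ Ioo 0 1) (ha : a ∈ Ioo 0 π)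
    {D : ℂ → ℂ} (hD : IsPhaseBranch c θ z a D) :
    ∃ C η : ℝ, 0 < C ∧ 0 < η ∧ ∀ t x : ℝ, 0 < t → t ≤ 1 → |√t * x| < η →
      ‖laplaceIntegrand c θ z a t x‖ ≤ C * exp (-(phaseCurvature c a / 8) * x ^ 2) := by
  have hsin_pos := sin_pos_of_mem_Ioo ha
  have hκ := phaseCurvature_pos hc ha
  obtain ⟨C, b, hC, hb, hkernel⟩ :=
    exists_norm_normalizedKernel_sub_le (show (a + π) / 2 < π by linarith [ha.2]) (a + 1)
  obtain ⟨η, hη, hball⟩ := Metric.eventually_nhds_iff_ball.1 (hD.cos_eq.and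
    ((hD.remainder_isLittleO.def (half_pos hκ)).and
      (eventually_branch_bounds ha hD.continuousAt hD.apply_eq)))
  have hC' : 0 < (a + 1 + C) / (sin a / 2) := by
    have := ha.1
    positivity
  refine ⟨(a + 1 + C) / (sin a / 2), η, hC', hη, fun t x ht ht1 hx => ?_⟩
  obtain ⟨hcos, hrem, hsin, hre, hnorm⟩ := hball (line θ (√t * x))
    (by rwa [mem_ball_iff_norm, norm_line_sub])
  set w := line θ (√t * x)
  have hnormalized : ‖normalizedKernel t (D w)‖ ≤ a + 1 + C := by
    have hexp : C * exp (-(b / t)) ≤ C :=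
      mul_le_of_le_one_right hC.le (exp_le_one_iff.2 (neg_nonpos.2 (by positivity)))
    linarith [hkernel t (D w) ht ht1 hre hnorm, norm_sub_norm_le (normalizedKernel t (D w)) (D w)]
  rw [norm_sq_line_sqrt_mul_sub ht] at hrem
  have hexponent : ((-(phaseCurvature c a / 4) * x ^ 2 : ℝ) -
      phaseRemainder c θ z a (D w) w / (4 * t) : ℂ).re ≤ -(phaseCurvature c a / 8) * x ^ 2 := by
    rw [Complex.sub_re, Complex.ofReal_re,
      show (4 * t : ℂ) = ((4 * t : ℝ) : ℂ) by push_cast; rfl, Complex.div_ofReal_re]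
    have hneg := (neg_le_abs _).trans ((Complex.abs_re_le_norm _).trans hrem)
    have hdiv : -(phaseCurvature c a / 8 * x ^ 2) ≤
        (phaseRemainder c θ z a (D w) w).re / (4 * t) := by
      rw [le_div_iff₀ (by positivity)]
      linarith
    linarith
  rw [laplaceIntegrand_eq ht (norm_pos_iff.1 (by linarith)) hcos, norm_mul, norm_div,
    Complex.norm_exp, mul_comm]
  have hbound : 0 ≤ a + 1 + C := by linarith [ha.1]
  gcongr

theorem tendsto_line_sqrt_mul (θ x : ℝ) :
    Tendsto (fun t : ℝ => line θ (√t * x)) (𝓝[>] 0) (𝓝 (θ : ℂ)) := by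
  have hcont : Continuous fun t : ℝ => line θ (√t * x) :=
    (continuous_line θ).comp (Real.continuous_sqrt.mul continuous_const)
  have hlim := hcont.tendsto 0
  rw [Real.sqrt_zero, zero_mul, show line θ 0 = θ by simp [line]] at hlim
  exact hlim.mono_left nhdsWithin_le_nhds

theorem tendsto_normalizedKernel {a : ℝ} (ha : a ∈ Ioo 0 π) {δ : ℝ → ℂ}
    (hδ : Tendsto δ (𝓝[>] 0) (𝓝 (a : ℂ))) :
    Tendsto (fun t => normalizedKernel t (δ t)) (𝓝[>] 0) (𝓝 (a : ℂ)) := by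
  obtain ⟨C, b, -, hb, hkernel⟩ :=
    exists_norm_normalizedKernel_sub_le (show (a + π) / 2 < π by linarith [ha.2]) (a + 1)
  have hexp : Tendsto (fun t : ℝ => C * exp (-(b / t))) (𝓝[>] 0) (𝓝 0) := by
    have hdiv : Tendsto (fun t : ℝ => b / t) (𝓝[>] 0) atTop := by
      simpa only [div_eq_mul_inv] using tendsto_inv_nhdsGT_zero.const_mul_atTop hb
    simpa only [mul_zero, Function.comp_def] using
      (tendsto_exp_neg_atTop_nhds_zero.comp hdiv).const_mul C
  have hsub : Tendsto (fun t => normalizedKernel t (δ t) - δ t) (𝓝[>] 0) (𝓝 0) := by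
    refine squeeze_zero_norm' ?_ hexp
    filter_upwards [Ioc_mem_nhdsGT (zero_lt_one' ℝ),
      hδ.eventually (eventually_branch_bounds ha continuousAt_id rfl)] with t ⟨ht, ht1⟩ hbounds
    exact hkernel t (δ t) ht ht1 hbounds.2.1 hbounds.2.2
  simpa only [sub_add_cancel, zero_add] using hsub.add hδ

theorem IsPhaseBranch.tendsto_remainder_div {c θ z a : ℝ} {D : ℂ → ℂ}
    (hD : IsPhaseBranch c θ z a D) (x : ℝ) :
    Tendsto (fun t : ℝ => phaseRemainder c θ z a (D (line θ (√t * x))) (line θ (√t * x)) / (4 * t))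
      (𝓝[>] 0) (𝓝 0) := by
  have hlittle : (fun t : ℝ =>
      phaseRemainder c θ z a (D (line θ (√t * x))) (line θ (√t * x)) / (4 * t : ℂ)) =o[𝓝[>] 0]
        fun t : ℝ => (line θ (√t * x) - θ) ^ 2 / (4 * t : ℂ) := by
    simp only [div_eq_mul_inv]
    exact (hD.remainder_isLittleO.comp_tendsto (tendsto_line_sqrt_mul θ x)).mul_isBigO
      (isBigO_refl _ _)
  refine (isLittleO_one_iff ℝ).1 (hlittle.trans_isBigO (.of_bound (x ^ 2 / 4) ?_))
  filter_upwards [self_mem_nhdsWithin] with t (ht : 0 < t)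
  rw [norm_div, norm_sq_line_sqrt_mul_sub ht, norm_mul, Complex.norm_of_nonneg ht.le,
    Complex.norm_ofNat, norm_one]
  exact le_of_eq (by field_simp)

theorem IsPhaseBranch.tendsto_laplaceIntegrand {c θ z a : ℝ} (ha : a ∈ Ioo 0 π) {D : ℂ → ℂ}
    (hD : IsPhaseBranch c θ z a D) (x : ℝ) :
    Tendsto (fun t => laplaceIntegrand c θ z a t x) (𝓝[>] 0)
      (𝓝 ((exp (-(phaseCurvature c a / 4) * x ^ 2) * (a / sin a) : ℝ) : ℂ)) := by
  have hline := tendsto_line_sqrt_mul θ x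
  have hbranch : Tendsto (fun t : ℝ => D (line θ (√t * x))) (𝓝[>] 0) (𝓝 (a : ℂ)) :=
    hD.apply_eq ▸ hD.continuousAt.tendsto.comp hline
  have hsin : Complex.sin (a : ℂ) ≠ 0 := mod_cast (sin_pos_of_mem_Ioo ha).ne'
  have hsin_lim := (Complex.continuous_sin.tendsto (a : ℂ)).comp hbranch
  have hlim := ((Complex.continuous_exp.tendsto _).comp
    ((hD.tendsto_remainder_div x).const_sub
      ((-(phaseCurvature c a / 4) * x ^ 2 : ℝ) : ℂ))).mul
    ((tendsto_normalizedKernel ha hbranch).div hsin_lim hsin)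
  rw [sub_zero, ← Complex.ofReal_sin, ← Complex.ofReal_div, ← Complex.ofReal_exp,
    ← Complex.ofReal_mul] at hlim
  refine hlim.congr' ?_
  filter_upwards [self_mem_nhdsWithin, hline.eventually hD.cos_eq,
    hsin_lim.eventually_ne hsin] with t ht hcos hne
  exact (laplaceIntegrand_eq ht hne hcos).symm

theorem tendsto_integral_laplaceIntegrand {c θ z a : ℝ} (hc : c ∈ Ioo 0 1) (ha : a ∈ Ioo 0 π)
    (h : cos a = c * cos θ) (hcrit : θ - z = c * sin θ * (a / sin a)) :
    Tendsto (fun t => ∫ x, laplaceIntegrand c θ z a t x) (𝓝[>] 0)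
      (𝓝 ((√(4 * π / phaseCurvature c a) * (a / sin a) : ℝ) : ℂ)) := by
  obtain ⟨D, hD⟩ := exists_isPhaseBranch (sin_pos_of_mem_Ioo ha).ne' h hcrit
  have hκ := phaseCurvature_pos hc ha
  obtain ⟨C₁, η, hC₁, hη, hnear⟩ := exists_norm_laplaceIntegrand_le_near hc ha hD
  obtain ⟨C₂, ε, hC₂, hε, hfar⟩ := exists_norm_laplaceIntegrand_le_far θ z hc hη
  rw [← h, arccos_cos ha.1.le ha.2.le] at hfar
  have hgauss : ∫ x : ℝ, ((exp (-(phaseCurvature c a / 4) * x ^ 2) * (a / sin a) : ℝ) : ℂ) =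
      ((√(4 * π / phaseCurvature c a) * (a / sin a) : ℝ) : ℂ) := by
    rw [integral_complex_ofReal, integral_mul_const, integral_gaussian, div_div_eq_mul_div,
      mul_comm π]
  rw [← hgauss]
  refine tendsto_integral_filter_of_dominated_convergence
    (fun x => C₁ * exp (-(phaseCurvature c a / 8) * x ^ 2) +
      C₂ * ((1 + |x|) ^ 2 * exp (-(ε * |x|)))) ?_ ?_ ?_
    (.of_forall fun x => hD.tendsto_laplaceIntegrand ha x)
  · filter_upwards [self_mem_nhdsWithin] with t ht
    exact (continuous_laplaceIntegrand c θ z a ht).aestronglyMeasurable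
  · filter_upwards [Ioc_mem_nhdsGT (zero_lt_one' ℝ)] with t ⟨ht, ht1⟩
    refine .of_forall fun x => ?_
    rcases lt_or_ge |√t * x| η with hx | hx
    · exact (hnear t x ht ht1 hx).trans (le_add_of_nonneg_right (by positivity))
    · exact (hfar t x ht ht1 hx).trans (le_add_of_nonneg_left (by positivity))
  · exact ((integrable_exp_neg_mul_sq (by positivity)).const_mul _).add
      ((integrable_one_add_abs_pow_mul_exp hε 2).const_mul _)

theorem integral_laplaceIntegrand (c θ z a : ℝ) {t : ℝ} (ht : 0 < t) :
    ∫ x, laplaceIntegrand c θ z a t x =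
      ((poissonFactor t * exp ((a ^ 2 - (θ - z) ^ 2) / (4 * t)) * (√t)⁻¹ : ℝ) : ℂ) *
        ∫ y, gaussWeight t θ z y * ellipticKernel t (c * Complex.cos (line θ y)) := by
  simp only [laplaceIntegrand]
  rw [integral_const_mul, Measure.integral_comp_mul_left
    (fun y => gaussWeight t θ z y * ellipticKernel t (c * Complex.cos (line θ y))) √t,
    abs_of_pos (inv_pos.2 (Real.sqrt_pos.2 ht)), Complex.real_smul, ← mul_assoc,
    ← Complex.ofReal_mul]

theorem IsHeatKernel.eq_integral_laplaceIntegrand {k : ℝ → SU2 → ℝ} (hk : IsHeatKernel k)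
    (r ϑ z θ a : ℝ) {t : ℝ} (ht : 0 < t) : k t (cyl r ϑ z) =
      √π * exp (-(a ^ 2 - (θ - z) ^ 2) / (4 * t)) / (4 * t ^ (3 / 2 : ℝ)) *
        (exp t * (∫ x, laplaceIntegrand (cos r) θ z a t x).re / (2 * √π)) := by
  have hrpow : t ^ (3 / 2 : ℝ) = t * √t := by
    rw [show (3 / 2 : ℝ) = 1 + 1 / 2 by norm_num, rpow_add ht, rpow_one, ← Real.sqrt_eq_rpow]
  have hsqrt : √(4 * π * t) = 2 * √π * √t := by
    rw [Real.sqrt_mul (by positivity), Real.sqrt_mul (by norm_num),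
      show (4 : ℝ) = 2 ^ 2 by norm_num, Real.sqrt_sq (by norm_num)]
  have := Real.sqrt_pos.2 ht
  have := Real.sqrt_pos.2 pi_pos
  have := Real.sq_sqrt ht.le
  rw [hk.eq_integral r ϑ z θ ht, integral_laplaceIntegrand _ _ _ _ ht, ← Complex.ofReal_inv,
    Complex.re_ofReal_mul, Complex.re_ofReal_mul, hrpow, hsqrt, poissonFactor,
    Real.sqrt_div ht.le, exp_neg t, neg_div, exp_neg]
  field_simp

theorem cos_mem_Ioo_zero_one {r : ℝ} (hr : r ∈ Ioo 0 (π / 2)) : cos r ∈ Ioo 0 1 := by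
  have hcos := cos_lt_cos_of_nonneg_of_le_pi_div_two le_rfl hr.2.le hr.1
  exact ⟨cos_pos_of_mem_Ioo ⟨by linarith [hr.1, pi_pos], hr.2⟩, by rwa [cos_zero] at hcos⟩

theorem sin_pos_of_mem_Ioo_zero_pi_div_two {r : ℝ} (hr : r ∈ Ioo 0 (π / 2)) : 0 < sin r :=
  sin_pos_of_pos_of_lt_pi hr.1 (by linarith [hr.2, pi_pos])

theorem sqrt_four_pi_div_phaseCurvature {r a : ℝ} (hr : 0 < sin r) (ha : a ∈ Ioo 0 π) :
    √(4 * π / phaseCurvature (cos r) a) =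
      2 * √π * sin a / (√(1 - cos a * a / sin a) * sin r) := by
  have hsin := sin_pos_of_mem_Ioo ha
  have hq := one_sub_cos_mul_div_sin_pos ha
  rw [← Real.sqrt_sq (show 0 ≤ 2 * √π * sin a / (√(1 - cos a * a / sin a) * sin r) by positivity),
    phaseCurvature, ← sin_sq, div_pow, mul_pow, mul_pow, mul_pow, Real.sq_sqrt pi_pos.le,
    Real.sq_sqrt hq.le]
  congr 1
  generalize 1 - cos a * a / sin a = q at hq
  field_simp
  norm_num

theorem IsHeatKernel.isEquivalent {k : ℝ → SU2 → ℝ} (hk : IsHeatKernel k) {r z θ a : ℝ}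
    (hr : r ∈ Ioo 0 (π / 2)) (ha : a ∈ Ioo 0 π) (h : cos a = cos r * cos θ)
    (hcrit : θ - z = cos r * sin θ * (a / sin a)) (ϑ : ℝ) :
    (fun t : ℝ => k t (cyl r ϑ z)) ~[𝓝[>] 0] fun t : ℝ =>
      1 / sin r * (a / √(1 - cos a * a / sin a)) *
        (√π * exp (-(a ^ 2 - (θ - z) ^ 2) / (4 * t)) / (4 * t ^ (3 / 2 : ℝ))) := by
  have hsin_r := sin_pos_of_mem_Ioo_zero_pi_div_two hr
  have hsin_a := sin_pos_of_mem_Ioo ha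
  have hsqrt := Real.sqrt_pos.2 (one_sub_cos_mul_div_sin_pos ha)
  have := Real.sqrt_pos.2 pi_pos
  have hexp : Tendsto exp (𝓝[>] 0) (𝓝 1) :=
    exp_zero ▸ (continuous_exp.tendsto 0).mono_left nhdsWithin_le_nhds
  have hre := (Complex.continuous_re.tendsto _).comp
    (tendsto_integral_laplaceIntegrand (cos_mem_Ioo_zero_one hr) ha h hcrit)
  have hlim : Tendsto (fun t => exp t * (∫ x, laplaceIntegrand (cos r) θ z a t x).re / (2 * √π))
      (𝓝[>] 0) (𝓝 (1 / sin r * (a / √(1 - cos a * a / sin a)))) := by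
    rw [Complex.ofReal_re, sqrt_four_pi_div_phaseCurvature hsin_r ha] at hre
    convert! (hexp.mul hre).div_const (2 * √π) using 2
    generalize √(1 - cos a * a / sin a) = q at hsqrt
    field_simp
  have hne : 1 / sin r * (a / √(1 - cos a * a / sin a)) ≠ 0 := by
    have := ha.1
    positivity
  have hequiv := ((isEquivalent_const_iff_tendsto hne).2 hlim).mul (IsEquivalent.refl
    (u := fun t : ℝ => √π * exp (-(a ^ 2 - (θ - z) ^ 2) / (4 * t)) / (4 * t ^ (3 / 2 : ℝ))))
  refine hequiv.congr_left ?_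
  filter_upwards [self_mem_nhdsWithin] with t ht
  rw [hk.eq_integral_laplaceIntegrand r ϑ z θ a ht, mul_comm]
  rfl

/-! ### The critical angle -/

/-- The map whose value at `θ` is the `z` for which the phase at `(r, z)`, `c = cos r`, is critical
at `θ`; the critical angle `θ(r, z)` is its inverse. -/
def criticalMap (c θ : ℝ) : ℝ :=
  θ - c * sin θ * (arccos (c * cos θ) / √(1 - (c * cos θ) ^ 2))

theorem arccos_mem_Ioo {u : ℝ} (hu : |u| < 1) : arccos u ∈ Ioo 0 π := by
  obtain ⟨hneg, hpos⟩ := abs_lt.1 hu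
  exact ⟨arccos_pos.2 hpos, (arccos_le_pi u).lt_of_ne fun h => (arccos_eq_pi.1 h).not_gt hneg⟩

theorem cos_arccos_of_abs_lt {u : ℝ} (hu : |u| < 1) : cos (arccos u) = u :=
  cos_arccos (abs_lt.1 hu).1.le (abs_lt.1 hu).2.le

theorem hasDerivAt_criticalMap {c : ℝ} (hc : c ∈ Ioo 0 1) (θ : ℝ) :
    HasDerivAt (criticalMap c) (phaseCurvature c (arccos (c * cos θ))) θ := by
  have hu := abs_mul_cos_lt_one hc θ
  have hcos := cos_arccos_of_abs_lt hu
  have hsin := sin_pos_of_mem_Ioo (arccos_mem_Ioo hu)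
  have harccos : HasDerivAt (fun θ => arccos (c * cos θ))
      (c * sin θ / sin (arccos (c * cos θ))) θ := by
    refine ((hasDerivAt_arccos (abs_lt.1 hu).1.ne' (abs_lt.1 hu).2.ne).comp θ
      ((hasDerivAt_cos θ).const_mul c)).congr_deriv ?_
    rw [sin_arccos]
    ring
  have hmap : criticalMap c =
      fun θ => θ - c * sin θ * (arccos (c * cos θ) / sin (arccos (c * cos θ))) := by
    funext θ
    rw [criticalMap, sin_arccos]
  rw [hmap]
  refine ((hasDerivAt_id θ).fun_sub (((hasDerivAt_sin θ).const_mul c).fun_mul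
    (harccos.fun_div harccos.sin hsin.ne'))).congr_deriv ?_
  have hsq := sq_mul_sin_sq hcos
  set a := arccos (c * cos θ)
  rw [phaseCurvature, ← hcos]
  field_simp
  linear_combination -(sin a - a * cos a) * (hsq - sin_sq_add_cos_sq a)

theorem strictMono_criticalMap {c : ℝ} (hc : c ∈ Ioo 0 1) : StrictMono (criticalMap c) :=
  strictMono_of_deriv_pos fun θ => by
    rw [(hasDerivAt_criticalMap hc θ).deriv]
    exact phaseCurvature_pos hc (arccos_mem_Ioo (abs_mul_cos_lt_one hc θ))

theorem continuous_criticalMap {c : ℝ} (hc : c ∈ Ioo 0 1) : Continuous (criticalMap c) :=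
  continuous_iff_continuousAt.2 fun θ => (hasDerivAt_criticalMap hc θ).continuousAt

theorem criticalMap_int_mul_pi (c : ℝ) (n : ℤ) : criticalMap c (n * π) = n * π := by
  rw [criticalMap, sin_int_mul_pi, mul_zero, zero_mul, sub_zero]

theorem existsUnique_criticalMap_eq {c : ℝ} (hc : c ∈ Ioo 0 1) (z : ℝ) :
    ∃! θ, criticalMap c θ = z := by
  obtain ⟨m, hm⟩ := exists_int_lt (z / π)
  obtain ⟨n, hn⟩ := exists_int_gt (z / π)
  rw [lt_div_iff₀ pi_pos] at hm
  rw [div_lt_iff₀ pi_pos] at hn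
  obtain ⟨θ, hθ⟩ := mem_range_of_exists_le_of_exists_ge (continuous_criticalMap hc)
    ⟨m * π, (criticalMap_int_mul_pi c m).trans_le hm.le⟩
    ⟨n * π, hn.le.trans_eq (criticalMap_int_mul_pi c n).symm⟩
  exact ⟨θ, hθ, fun θ' hθ' => (strictMono_criticalMap hc).injective (hθ'.trans hθ.symm)⟩

theorem isCriticalAngle_iff {r z θ : ℝ} :
    IsCriticalAngle r z θ ↔ θ ∈ Icc (-π) π ∧ criticalMap (cos r) θ = z := by
  rw [IsCriticalAngle, criticalMap, mul_comm (cos θ), mul_pow, sub_eq_iff_eq_add',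
    sub_eq_iff_eq_add]

theorem isCriticalAngle_iff_criticalMap_eq {r z θ : ℝ} (hr : r ∈ Ioo 0 (π / 2))
    (hz : z ∈ Icc (-π) π) : IsCriticalAngle r z θ ↔ criticalMap (cos r) θ = z := by
  refine isCriticalAngle_iff.trans (and_iff_right_of_imp ?_)
  rintro rfl
  have hmono := strictMono_criticalMap (cos_mem_Ioo_zero_one hr)
  have hpi := criticalMap_int_mul_pi (cos r) 1
  have hneg_pi := criticalMap_int_mul_pi (cos r) (-1)
  simp only [Int.cast_one, one_mul, Int.cast_neg, neg_one_mul] at hpi hneg_pi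
  exact ⟨hmono.le_iff_le.1 (hneg_pi.trans_le hz.1), hmono.le_iff_le.1 (hz.2.trans_eq hpi.symm)⟩

theorem expo_criticalMap {r : ℝ} (hr : r ∈ Ioo 0 (π / 2)) (θ : ℝ) :
    expo r (criticalMap (cos r) θ) θ =
      arccos (cos r * cos θ) ^ 2 - (θ - criticalMap (cos r) θ) ^ 2 := by
  have hu := abs_mul_cos_lt_one (cos_mem_Ioo_zero_one hr) θ
  have hcos := cos_arccos_of_abs_lt hu
  have hsin := sin_pos_of_mem_Ioo (arccos_mem_Ioo hu)
  have hcos_r := (cos_mem_Ioo_zero_one hr).1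
  rw [expo, criticalMap, sub_sub_cancel, ← sin_arccos, tan_eq_sin_div_cos]
  split_ifs with hθ
  · rw [hθ]
    ring
  · have hsq := sq_mul_sin_sq hcos
    set a := arccos (cos r * cos θ)
    field_simp
    linear_combination a ^ 2 * (hsq - sin_sq_add_cos_sq a + sin_sq_add_cos_sq r)

theorem IsHeatKernel.isEquivalent_criticalMap {k : ℝ → SU2 → ℝ} (hk : IsHeatKernel k)
    {r : ℝ} (hr : r ∈ Ioo 0 (π / 2)) (ϑ θ : ℝ) :
    (fun t : ℝ => k t (cyl r ϑ (criticalMap (cos r) θ))) ~[𝓝[>] 0] fun t : ℝ =>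
      1 / sin r * (arccos (cos r * cos θ) / √(1 - cos r * cos θ * arccos (cos r * cos θ) /
        √(1 - (cos r * cos θ) ^ 2))) *
        (√π * exp (-expo r (criticalMap (cos r) θ) θ / (4 * t)) / (4 * t ^ (3 / 2 : ℝ))) := by
  have hu := abs_mul_cos_lt_one (cos_mem_Ioo_zero_one hr) θ
  have hcos := cos_arccos_of_abs_lt hu
  have hcrit : θ - criticalMap (cos r) θ =
      cos r * sin θ * (arccos (cos r * cos θ) / sin (arccos (cos r * cos θ))) := by
    rw [criticalMap, sub_sub_cancel, sin_arccos]
  have hequiv := hk.isEquivalent hr (arccos_mem_Ioo hu) hcos hcrit ϑ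
  rwa [hcos, sin_arccos, ← expo_criticalMap hr] at hequiv

theorem IsHeatKernel.isEquivalent_zero {k : ℝ → SU2 → ℝ} (hk : IsHeatKernel k) (ϑ : ℝ)
    {r : ℝ} (hr : r ∈ Ioo 0 (π / 2)) :
    (fun t : ℝ => k t (cyl r ϑ 0)) ~[𝓝[>] 0] fun t : ℝ =>
      r / sin r * √(1 / (1 - r * cot r)) *
        (√π * exp (-r ^ 2 / (4 * t)) / (4 * t ^ (3 / 2 : ℝ))) := by
  have hr_mem : r ∈ Ioo 0 π := ⟨hr.1, by linarith [hr.2, pi_pos]⟩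
  have hequiv := hk.isEquivalent (z := 0) (θ := 0) hr hr_mem (by simp) (by simp) ϑ
  rw [sub_zero, zero_pow two_ne_zero, sub_zero] at hequiv
  convert hequiv using 3
  rw [cot_eq_cos_div_sin, Real.sqrt_div zero_le_one, Real.sqrt_one,
    show r * (cos r / sin r) = cos r * r / sin r by ring]
  ring

end

end SU2

theorem proposition3p9_general (p : ℝ → SU2 → ℝ) (hp : SU2.IsHeatKernel p) :
    (∀ ϑ z t : ℝ, 0 < t →
      HasSum (fun k : ℤ => SU2.axisFactor t z * SU2.axisTerm t z k) (p t (SU2.cyl 0 ϑ z))) ∧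
    (∀ ϑ z : ℝ, z ∈ Ioc 0 π → ∃ C : ℝ, 0 < C ∧
      (fun t : ℝ => p t (SU2.cyl 0 ϑ z) / SU2.axisFactor t z - 1)
        =O[𝓝[>] 0] fun t : ℝ => exp (-C / t)) ∧
    (∀ ϑ r : ℝ, r ∈ Ioo 0 (π / 2) →
      (fun t : ℝ => p t (SU2.cyl r ϑ 0)) ~[𝓝[>] 0] fun t : ℝ =>
        r / sin r * √(1 / (1 - r * cot r)) *
          (√π * exp (-r ^ 2 / (4 * t)) / (4 * t ^ (3 / 2 : ℝ)))) ∧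
    (∀ r z : ℝ, r ∈ Ioo 0 (π / 2) → (∃! θ : ℝ, SU2.criticalMap (cos r) θ = z) ∧
      ∀ θ u : ℝ, SU2.criticalMap (cos r) θ = z → u = cos r * cos θ → ∀ ϑ : ℝ,
        (fun t : ℝ => p t (SU2.cyl r ϑ z)) ~[𝓝[>] 0] fun t : ℝ =>
          1 / sin r * (arccos u / √(1 - u * arccos u / √(1 - u ^ 2))) *
            (√π * exp (-SU2.expo r z θ / (4 * t)) / (4 * t ^ (3 / 2 : ℝ)))) := by
  refine ⟨fun ϑ z t ht => hp.hasSum_axis ϑ z ht, fun ϑ z hz => ⟨π * z / 2, ?_, ?_⟩,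
    fun ϑ r hr => hp.isEquivalent_zero ϑ hr, fun r z hr => ⟨?_, ?_⟩⟩
  · exact half_pos (mul_pos pi_pos hz.1)
  · exact hp.isBigO_axis ϑ hz.2
  · exact SU2.existsUnique_criticalMap_eq (SU2.cos_mem_Ioo_zero_one hr) z
  · rintro θ u rfl rfl ϑ
    exact hp.isEquivalent_criticalMap hr ϑ θ

theorem proposition3p9 (p : ℝ → SU2 → ℝ) (hp : SU2.IsHeatKernel p) :
    -- the points `(0, z)`: exact series formula, and its consequence as `t → 0+`
    (∀ ϑ z t : ℝ, z ∈ Icc 0 π → 0 < t →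
      HasSum (fun k : ℤ =>
        π ^ 2 * exp t / (4 * t ^ 2) * exp (-(2 * π * z - z ^ 2) / (4 * t)) *
          (exp (-((k : ℝ) * (k + 1) * π ^ 2 / t)) *
            ((2 * (k : ℝ) + 1 + 2 * (k : ℝ) * exp (-(π / (2 * t) * (z + 2 * k * π)))) /
              (1 + exp (-(π / (2 * t) * (z + 2 * k * π)))) ^ 2)))
        (p t (SU2.cyl 0 ϑ z))) ∧
    (∀ ϑ z : ℝ, z ∈ Ioc 0 π → ∃ C : ℝ, 0 < C ∧
      (fun t : ℝ => p t (SU2.cyl 0 ϑ z) /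
          (π ^ 2 * exp t / (4 * t ^ 2) * exp (-(2 * π * z - z ^ 2) / (4 * t))) - 1)
        =O[𝓝[>] 0] fun t : ℝ => exp (-C / t)) ∧
    -- the points `(r, 0)`, `r ≠ 0`
    (∀ ϑ r : ℝ, r ∈ Ioo 0 (π / 2) →
      (fun t : ℝ => p t (SU2.cyl r ϑ 0)) ~[𝓝[>] 0] fun t : ℝ =>
        r / sin r * √(1 / (1 - r * cot r)) *
          (√π * exp (-r ^ 2 / (4 * t)) / (4 * t ^ (3 / 2 : ℝ)))) ∧
    -- the points `(r, z)`, `r ≠ 0`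
    (∀ r z : ℝ, r ∈ Ioo 0 (π / 2) → z ∈ Icc (-π) π →
      (∃! θ : ℝ, SU2.IsCriticalAngle r z θ) ∧
      ∀ θ u : ℝ, SU2.IsCriticalAngle r z θ → u = cos r * cos θ → ∀ ϑ : ℝ,
        (fun t : ℝ => p t (SU2.cyl r ϑ z)) ~[𝓝[>] 0] fun t : ℝ =>
          1 / sin r * (arccos u / √(1 - u * arccos u / √(1 - u ^ 2))) *
            (√π * exp (-SU2.expo r z θ / (4 * t)) / (4 * t ^ (3 / 2 : ℝ)))) := by
  obtain ⟨hseries, haxis, hzero, hcritical⟩ := proposition3p9_general p hp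
  refine ⟨fun ϑ z t _ => hseries ϑ z t, haxis, hzero, fun r z hr hz => ?_⟩
  simpa only [SU2.isCriticalAngle_iff_criticalMap_eq hr hz] using hcritical r z hr
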